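/- **Conventions.** For $k<0$ let $M^2_k$ be the hyperbolic plane with its metric multiplied by $1/\sqrt{-k}$. An $M_k$-simplicial $2$-complex is a locally finite simplicial complex $K$ of dimension at most $2$ whose simplices are geodesic simplices of $M^2_k$ (nondegenerate), glued by isometries of their faces. The link of a vertex $v$ is the metric graph whose vertices are the edges of $K$ at $v$ and whose edges are the $2$-simplices of $K$ at $v$, the length of such an edge being the angle of the $2$-simplex at $v$; distances in the link are path distances, and are $\infty$ between different components. $K$ is *negatively curved (of curvature $k$)* if it satisfies Gromov's link condition: the link of every vertex is CAT(1), i.e. contains no essential loop of length less than $2\pi$. A *closed geodesic* is a closed simplicial path $(e_1,\dots,e_n)$, $n\ge 1$, such that at each of its vertices, including the one between $e_n$ and $e_1$, the distance in the link between the incoming and the outgoing edge is at least $\pi$. It *intersects itself transversely* if $e_i\ne e_j$ and $\bar e_i\neq e_j$ for all $i\ne j$, where $\bar e$ denotes $e$ with the opposite orientation. Two closed geodesics $(e_i)$, $(e'_j)$ *intersect transversely* if $e_i\neq e'_j$ and $\bar e_i\ne e'_j$ for all $i,j$. A subgroup $H$ of a group $G$ is *malnormal* if $x^{-1}Hx\cap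 H=\{1\}$ for all $x\notin H$. Subgroups $H_1,\dots,H_m$ form a *malnormal family* if each $H_a$ is malnormal and $x^{-1}H_ax\cap y^{-1}H_by=\{1\}$ for all $a\neq b$ and all $x,y\in G$. **Lemma.** Let $K$ be a negatively curved simplicial $2$-complex of curvature $k<0$. Let $\gamma^{(1)},\dots,\gamma^{(m)}$ be simplicial closed geodesics in $K$, let $x_0$ be a point of $K$, and for each $a$ let $p_a$ be a path in $K$ from $x_0$ to the starting point of $\gamma^{(a)}$. Suppose that the cyclic subgroups $\langle [p_a\gamma^{(a)}p_a^{-1}]\rangle$ $(1\le a\le m)$ of $\pi_1(K,x_0)$ form a malnormal family. Then there are a number $\bar k$ with $k\le\bar k<0$ and a $2$-complex $\bar K$ such that: * $\bar K$ is a negatively curved simplicial $2$-complex of curvature $\bar k$; * there is an inclusion $i\colon K\to\bar K$ of $K$ as a simplicial subcomplex (not necessarily isometric), and a deformation retraction $r\colon\bar K\to K$, that is, $r$ is continuous, $r\circ i=\mathrm{id}_K$, and $i\circ r$ is homotopic to $\mathrm{id}_{\bar K}$ by a homotopy that is constant on $i(K)$; * there are simplicial closed geodesics $\bar\gamma^{(1)},\dots,\bar\gamma^{(m)}$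 in $\bar K$ such that $r(\bar\gamma^{(a)})=\gamma^{(a)}$ for each $a$, as based oriented loops up to reparametrization by an increasing homeomorphism of $[0,1]$, and such that each $\bar\gamma^{(a)}$ intersects itself transversely and $\bar\gamma^{(a)}$, $\bar\gamma^{(b)}$ intersect transversely for all $a\neq b$. -/

import Mathlib

open scoped ENNReal unitInterval

universe u

noncomputable section

/-! ## Malnormal families of subgroups -/

/-- `H` is malnormal if `x⁻¹ H x ∩ H = {1}` for every `x ∉ H`. -/
def IsMalnormal {G : Type*} [Group G] (H : Subgroup G) : Prop :=
  ∀ x : G, x ∉ H → H.map (MulAut.conj x⁻¹).toMonoidHom ⊓ H = ⊥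

/-- A family `H` of subgroups is malnormal if each member is malnormal and
`x⁻¹ H i x ∩ y⁻¹ H j y = {1}` for all `i ≠ j` and all `x`, `y`. -/
def IsMalnormalFamily {G ι : Type*} [Group G] (H : ι → Subgroup G) : Prop :=
  (∀ i, IsMalnormal (H i)) ∧
    ∀ i j, i ≠ j → ∀ x y : G,
      (H i).map (MulAut.conj x⁻¹).toMonoidHom ⊓ (H j).map (MulAut.conj y⁻¹).toMonoidHom = ⊥

/-! ## Simplicial complexes and their geometric realizations -/

namespace AbstractSimplicialComplex

variable {V W : Type*}

/-- Two distinct vertices are adjacent if they span an edge. -/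
def Adj (K : AbstractSimplicialComplex V) (u w : V) : Prop :=
  u ≠ w ∧ ∃ s ∈ K.faces, u ∈ s ∧ w ∈ s

/-- The three vertices `u`, `v`, `w` are distinct and span a 2-simplex. -/
def IsTriangle (K : AbstractSimplicialComplex V) (u v w : V) : Prop :=
  u ≠ v ∧ v ≠ w ∧ u ≠ w ∧ ∃ s ∈ K.faces, u ∈ s ∧ v ∈ s ∧ w ∈ s

/-- The geometric realization `|K|`, through barycentric coordinates: nonnegative functions on the
vertices that are supported in a simplex and have sum one. -/
def Realization (K : AbstractSimplicialComplex V) : Type _ :=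
  {t : V → ℝ // (∀ v, 0 ≤ t v) ∧ ∃ s ∈ K.faces, (∀ v, v ∉ s → t v = 0) ∧ ∑ v ∈ s, t v = 1}

/-- The topology of convergence of barycentric coordinates. On a locally finite complex this is
the usual (weak) topology, and also the topology of any piecewise hyperbolic path metric. -/
instance (K : AbstractSimplicialComplex V) : TopologicalSpace K.Realization :=
  inferInstanceAs (TopologicalSpace {t : V → ℝ // (∀ v, 0 ≤ t v) ∧
    ∃ s ∈ K.faces, (∀ v, v ∉ s → t v = 0) ∧ ∑ v ∈ s, t v = 1})

/-- The vertex `v` as a point of `|K|`. -/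
def vertexPoint (K : AbstractSimplicialComplex V) (v : V) : K.Realization :=
  ⟨Set.indicator {v} 1, fun w => Set.indicator_nonneg (fun _ _ => zero_le_one) w,
    {v}, K.singleton_mem v, fun w hw => by simpa using hw, by simp⟩

/-- The edge from `u` to `w`, run through linearly. -/
def edgePath (K : AbstractSimplicialComplex V) {u w : V} (h : K.Adj u w) :
    Path (K.vertexPoint u) (K.vertexPoint w) where
  toFun t := ⟨fun x => (1 - (t : ℝ)) * Set.indicator {u} 1 x + (t : ℝ) * Set.indicator {w} 1 x, by
    classical
    obtain ⟨huw, s, hs, hu, hw⟩ := h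
    refine ⟨fun x => ?_, s, hs, fun x hx => ?_, ?_⟩
    · have h1 : (0 : ℝ) ≤ Set.indicator {u} 1 x :=
        Set.indicator_nonneg (fun _ _ => zero_le_one) x
      have h2 : (0 : ℝ) ≤ Set.indicator {w} 1 x :=
        Set.indicator_nonneg (fun _ _ => zero_le_one) x
      have h3 := t.2.1
      have h4 : (0 : ℝ) ≤ 1 - t := sub_nonneg.2 t.2.2
      positivity
    · have h1 : x ≠ u := fun e => hx (e ▸ hu)
      have h2 : x ≠ w := fun e => hx (e ▸ hw)
      simp [h1, h2]
    · rw [Finset.sum_add_distrib, ← Finset.mul_sum, ← Finset.mul_sum]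
      simp [Set.indicator_apply, hu, hw]⟩
  continuous_toFun := by
    refine Continuous.subtype_mk (continuous_pi fun x => ?_) _
    fun_prop
  source' := Subtype.ext (by funext x; simp [vertexPoint])
  target' := Subtype.ext (by funext x; simp [vertexPoint])

/-- The concatenation of the edges `f 0 f 1`, `f 1 f 2`, …, `f (n - 1) f n`. -/
def pathAlong (K : AbstractSimplicialComplex V) (f : ℕ → V) (h : ∀ j, K.Adj (f j) (f (j + 1))) :
    (n : ℕ) → Path (K.vertexPoint (f 0)) (K.vertexPoint (f n))
  | 0 => Path.refl _
  | n + 1 => (pathAlong K f h n).trans (K.edgePath (h n))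

/-- The injective vertex map `i` embeds `K` in `L` as a subcomplex. -/
def IsInclusion (K : AbstractSimplicialComplex V) (L : AbstractSimplicialComplex W)
    (i : V ↪ W) : Prop :=
  ∀ s ∈ K.faces, s.map i ∈ L.faces

/-- The inclusion `|K| → |L|` of geometric realizations, linear on each simplex. -/
def inclusionMap {K : AbstractSimplicialComplex V} {L : AbstractSimplicialComplex W} {i : V ↪ W}
    (hi : IsInclusion K L i) : C(K.Realization, L.Realization) where
  toFun t := ⟨Function.extend i t.1 0, by
    obtain ⟨t, h0, s, hs, hsupp, hsum⟩ := t
    refine ⟨fun w => ?_, s.map i, hi s hs, fun w hw => ?_, ?_⟩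
    · by_cases hw : ∃ v, i v = w
      · obtain ⟨v, rfl⟩ := hw
        simpa [i.injective.extend_apply] using h0 v
      · simp [Function.extend_apply' _ _ _ hw]
    · by_cases hw' : ∃ v, i v = w
      · obtain ⟨v, rfl⟩ := hw'
        have hv : v ∉ s := fun hv => hw (Finset.mem_map_of_mem i hv)
        simpa [i.injective.extend_apply] using hsupp v hv
      · simp [Function.extend_apply' _ _ _ hw']
    · simpa [i.injective.extend_apply] using hsum⟩
  continuous_toFun := by
    refine Continuous.subtype_mk (continuous_pi fun w => ?_) _
    by_cases hw : ∃ v, i v = w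
    · obtain ⟨v, rfl⟩ := hw
      simp only [i.injective.extend_apply]
      exact (continuous_apply v).comp continuous_subtype_val
    · simp only [Function.extend_apply' _ _ _ hw]
      exact continuous_const

/-- `r` is a deformation retraction of `|L|` onto the subcomplex `|K|`: it restricts to the identity
on `|K|`, and the identity of `|L|` is homotopic to it by a homotopy that fixes `|K|`. -/
def IsDeformationRetraction {K : AbstractSimplicialComplex V} {L : AbstractSimplicialComplex W}
    {i : V ↪ W} (hi : IsInclusion K L i) (r : C(L.Realization, K.Realization)) : Prop :=
  r.comp (inclusionMap hi) = ContinuousMap.id _ ∧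
    (ContinuousMap.id _).HomotopicRel ((inclusionMap hi).comp r) (Set.range (inclusionMap hi))

end AbstractSimplicialComplex

/-! ## Piecewise hyperbolic 2-complexes -/

/-- The angle between the sides of lengths `a` and `b` in a triangle of the rescaled hyperbolic
plane `M²ₖ` (`k < 0`) whose third side has length `c`, by the hyperbolic law of cosines. -/
def hyperbolicAngle (k a b c : ℝ) : ℝ :=
  Real.arccos ((Real.cosh (√(-k) * a) * Real.cosh (√(-k) * b) - Real.cosh (√(-k) * c)) /
    (Real.sinh (√(-k) * a) * Real.sinh (√(-k) * b)))

/-- The data of a locally finite `Mₖ`-simplicial complex of dimension at most two, `k < 0`: a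
simplicial complex in which every simplex is a geodesic simplex of `M²ₖ`, glued by isometries of
faces. A geodesic triangle of `M²ₖ` is determined by its side lengths up to isometry, and the
possible side lengths of nondegenerate ones are those that satisfy the strict triangle
inequalities; two triangles are glued along sides of equal length. So the geometry is given by the
lengths of the edges, for any `k`. (Values of `length` on pairs that are not edges are unused.) -/
structure HyperbolicTwoComplex (V : Type*) extends AbstractSimplicialComplex V where
  card_le_three : ∀ s ∈ faces, s.card ≤ 3
  locallyFinite : ∀ v : V, {s | s ∈ faces ∧ v ∈ s}.Finite
  length : Sym2 V → ℝ
  length_pos : ∀ u w, toAbstractSimplicialComplex.Adj u w → 0 < length s(u, w)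
  length_lt_add : ∀ u v w, toAbstractSimplicialComplex.IsTriangle u v w →
    length s(u, w) < length s(u, v) + length s(v, w)

namespace HyperbolicTwoComplex

variable {V : Type*}

/-- The geometric realization `|K|`. -/
abbrev Space (K : HyperbolicTwoComplex V) : Type _ :=
  K.toAbstractSimplicialComplex.Realization

/-- The angle at `v` of the triangle `v u w`, in curvature `k`. -/
def angle (K : HyperbolicTwoComplex V) (k : ℝ) (v u w : V) : ℝ :=
  hyperbolicAngle k (K.length s(v, u)) (K.length s(v, w)) (K.length s(u, w))

/-- The link of the vertex `v`, a graph: its vertices are the edges of `K` at `v` (given by their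
other endpoints), its edges are the 2-simplices of `K` at `v`. (Elements of `V` that are not
adjacent to `v` are isolated, and play no role.) -/
def link (K : HyperbolicTwoComplex V) (v : V) : SimpleGraph V where
  Adj u w := K.IsTriangle u v w
  symm := ⟨fun _ _ ⟨h1, h2, h3, s, hs, hu, hv, hw⟩ =>
    ⟨h2.symm, h1.symm, h3.symm, s, hs, hw, hv, hu⟩⟩
  loopless := ⟨fun _ h => h.2.2.1 rfl⟩

/-- The length of a walk in the link of `v`, in which the edge of a 2-simplex has the angle of this
2-simplex at `v` as its length. -/
def linkLength (K : HyperbolicTwoComplex V) (k : ℝ) (v : V) {u w : V} (p : (K.link v).Walk u w) :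
    ℝ :=
  (p.darts.map fun d => K.angle k v d.fst d.snd).sum

/-- The path metric on the vertices of the link of `v`; it is `∞` between different components. -/
def linkDist (K : HyperbolicTwoComplex V) (k : ℝ) (v u w : V) : ℝ≥0∞ :=
  ⨅ p : (K.link v).Walk u w, ENNReal.ofReal (K.linkLength k v p)

/-- `K`, with simplices of curvature `k`, is negatively curved if `k < 0` and Gromov's link
condition holds: the metric graph `link v` is CAT(1), that is, contains no essential loop of length
less than `2π`, for each vertex `v`. (Every essential loop of a graph contains an embedded one.) -/
def IsNegativelyCurved (K : HyperbolicTwoComplex V) (k : ℝ) : Prop :=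
  k < 0 ∧ ∀ (v u : V) (p : (K.link v).Walk u u), p.IsCycle → 2 * Real.pi ≤ K.linkLength k v p

/-- A closed simplicial path with `n ≥ 1` edges, given by its cyclic sequence of vertices. -/
structure ClosedPath (K : HyperbolicTwoComplex V) where
  n : ℕ
  n_pos : 0 < n
  vertex : ZMod n → V
  adj : ∀ j, K.Adj (vertex j) (vertex (j + 1))

namespace ClosedPath

variable {K : HyperbolicTwoComplex V}

/-- The point of `|K|` at which the closed path starts. -/
def start (γ : K.ClosedPath) : K.Space :=
  K.vertexPoint (γ.vertex 0)

/-- The closed path as a loop in `|K|`, its edges being run through one after another. -/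
def loop (γ : K.ClosedPath) : Path γ.start γ.start :=
  (K.pathAlong (fun j : ℕ => γ.vertex (j : ZMod γ.n))
      (fun j => by simpa using γ.adj (j : ZMod γ.n)) γ.n).cast
    (by simp [start]) (by simp [start])

/-- The `j`-th edge, without its orientation. -/
def edge (γ : K.ClosedPath) (j : ZMod γ.n) : Sym2 V :=
  s(γ.vertex j, γ.vertex (j + 1))

/-- A closed path is a closed geodesic if at each of its vertices the angle that it subtends, i.e.
the distance in the link between its incoming and outgoing edge, is at least `π`. -/
def IsGeodesic (γ : K.ClosedPath) (k : ℝ) : Prop :=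
  ∀ j, ENNReal.ofReal Real.pi ≤
    K.linkDist k (γ.vertex j) (γ.vertex (j - 1)) (γ.vertex (j + 1))

/-- No edge is run through twice, in the same or in opposite directions. -/
def IntersectsSelfTransversely (γ : K.ClosedPath) : Prop :=
  ∀ i j, i ≠ j → γ.edge i ≠ γ.edge j

/-- The two closed paths do not share an edge. -/
def IntersectsTransversely (γ γ' : K.ClosedPath) : Prop :=
  ∀ i j, γ.edge i ≠ γ'.edge j

/-- The cyclic subgroup of `π₁(|K|, x₀)` that a closed path and a path `p` from `x₀` to its
starting point determine. Another choice of `p` gives a conjugate subgroup. -/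
def cyclicSubgroup (γ : K.ClosedPath) {x₀ : K.Space} (p : Path x₀ γ.start) :
    Subgroup (FundamentalGroup K.Space x₀) :=
  Subgroup.zpowers (FundamentalGroup.fromPath
    (Path.Homotopic.Quotient.mk ((p.trans γ.loop).trans p.symm)))

end ClosedPath

end HyperbolicTwoComplex

end

/-!
The proof enlarges `K` step by step. One step (`GeodesicSystem.enlarge`) adds a new vertex for each
edge `e` of the geodesics, a triangle that joins it to `e`, and, wherever a geodesic passes at a
vertex `v` from `e` to `e'`, a triangle that joins `v` to the new vertices of `e` and `e'`. The new
complex retracts to the old one: a new vertex goes to the midpoint of its edge. The new geodesics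
run through the new vertices instead of the old ones. As their vertices are the edges of the old
geodesics, a stretch of `N` vertices that two of them have in common comes from a common stretch of
`N + 1` vertices of the old ones (`GeodesicSystem.IsSeparated.lift`). After enough steps no edge is
left in common, provided that the original geodesics have no arbitrarily long common stretches. Two
steps are carried out at a time, since then the retraction maps each new edge linearly onto an
old one.

The curvature bound `k` can be kept. The lengths of the old edges are halved, which strictly
increases the angles of all triangles by `hyperbolicAngle_lt_half` and so gains some room in the
links of the old vertices. The new triangles are almost degenerate. Those of the turns have an angle
close to `π` at the old vertex `v`, and the loss is made up for by this room, as the two edges of a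
geodesic subtend at least `π` in the old link (`GeodesicSystem.two_pi_le_linkLength_inl`). The links
of new vertices are trees, and if the new triangles over the edges are much flatter than those of
the turns, then the new geodesics subtend at least `π` in them (`GeodesicSystem.lift`).

Long common stretches are impossible by malnormality. If two geodesics agree along a common multiple
of their periods, then they agree altogether, and nontrivial powers of conjugates of their classes
coincide up to inversion (`GeodesicSystem.isSeparated_of_isMalnormalFamily`). This argument needs
that no power of a closed geodesic is null-homotopic. A null-homotopic edge path bounds a singular
disc diagram; this is seen by lifting it to a covering of `K` whose sheets are words of edges up to
equivalence (`exists_nullWord_of_homotopic`). Disc diagrams are encoded by derivations of their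
boundary words, `NullWord`. In a diagram of least area the link condition bounds the angle at each
interior vertex from below by `2π`, while the angle sum of each triangle is at most `π`, and
so the exterior angles of the boundary add up to at least `2π`
(`HyperbolicTwoComplex.gaussBonnet`). Along a closed geodesic none of them is positive.
-/

noncomputable section

/-! ### Null words and their areas -/

/-- `NullWord T n w`: the word `w` of oriented edges bounds a singular disc diagram with `n`
triangles, where `T x y z` says that `x`, `y`, `z` span a triangle. The derivation peels a diagram
off at the first edge of its boundary: this edge is either a bridge, traversed a second time later
on, or a side of a triangle, which is removed. Words need not be composable. -/
inductive NullWord {V : Type*} (T : V → V → V → Prop) : ℕ → List (V × V) → Prop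
  | nil : NullWord T 0 []
  | pair {m n : ℕ} {c v : List (V × V)} {x y : V} : NullWord T m c → NullWord T n v →
      NullWord T (m + n) ((x, y) :: (c ++ (y, x) :: v))
  | tri {n : ℕ} {v : List (V × V)} {x y z : V} : T x y z →
      NullWord T n ((x, y) :: (y, z) :: v) → NullWord T (n + 1) ((x, z) :: v)

namespace NullWord

variable {V : Type*} {T : V → V → V → Prop}

theorem of_cons {n : ℕ} {x z : V} {v : List (V × V)} (h : NullWord T n ((x, z) :: v)) :
    (∃ c v' m₁ m₂, v = c ++ (z, x) :: v' ∧ n = m₁ + m₂ ∧ NullWord T m₁ c ∧ NullWord T m₂ v') ∨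
      ∃ y n', n = n' + 1 ∧ T x y z ∧ NullWord T n' ((x, y) :: (y, z) :: v) := by
  cases h with
  | pair h1 h2 => exact Or.inl ⟨_, _, _, _, rfl, rfl, h1, h2⟩
  | tri hT h => exact Or.inr ⟨_, _, rfl, hT, h⟩

theorem cast_eq {n m : ℕ} {v w : List (V × V)} (h : NullWord T n v) (hn : n = m) (hv : v = w) :
    NullWord T m w := hn ▸ hv ▸ h

theorem concat {m n : ℕ} {c v : List (V × V)} (hc : NullWord T m c) (hv : NullWord T n v) :
    NullWord T (m + n) (c ++ v) := by
  induction hc with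
  | nil => simpa using hv
  | @pair _ _ _ _ x y h1 _ _ ih2 =>
    exact (pair (x := x) (y := y) h1 ih2).cast_eq (by omega) (by simp)
  | tri hT _ ih => exact (tri hT ih).cast_eq (by omega) (by simp)

/-- A null word may be inserted anywhere in a null word. -/
theorem insert {m : ℕ} {c : List (V × V)} (hc : NullWord T m c) {n : ℕ} {u v : List (V × V)}
    (h : NullWord T n (u ++ v)) : NullWord T (m + n) (u ++ c ++ v) := by
  suffices H : ∀ (N n : ℕ) (u v : List (V × V)), 2 * n + (u ++ v).length < N →
      NullWord T n (u ++ v) → NullWord T (m + n) (u ++ c ++ v) from H _ n u v (Nat.lt_succ_self _) h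
  intro N
  induction N with
  | zero => intro n u v hN; omega
  | succ N ih =>
    intro n u v hN h
    cases u with
    | nil => simpa using hc.concat h
    | cons e u =>
      obtain ⟨x, z⟩ := e
      rcases of_cons h with ⟨d, w, m₁, m₂, hv, rfl, h1, h2⟩ | ⟨y, n', rfl, hT, h'⟩
      · simp only [List.append_eq] at hv
        rcases List.append_eq_append_iff.1 hv with ⟨a, rfl, ha⟩ | ⟨a, rfl, ha⟩
        · have := ih m₁ u a (by simp [ha] at hN ⊢; omega) h1
          exact (pair (x := x) (y := z) this h2).cast_eq (by omega) (by simp [ha])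
        · cases a with
          | nil =>
            simp only [List.nil_append] at ha
            subst ha
            have := h1.concat hc
            exact (pair (x := x) (y := z) this h2).cast_eq (by omega) (by simp)
          | cons f a =>
            simp only [List.cons_append, List.cons.injEq] at ha
            obtain ⟨rfl, rfl⟩ := ha
            have := ih m₂ a v (by simp at hN ⊢; omega) h2
            exact (pair (x := x) (y := z) h1 this).cast_eq (by omega) (by simp)
      · have := ih n' ((x, y) :: (y, z) :: u) v (by simp at hN ⊢; omega) h'
        exact (tri hT this).cast_eq (by omega) (by simp)

/-- Rotation of words of area at most `N` implies that triangles may be glued to any edge. -/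
theorem tri_mid_aux {N : ℕ} (hT' : ∀ x y z, T x y z → T y z x)
    (hrot : ∀ n ≤ N, ∀ (e : V × V) (v : List (V × V)), NullWord T n (e :: v) →
      NullWord T n (v ++ [e])) (n : ℕ) (hn : n ≤ N) {u v : List (V × V)}
    {x y z : V} (hT : T x y z) (h : NullWord T n (u ++ (x, y) :: (y, z) :: v)) :
    NullWord T (n + 1) (u ++ (x, z) :: v) := by
  suffices H : ∀ (M n : ℕ) (u v : List (V × V)), n ≤ N →
      2 * n + (u ++ (x, y) :: (y, z) :: v).length < M → NullWord T n (u ++ (x, y) :: (y, z) :: v) →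
      NullWord T (n + 1) (u ++ (x, z) :: v) from H _ n u v hn (Nat.lt_succ_self _) h
  intro M
  induction M with
  | zero => intro n u v _ hN; omega
  | succ M ih =>
    intro n u v hn hN h
    cases u with
    | nil => exact tri hT h
    | cons e u =>
      obtain ⟨p, q⟩ := e
      rcases of_cons h with ⟨d, w, m₁, m₂, hv, rfl, h1, h2⟩ | ⟨y', n', rfl, hT2, h'⟩
      · simp only [List.append_eq] at hv
        rcases List.append_eq_append_iff.1 hv with ⟨a, rfl, ha⟩ | ⟨a, rfl, ha⟩
        · cases a with
          | nil =>
            -- the bridge is the first of the two edges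
            simp only [List.nil_append, List.cons.injEq, Prod.mk.injEq] at ha
            obtain ⟨⟨rfl, rfl⟩, rfl⟩ := ha
            have h3 : NullWord T _ ((z, x) :: (u ++ (x, z) :: ([] : List (V × V)))) :=
              pair (by simpa using h1) nil
            have h4 := h3.insert (u := [(y, z)]) (v := v) (by simpa using h2)
            exact (tri (v := u ++ (x, z) :: v) (hT' _ _ _ hT) (h4.cast_eq rfl (by simp))).cast_eq
              (by omega) (by simp)
          | cons f a =>
            simp only [List.cons_append, List.cons.injEq] at ha
            obtain ⟨rfl, ha⟩ := ha
            cases a with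
            | nil =>
              -- the bridge is the second of the two edges
              simp only [List.nil_append, List.cons.injEq, Prod.mk.injEq] at ha
              obtain ⟨⟨rfl, rfl⟩, rfl⟩ := ha
              have h3 : NullWord T m₁ ((x, y) :: u) := by
                have h5 : NullWord T m₁ (u ++ [(x, y)]) := h1
                cases u with
                | nil => exact h5
                | cons e u =>
                  -- rotate once for each letter of `u`
                  have key : ∀ (a b : List (V × V)), NullWord T m₁ (a ++ b) →
                      NullWord T m₁ (b ++ a) := by
                    intro a
                    induction a with
                    | nil => intro b hb; simpa using hb
                    | cons e a iha =>
                      intro b hb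
                      have := iha (b ++ [e]) (by simpa using hrot m₁ (by omega) e (a ++ b) hb)
                      simpa using this
                  exact key _ _ h5
              have h4 := pair (x := z) (y := x) h3 h2
              exact (tri (v := u ++ (x, z) :: v) (hT' _ _ _ (hT' _ _ _ hT))
                (h4.cast_eq rfl (by simp))).cast_eq
                (by omega) (by simp)
            | cons g a =>
              simp only [List.cons_append, List.cons.injEq] at ha
              obtain ⟨rfl, rfl⟩ := ha
              have := ih m₁ u a (by omega) (by simp at hN ⊢; omega) h1
              exact (pair (x := p) (y := q) this h2).cast_eq (by omega) (by simp)
        · cases a with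
          | nil =>
            simp only [List.nil_append, List.cons.injEq, Prod.mk.injEq] at ha
            obtain ⟨⟨rfl, rfl⟩, rfl⟩ := ha
            have h3 : NullWord T _ ((z, q) :: (d ++ (q, z) :: ([] : List (V × V)))) :=
              pair (by simpa using h1) nil
            have h4 := h3.insert (u := [(p, z)]) (v := v) (by simpa using h2)
            exact (tri (v := d ++ (q, z) :: v) (hT' _ _ _ hT) (h4.cast_eq rfl (by simp))).cast_eq
              (by omega) (by simp)
          | cons f a =>
            simp only [List.cons_append, List.cons.injEq] at ha
            obtain ⟨rfl, rfl⟩ := ha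
            have := ih m₂ a v (by omega) (by simp at hN ⊢; omega) h2
            exact (pair (x := p) (y := q) h1 this).cast_eq (by omega) (by simp)
      · have := ih n' ((p, y') :: (y', q) :: u) v (by omega) (by simp at hN ⊢; omega) h'
        exact tri hT2 this

theorem rotate_one (hT' : ∀ x y z, T x y z → T y z x) (N : ℕ) :
    ∀ n ≤ N, ∀ (e : V × V) (v : List (V × V)), NullWord T n (e :: v) →
      NullWord T n (v ++ [e]) := by
  induction N with
  | zero =>
    rintro n hn ⟨x, z⟩ v h
    rcases of_cons h with ⟨c, w, m₁, m₂, rfl, rfl, h1, h2⟩ | ⟨y, n', rfl, hT, h'⟩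
    · exact (h1.concat (pair (x := z) (y := x) (v := []) h2 nil)).cast_eq (by omega) (by simp)
    · omega
  | succ N ih =>
    rintro n hn ⟨x, z⟩ v h
    rcases of_cons h with ⟨c, w, m₁, m₂, rfl, rfl, h1, h2⟩ | ⟨y, n', rfl, hT, h'⟩
    · exact (h1.concat (pair (x := z) (y := x) (v := []) h2 nil)).cast_eq (by omega) (by simp)
    · have h3 := ih n' (by omega) _ _ h'
      have h4 := ih n' (by omega) _ _ h3
      exact (tri_mid_aux hT' ih n' (by omega) (u := v) (v := []) hT (by simpa using h4))

theorem rotate (hT' : ∀ x y z, T x y z → T y z x) {n : ℕ} {a b : List (V × V)}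
    (h : NullWord T n (a ++ b)) : NullWord T n (b ++ a) := by
  induction a generalizing b with
  | nil => simpa using h
  | cons e a ih =>
    have := ih (b := b ++ [e]) (by simpa using rotate_one hT' n n le_rfl e (a ++ b) h)
    simpa using this

theorem tri_mid (hT' : ∀ x y z, T x y z → T y z x) {n : ℕ} {u v : List (V × V)}
    {x y z : V} (hT : T x y z) (h : NullWord T n (u ++ (x, y) :: (y, z) :: v)) :
    NullWord T (n + 1) (u ++ (x, z) :: v) :=
  tri_mid_aux hT' (rotate_one hT' n) n le_rfl hT h

theorem pair_mid {m n : ℕ} {u c v : List (V × V)} {x y : V} (hc : NullWord T m c)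
    (h : NullWord T n (u ++ v)) : NullWord T (m + n) (u ++ (x, y) :: (c ++ (y, x) :: v)) :=
  ((pair (x := x) (y := y) hc nil).insert h).cast_eq rfl (by simp)

/-- Folding a backtrack does not increase the area. -/
theorem fold_head (hT' : ∀ x y z, T x y z → T y z x) {n : ℕ} {x y : V} {v : List (V × V)}
    (h : NullWord T n ((x, y) :: (y, x) :: v)) : ∃ n' ≤ n, NullWord T n' v := by
  suffices H : ∀ (N n : ℕ) (v : List (V × V)), 2 * n + v.length < N →
      NullWord T n ((x, y) :: (y, x) :: v) → ∃ n' ≤ n, NullWord T n' v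
      from H _ n v (Nat.lt_succ_self _) h
  intro N
  induction N with
  | zero => intro n v hN; omega
  | succ N ih =>
    intro n v hN h
    cases v with
    | nil => exact ⟨0, Nat.zero_le _, nil⟩
    | cons f v =>
      obtain ⟨p, q⟩ := f
      have h0 : NullWord T n ((p, q) :: (v ++ [(x, y), (y, x)])) :=
        (rotate hT' (a := [(x, y), (y, x)]) (b := (p, q) :: v) h).cast_eq rfl (by simp)
      rcases of_cons h0 with ⟨d, w, m₁, m₂, hv, rfl, h1, h2⟩ | ⟨s, n', rfl, hT, h'⟩
      · rcases List.append_eq_append_iff.1 hv with ⟨a, rfl, ha⟩ | ⟨a, rfl, ha⟩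
        · cases a with
          | nil =>
            simp only [List.nil_append, List.cons.injEq, Prod.mk.injEq] at ha
            obtain ⟨⟨rfl, rfl⟩, rfl⟩ := ha
            exact ⟨m₁ + m₂, le_rfl,
              (h2.concat h1).cast_eq (by omega) (by simp)⟩
          | cons f a =>
            simp only [List.cons_append, List.cons.injEq] at ha
            obtain ⟨rfl, ha⟩ := ha
            cases a with
            | nil =>
              simp only [List.nil_append, List.cons.injEq, Prod.mk.injEq] at ha
              obtain ⟨⟨rfl, rfl⟩, rfl⟩ := ha
              exact ⟨m₁, by omega, (rotate hT' (a := v) (b := [(x, y)]) h1).cast_eq rfl (by simp)⟩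
            | cons g a => simp at ha
        · cases a with
          | nil =>
            simp only [List.nil_append, List.cons.injEq, Prod.mk.injEq] at ha
            obtain ⟨⟨rfl, rfl⟩, rfl⟩ := ha
            exact ⟨m₁ + m₂, le_rfl,
              (h2.concat h1).cast_eq (by omega) (by simp)⟩
          | cons f a =>
            simp only [List.cons_append, List.cons.injEq] at ha
            obtain ⟨rfl, rfl⟩ := ha
            obtain ⟨n', hn', h3⟩ := ih m₂ a (by simp at hN ⊢; omega)
              (rotate hT' (a := a) (b := [(x, y), (y, x)]) h2)
            exact ⟨m₁ + n', by omega, (pair (x := p) (y := q) h1 h3).cast_eq rfl (by simp)⟩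
      · obtain ⟨n'', hn'', h3⟩ := ih n' ((p, s) :: (s, q) :: v) (by simp at hN ⊢; omega)
          (rotate hT' (a := (p, s) :: (s, q) :: v) (b := [(x, y), (y, x)])
            (h'.cast_eq rfl (by simp)))
        exact ⟨n'' + 1, by omega, tri hT h3⟩

theorem fold (hT' : ∀ x y z, T x y z → T y z x) {n : ℕ} {x y : V} {u v : List (V × V)}
    (h : NullWord T n (u ++ (x, y) :: (y, x) :: v)) : ∃ n' ≤ n, NullWord T n' (u ++ v) := by
  obtain ⟨n', hn', h'⟩ := fold_head hT' (x := x) (y := y) (v := v ++ u)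
    ((rotate hT' h).cast_eq rfl (by simp))
  exact ⟨n', hn', rotate hT' h'⟩

theorem sum_eq_zero {n : ℕ} {w : List (V × V)} (h : NullWord T n w) (f : V → ℤ) :
    (w.map fun d => f d.2 - f d.1).sum = 0 := by
  induction h with
  | nil => simp
  | pair _ _ ih1 ih2 => simp only [List.map_cons, List.map_append, List.sum_cons,
      List.sum_append] at *; omega
  | tri _ _ ih => simp only [List.map_cons, List.sum_cons] at *; omega

/-- A single edge is not null. -/
theorem not_singleton (hne : ∀ x y z, T x y z → x ≠ z) {n : ℕ} {d : V × V} :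
    ¬ NullWord T n [d] := by
  classical
  intro h
  obtain ⟨x, z⟩ := d
  have h1 := h.sum_eq_zero (fun v => if v = x then 1 else 0)
  rcases of_cons h with ⟨c, w, _, _, hv, _⟩ | ⟨y, n', rfl, hT, h'⟩
  · simp at hv
  · have := hne _ _ _ hT
    simp [this.symm] at h1

end NullWord

/-! ### Hyperbolic angles -/

theorem hyperbolicAngle_comm (k a b c : ℝ) : hyperbolicAngle k a b c = hyperbolicAngle k b a c := by
  unfold hyperbolicAngle
  rw [mul_comm (Real.cosh _), mul_comm (Real.sinh _)]

theorem hyperbolicAngle_nonneg (k a b c : ℝ) : 0 ≤ hyperbolicAngle k a b c := Real.arccos_nonneg _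

/-- Half-angle formulas for a hyperbolic triangle with sides `q + r`, `p + r`, `p + q`. -/
theorem half_angle_formulas {p q r : ℝ} (hp : 0 < p) (hq : 0 < q) (hr : 0 < r) :
    let γ := Real.arccos ((Real.cosh (q + r) * Real.cosh (p + r) - Real.cosh (p + q)) /
      (Real.sinh (q + r) * Real.sinh (p + r)))
    Real.cos (γ / 2) ^ 2 =
        Real.sinh (p + q + r) * Real.sinh r / (Real.sinh (q + r) * Real.sinh (p + r)) ∧
      Real.sin (γ / 2) ^ 2 =
        Real.sinh p * Real.sinh q / (Real.sinh (q + r) * Real.sinh (p + r)) := by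
  intro γ
  have h1 : 0 < Real.sinh (q + r) := Real.sinh_pos_iff.2 (by linarith)
  have h2 : 0 < Real.sinh (p + r) := Real.sinh_pos_iff.2 (by linarith)
  have hsp := Real.sinh_pos_iff.2 hp
  have hsq := Real.sinh_pos_iff.2 hq
  have hsr := Real.sinh_pos_iff.2 hr
  have hs : 0 < Real.sinh (p + q + r) := Real.sinh_pos_iff.2 (by linarith)
  set X := (Real.cosh (q + r) * Real.cosh (p + r) - Real.cosh (p + q)) /
      (Real.sinh (q + r) * Real.sinh (p + r)) with hX
  have e1 : (1 + X) / 2 =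
      Real.sinh (p + q + r) * Real.sinh r / (Real.sinh (q + r) * Real.sinh (p + r)) := by
    rw [hX]
    field_simp
    have := Real.cosh_sq p
    have := Real.cosh_sq q
    have := Real.cosh_sq r
    simp only [Real.sinh_add, Real.cosh_add]
    grind
  have e2 : (1 - X) / 2 =
      Real.sinh p * Real.sinh q / (Real.sinh (q + r) * Real.sinh (p + r)) := by
    rw [hX]
    field_simp
    have := Real.cosh_sq p
    have := Real.cosh_sq q
    have := Real.cosh_sq r
    simp only [Real.sinh_add, Real.cosh_add]
    grind
  have p1 : 0 ≤ (1 + X) / 2 := by rw [e1]; positivity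
  have p2 : 0 ≤ (1 - X) / 2 := by rw [e2]; positivity
  have hcos : Real.cos γ = X := Real.cos_arccos (by linarith) (by linarith)
  constructor
  · rw [← e1, Real.cos_sq, show 2 * (γ / 2) = γ by ring, hcos]; ring
  · rw [← e2, Real.sin_sq, Real.cos_sq, show 2 * (γ / 2) = γ by ring, hcos]; ring

/-- The angle sum of a hyperbolic triangle is at most `π`. -/
theorem hyperbolicAngle_sum_le {k a b c : ℝ} (hk : k < 0) (h1 : a < b + c) (h2 : b < a + c)
    (h3 : c < a + b) :
    hyperbolicAngle k b c a + hyperbolicAngle k a c b + hyperbolicAngle k a b c ≤ Real.pi := by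
  have hs : 0 < √(-k) := Real.sqrt_pos.2 (by linarith)
  obtain ⟨p, hp⟩ : ∃ p, p = √(-k) * ((b + c - a) / 2) := ⟨_, rfl⟩
  obtain ⟨q, hq⟩ : ∃ q, q = √(-k) * ((a + c - b) / 2) := ⟨_, rfl⟩
  obtain ⟨r, hr⟩ : ∃ r, r = √(-k) * ((a + b - c) / 2) := ⟨_, rfl⟩
  have p0 : 0 < p := hp ▸ mul_pos hs (by linarith)
  have q0 : 0 < q := hq ▸ mul_pos hs (by linarith)
  have r0 : 0 < r := hr ▸ mul_pos hs (by linarith)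
  have ea : √(-k) * a = q + r := by rw [hq, hr]; ring
  have eb : √(-k) * b = p + r := by rw [hp, hr]; ring
  have ec : √(-k) * c = p + q := by rw [hp, hq]; ring
  unfold hyperbolicAngle
  rw [ea, eb, ec]
  obtain ⟨c3, s3⟩ := half_angle_formulas p0 q0 r0
  obtain ⟨c2, s2⟩ := half_angle_formulas p0 r0 q0
  obtain ⟨c1, s1⟩ := half_angle_formulas q0 r0 p0
  rw [add_comm r q, show p + r + q = p + q + r by ring] at c2
  rw [add_comm r q] at s2
  rw [add_comm r p, add_comm q p, show q + r + p = p + q + r by ring,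
    mul_comm (Real.cosh (p + r)), mul_comm (Real.sinh (p + r))] at c1
  rw [add_comm r p, add_comm q p, mul_comm (Real.cosh (p + r)),
    mul_comm (Real.sinh (p + r))] at s1
  rw [mul_comm (Real.cosh (p + r)) (Real.cosh (p + q)),
    mul_comm (Real.sinh (p + r)) (Real.sinh (p + q))]
  set α := Real.arccos ((Real.cosh (p + q) * Real.cosh (p + r) - Real.cosh (q + r)) /
    (Real.sinh (p + q) * Real.sinh (p + r)))
  set β := Real.arccos ((Real.cosh (q + r) * Real.cosh (p + q) - Real.cosh (p + r)) /
    (Real.sinh (q + r) * Real.sinh (p + q)))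
  set γ := Real.arccos ((Real.cosh (q + r) * Real.cosh (p + r) - Real.cosh (p + q)) /
    (Real.sinh (q + r) * Real.sinh (p + r)))
  have bα : 0 ≤ α ∧ α ≤ Real.pi := ⟨Real.arccos_nonneg _, Real.arccos_le_pi _⟩
  have bβ : 0 ≤ β ∧ β ≤ Real.pi := ⟨Real.arccos_nonneg _, Real.arccos_le_pi _⟩
  have bγ : 0 ≤ γ ∧ γ ≤ Real.pi := ⟨Real.arccos_nonneg _, Real.arccos_le_pi _⟩
  have hsp := Real.sinh_pos_iff.2 p0
  have hsq := Real.sinh_pos_iff.2 q0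
  have hsr := Real.sinh_pos_iff.2 r0
  have hA : 0 < Real.sinh (q + r) := Real.sinh_pos_iff.2 (by linarith)
  have hB : 0 < Real.sinh (p + r) := Real.sinh_pos_iff.2 (by linarith)
  have hC : 0 < Real.sinh (p + q) := Real.sinh_pos_iff.2 (by linarith)
  have hS : 0 < Real.sinh (p + q + r) := Real.sinh_pos_iff.2 (by linarith)
  have cn : ∀ x, 0 ≤ x ∧ x ≤ Real.pi → 0 ≤ Real.cos (x / 2) := fun x hx =>
    Real.cos_nonneg_of_mem_Icc ⟨by linarith [Real.pi_pos], by linarith⟩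
  have sn : ∀ x, 0 ≤ x ∧ x ≤ Real.pi → 0 ≤ Real.sin (x / 2) := fun x hx =>
    Real.sin_nonneg_of_nonneg_of_le_pi (by linarith) (by linarith)
  have m1 : Real.cos (α / 2) * Real.cos (β / 2) =
      Real.sinh (p + q + r) / Real.sinh (p + q) * Real.sin (γ / 2) := by
    refine (sq_eq_sq₀ (mul_nonneg (cn _ bα) (cn _ bβ)) (mul_nonneg (by positivity) (sn _ bγ))).1 ?_
    rw [mul_pow, mul_pow, c1, c2, s3]
    field_simp
  have m2 : Real.sin (α / 2) * Real.sin (β / 2) =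
      Real.sinh r / Real.sinh (p + q) * Real.sin (γ / 2) := by
    refine (sq_eq_sq₀ (mul_nonneg (sn _ bα) (sn _ bβ)) (mul_nonneg (by positivity) (sn _ bγ))).1 ?_
    rw [mul_pow, mul_pow, s1, s2, s3]
    field_simp
  have key : Real.sin (γ / 2) ≤ Real.cos (α / 2 + β / 2) := by
    rw [Real.cos_add, m1, m2, ← sub_mul, ← sub_div]
    refine le_mul_of_one_le_left (sn _ bγ) ((one_le_div hC).2 ?_)
    rw [Real.sinh_add (p + q) r]
    nlinarith [Real.one_le_cosh r, Real.one_le_cosh (p + q)]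
  by_contra hlt
  push Not at hlt
  have := Real.cos_lt_cos_of_nonneg_of_le_pi (x := Real.pi / 2 - γ / 2) (y := α / 2 + β / 2)
    (by linarith) (by linarith) (by linarith)
  rw [Real.cos_pi_div_two_sub] at this
  linarith

/-! ### Closed walks in graphs -/

/-- A walk is a path, or contains an embedded cycle, or contains a backtrack that can be removed. -/
theorem SimpleGraph.Walk.isPath_or_cycle_or_backtrack {V : Type*} {G : SimpleGraph V} {u w : V}
    (p : G.Walk u w) :
    p.IsPath ∨ (∃ (v : V) (c : G.Walk v v), c.IsCycle ∧ c.darts <:+: p.darts) ∨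
      ∃ (p' : G.Walk u w) (a b : List G.Dart) (d : G.Dart),
        p.darts = a ++ d :: d.symm :: b ∧ p'.darts = a ++ b := by
  classical
  induction p with
  | nil => exact Or.inl SimpleGraph.Walk.IsPath.nil
  | @cons u v w h p ih =>
    rcases ih with ih | ⟨v', c, hc, hcp⟩ | ⟨p', a, b, d, h1, h2⟩
    · by_cases hu : u ∈ p.support
      · right
        cases p with
        | nil => simp at hu; exact absurd hu h.ne
        | @cons _ a _ h' p =>
          by_cases hau : a = u
          · subst hau
            refine Or.inr ⟨p, [], p.darts, ⟨(a, v), h⟩, ?_, by simp⟩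
            simp [SimpleGraph.Dart.symm]
          · left
            set q := (SimpleGraph.Walk.cons h' p).takeUntil u hu with hq
            have hqp : q.IsPath := ih.takeUntil hu
            refine ⟨u, SimpleGraph.Walk.cons h q, ?_, ?_⟩
            · rw [SimpleGraph.Walk.cons_isCycle_iff]
              refine ⟨hqp, fun he => ?_⟩
              have hq' : q = SimpleGraph.Walk.cons h' (p.takeUntil u (by
                  simp only [SimpleGraph.Walk.support_cons, List.mem_cons] at hu
                  exact hu.resolve_left h.ne)) := by
                rw [hq, SimpleGraph.Walk.takeUntil_cons _ h.symm.ne]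
              rw [hq', SimpleGraph.Walk.cons_isPath_iff] at hqp
              rw [hq', SimpleGraph.Walk.edges_cons, List.mem_cons] at he
              rcases he with he | he
              · rw [Sym2.eq_iff] at he
                rcases he with ⟨rfl, _⟩ | ⟨rfl, _⟩
                · exact h.ne rfl
                · exact hau rfl
              · exact hqp.2 (SimpleGraph.Walk.snd_mem_support_of_mem_edges _ he)
            · have := congrArg SimpleGraph.Walk.darts
                ((SimpleGraph.Walk.cons h' p).take_spec hu)
              rw [SimpleGraph.Walk.darts_append] at this
              exact ⟨[], ((SimpleGraph.Walk.cons h' p).dropUntil u hu).darts, by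
                rw [SimpleGraph.Walk.darts_cons, SimpleGraph.Walk.darts_cons, ← this]; rfl⟩
      · exact Or.inl (ih.cons hu)
    · exact Or.inr (Or.inl ⟨v', c, hc, hcp.trans ⟨[⟨(u, v), h⟩], [], by simp⟩⟩)
    · exact Or.inr (Or.inr ⟨.cons h p', ⟨(u, v), h⟩ :: a, b, d, by simp [h1], by simp [h2]⟩)

/-! ### Corners of disc diagrams -/

namespace AbstractSimplicialComplex

variable {V : Type*} (K : AbstractSimplicialComplex V)

theorem isTriangle_rotate {x y z : V} (h : K.IsTriangle x y z) : K.IsTriangle y z x := by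
  obtain ⟨h1, h2, h3, s, hs, hx, hy, hz⟩ := h
  exact ⟨h2, h3.symm, h1.symm, s, hs, hy, hz, hx⟩

theorem isTriangle_swap {x y z : V} (h : K.IsTriangle x y z) : K.IsTriangle x z y := by
  obtain ⟨h1, h2, h3, s, hs, hx, hy, hz⟩ := h
  exact ⟨h3, h2.symm, h1, s, hs, hx, hz, hy⟩

end AbstractSimplicialComplex

namespace HyperbolicTwoComplex

variable {V : Type*} (K : HyperbolicTwoComplex V)

theorem angle_comm (k : ℝ) (v u w : V) : K.angle k v u w = K.angle k v w u := by
  unfold angle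
  rw [hyperbolicAngle_comm, Sym2.eq_swap (a := u)]

theorem angle_nonneg (k : ℝ) (v u w : V) : 0 ≤ K.angle k v u w := hyperbolicAngle_nonneg ..

theorem angle_sum_le {k : ℝ} (hk : k < 0) {x y z : V} (h : K.IsTriangle x y z) :
    K.angle k x y z + K.angle k y x z + K.angle k z x y ≤ Real.pi := by
  have h1 := K.length_lt_add _ _ _ h
  have h2 := K.length_lt_add _ _ _ (K.isTriangle_rotate h)
  have h3 := K.length_lt_add _ _ _ (K.isTriangle_rotate (K.isTriangle_rotate h))
  unfold angle
  rw [Sym2.eq_swap (a := z) (b := x)] at h2 h3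
  rw [Sym2.eq_swap (a := y) (b := x)] at *
  rw [Sym2.eq_swap (a := z) (b := x)]
  rw [Sym2.eq_swap (a := z) (b := y)] at *
  have := hyperbolicAngle_sum_le (a := K.length s(y, z)) (b := K.length s(x, y))
    (c := K.length s(x, z)) hk (by linarith) (by linarith) (by linarith)
  rw [hyperbolicAngle_comm k (K.length s(y, z)) (K.length s(x, z)),
    hyperbolicAngle_comm k (K.length s(y, z)) (K.length s(x, y))] at this
  linarith

theorem linkLength_nonneg (k : ℝ) {v u w : V} (p : (K.link v).Walk u w) :
    0 ≤ K.linkLength k v p :=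
  List.sum_nonneg fun _ hx => by
    obtain ⟨d, -, rfl⟩ := List.mem_map.1 hx
    exact K.angle_nonneg ..

/-- If the link of `y` contains no short embedded cycle, then a closed walk in it that consists
of more than one point and has no backtracks has length at least `2π`. -/
theorem two_pi_le_linkLength_of_not_backtrack {k : ℝ} {y u : V}
    (hlink : ∀ (v : V) (p : (K.link y).Walk v v), p.IsCycle → 2 * Real.pi ≤ K.linkLength k y p)
    (p : (K.link y).Walk u u) (hp : ¬ p.Nil)
    (hb : ¬ ∃ (p' : (K.link y).Walk u u) (a b : List (K.link y).Dart) (d : (K.link y).Dart),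
        p.darts = a ++ d :: d.symm :: b ∧ p'.darts = a ++ b) :
    2 * Real.pi ≤ K.linkLength k y p := by
  rcases p.isPath_or_cycle_or_backtrack with h | ⟨v, c, hc, hcp⟩ | h
  · exact absurd (SimpleGraph.Walk.isPath_iff_nil.1 h) hp
  · refine (hlink v c hc).trans ?_
    unfold linkLength
    refine List.Sublist.sum_le_sum (hcp.sublist.map _) fun x hx => ?_
    obtain ⟨d, -, rfl⟩ := List.mem_map.1 hx
    exact K.angle_nonneg ..
  · exact absurd h hb

/-- The word of the outer boundary of the fan of triangles around `y` that a walk in the link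
describes. -/
def fan {y x z : V} (W : (K.link y).Walk x z) : List (V × V) := W.darts.map (·.toProd)

variable {K}

theorem length_darts_append {y x z x' z' : V} {W : (K.link y).Walk x z}
    {W' : (K.link y).Walk x' z'} {a b : List (K.link y).Dart} {d e : (K.link y).Dart}
    (h : W.darts = a ++ d :: e :: b) (h' : W'.darts = a ++ b) :
    W.length = W'.length + 2 := by
  rw [← SimpleGraph.Walk.length_darts, ← SimpleGraph.Walk.length_darts, h, h']
  simp
  omega

/-- A boundary path around a fan may be replaced by the two sides of the fan, at the cost of the
triangles of the fan. -/
theorem fan_fill {y x z : V} (W : (K.link y).Walk x z) {n : ℕ} {r : List (V × V)}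
    (h : NullWord K.IsTriangle n (r ++ K.fan W)) :
    NullWord K.IsTriangle (n + W.length) (r ++ [(x, y), (y, z)]) := by
  induction W generalizing n r with
  | @nil x =>
    exact (NullWord.pair_mid (u := r) (v := []) (x := x) (y := y) NullWord.nil
      (h.cast_eq rfl (by simp [fan]))).cast_eq (by simp) (by simp)
  | @cons x q z hxq W ih =>
    have h1 : K.IsTriangle x y q := hxq
    have h2 := ih (r := r ++ [(x, q)]) (h.cast_eq rfl (by simp [fan]))
    exact (NullWord.tri_mid (fun _ _ _ => K.isTriangle_rotate) (K.isTriangle_swap h1)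
      (u := r) (v := [(y, z)]) (h2.cast_eq rfl (by simp))).cast_eq
      (by simp [SimpleGraph.Walk.length_cons]; omega) rfl

/-- `K.Corner k n b s`: in a disc diagram with boundary word `b` and at most `n` triangles, the
turning of the boundary at the starting point of `b` may be counted as `s`. Either the diagram can
be cut in two at this corner, and `s ≤ 0`, or the triangles at this corner form a fan, which can be
removed, and `s` is at most `π` minus the angle of this fan. -/
def Corner (K : HyperbolicTwoComplex V) (k : ℝ) (n : ℕ) (b : List (V × V)) (s : ℝ) : Prop :=
  (s ≤ 0 ∧ ∃ b₁ b₂ m₁ m₂, b₁ ≠ [] ∧ b₂ ≠ [] ∧ b = b₁ ++ b₂ ∧ NullWord K.IsTriangle m₁ b₁ ∧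
    NullWord K.IsTriangle m₂ b₂ ∧ m₁ + m₂ ≤ n) ∨
  ∃ (y x z : V) (r : List (V × V)) (W : (K.link y).Walk x z) (n' : ℕ),
    b = (y, z) :: (r ++ [(x, y)]) ∧ NullWord K.IsTriangle n' (r ++ K.fan W) ∧
    n' + W.length ≤ n ∧ s ≤ Real.pi - K.linkLength k y W

theorem Corner.le_pi {k : ℝ} {n : ℕ} {b : List (V × V)} {s : ℝ} (h : K.Corner k n b s) :
    s ≤ Real.pi := by
  rcases h with ⟨h, -⟩ | ⟨y, x, z, r, W, n', -, -, -, h⟩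
  · exact h.trans Real.pi_pos.le
  · linarith [K.linkLength_nonneg k W]

/-- The cuts of `p ++ D ++ q` at its starting point do not cut `D`. -/
def Uncut (K : HyperbolicTwoComplex V) (n : ℕ) (p D q : List (V × V)) : Prop :=
  ∀ b₁ b₂ m₁ m₂, b₁ ≠ [] → b₂ ≠ [] → p ++ D ++ q = b₁ ++ b₂ → NullWord K.IsTriangle m₁ b₁ →
    NullWord K.IsTriangle m₂ b₂ → m₁ + m₂ ≤ n →
    (∃ q₁, b₁ = p ++ D ++ q₁ ∧ q = q₁ ++ b₂) ∨ ∃ p₂, b₂ = p₂ ++ D ++ q ∧ p = b₁ ++ p₂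

theorem uncut_nil (n : ℕ) (p q : List (V × V)) : K.Uncut n p [] q := by
  intro b₁ b₂ m₁ m₂ _ _ h _ _ _
  rcases List.append_eq_append_iff.1 h with ⟨a, rfl, ha⟩ | ⟨a, ha, rfl⟩
  · exact Or.inl ⟨a, rfl, ha⟩
  · exact Or.inr ⟨a, by simp, by simpa using ha⟩

theorem uncut_singleton (n : ℕ) (p : List (V × V)) (d : V × V) (q : List (V × V)) :
    K.Uncut n p [d] q := by
  intro b₁ b₂ m₁ m₂ _ _ h _ _ _
  rw [List.append_assoc] at h
  rcases List.append_eq_append_iff.1 h with ⟨a, rfl, ha⟩ | ⟨a, ha, rfl⟩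
  · cases a with
    | nil => exact Or.inr ⟨[], by simpa using ha.symm, by simp⟩
    | cons e a =>
      simp only [List.cons_append, List.nil_append, List.cons.injEq] at ha
      obtain ⟨rfl, rfl⟩ := ha
      exact Or.inl ⟨a, by simp, rfl⟩
  · exact Or.inr ⟨a, by simp, by simpa using ha⟩

theorem uncut_pair {n : ℕ} {p : List (V × V)} {d e : V × V} {q : List (V × V)}
    (h0 : ∀ m₁ m₂, NullWord K.IsTriangle m₁ (p ++ [d]) → NullWord K.IsTriangle m₂ (e :: q) →
      ¬ m₁ + m₂ ≤ n) :
    K.Uncut n p [d, e] q := by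
  intro b₁ b₂ m₁ m₂ _ _ h hb₁ hb₂ hn
  rw [List.append_assoc] at h
  rcases List.append_eq_append_iff.1 h with ⟨a, rfl, ha⟩ | ⟨a, ha, rfl⟩
  · cases a with
    | nil => exact Or.inr ⟨[], by simpa using ha.symm, by simp⟩
    | cons e a =>
      simp only [List.cons_append, List.nil_append, List.cons.injEq] at ha
      obtain ⟨rfl, ha⟩ := ha
      cases a with
      | nil =>
        simp only [List.nil_append] at ha
        subst ha
        exact absurd hn (h0 m₁ m₂ hb₁ hb₂)
      | cons f a =>
        simp only [List.cons_append, List.cons.injEq] at ha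
        obtain ⟨rfl, rfl⟩ := ha
        exact Or.inl ⟨a, by simp, rfl⟩
  · exact Or.inr ⟨a, by simp, by simpa using ha⟩

/-- A corner is not affected by changes of the boundary away from it. -/
theorem Corner.subst {k : ℝ} {n l : ℕ} {p D D' q : List (V × V)} {s : ℝ} (hp : p ≠ [])
    (hq : q ≠ [])
    (h : ∀ u v m, NullWord K.IsTriangle m (u ++ D ++ v) →
      NullWord K.IsTriangle (m + l) (u ++ D' ++ v))
    (hs : K.Uncut n p D q) (hc : K.Corner k n (p ++ D ++ q) s) :
    K.Corner k (n + l) (p ++ D' ++ q) s := by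
  rcases hc with ⟨hs0, b₁, b₂, m₁, m₂, hb₁, hb₂, hb, h1, h2, hn⟩ |
    ⟨y, x, z, r, W, n', hb, h1, hn, hsW⟩
  · left
    refine ⟨hs0, ?_⟩
    rcases hs b₁ b₂ m₁ m₂ hb₁ hb₂ hb h1 h2 hn with ⟨q₁, rfl, rfl⟩ | ⟨p₂, rfl, rfl⟩
    · exact ⟨p ++ D' ++ q₁, b₂, m₁ + l, m₂, by simp [hp], hb₂, by simp, h _ _ _ h1, h2, by omega⟩
    · exact ⟨b₁, p₂ ++ D' ++ q, m₁, m₂ + l, hb₁, by simp [hq], by simp, h1, h _ _ _ h2, by omega⟩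
  · right
    obtain ⟨e, p', rfl⟩ := List.exists_cons_of_ne_nil hp
    obtain ⟨q', f, rfl⟩ := List.eq_nil_or_concat' q |>.resolve_left hq
    have hb' : e :: (p' ++ D ++ q' ++ [f]) = (y, z) :: (r ++ [(x, y)]) := by
      rw [← hb]; simp
    obtain ⟨rfl, h2⟩ := List.cons.inj hb'
    obtain ⟨rfl, h3⟩ := List.append_inj' h2 rfl
    simp only [List.cons.injEq, and_true] at h3
    subst h3
    refine ⟨y, x, z, p' ++ D' ++ q', W, n' + l, by simp, ?_, by omega, hsW⟩
    exact (h p' (q' ++ K.fan W) n' (h1.cast_eq rfl (by simp))).cast_eq rfl (by simp)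

/-- The corner at the first endpoint of an edge on which a triangle is glued. -/
theorem Corner.glue_left {k : ℝ} {n l : ℕ} {x y z : V} {Q Q' q : List (V × V)} {s : ℝ}
    (hT : K.IsTriangle x y z) (hq : q ≠ [])
    (h : ∀ u v m, NullWord K.IsTriangle m (u ++ Q ++ v) →
      NullWord K.IsTriangle (m + l) (u ++ (y, z) :: Q' ++ v))
    (hs : K.Uncut n [(x, y)] Q q)
    (hc : K.Corner k n ((x, y) :: (Q ++ q)) s)
    (hQ : ∀ m, Q ≠ [] → ¬ NullWord K.IsTriangle m [(x, y)]) :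
    K.Corner k (n + l + 1) ((x, z) :: (Q' ++ q)) (s - K.angle k x y z) := by
  rcases hc with ⟨hs0, b₁, b₂, m₁, m₂, hb₁, hb₂, hb, h1, h2, hn⟩ |
    ⟨y', x', z', r, W, n', hb, h1, hn, hsW⟩
  · left
    refine ⟨by linarith [K.angle_nonneg k x y z], ?_⟩
    have key : ∃ q₁, b₁ = (x, y) :: (Q ++ q₁) ∧ q = q₁ ++ b₂ := by
      rcases hs b₁ b₂ m₁ m₂ hb₁ hb₂ (by simpa using hb) h1 h2 hn with ⟨q₁, rfl, rfl⟩ | ⟨p₂, rfl, hp⟩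
      · exact ⟨q₁, by simp, rfl⟩
      · obtain ⟨e, b, rfl⟩ := List.exists_cons_of_ne_nil hb₁
        simp only [List.cons_append, List.cons.injEq, List.nil_eq, List.append_eq_nil_iff] at hp
        obtain ⟨rfl, rfl, rfl⟩ := hp
        by_cases hQ0 : Q = []
        · subst hQ0; exact ⟨[], rfl, by simp⟩
        · exact absurd h1 (hQ _ hQ0)
    obtain ⟨q₁, rfl, rfl⟩ := key
    refine ⟨(x, z) :: (Q' ++ q₁), b₂, m₁ + l + 1, m₂, by simp, hb₂, by simp, ?_, h2, by omega⟩
    exact NullWord.tri hT ((h [(x, y)] q₁ m₁ (h1.cast_eq rfl (by simp))).cast_eq rfl (by simp))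
  · right
    obtain ⟨q', f, rfl⟩ := List.eq_nil_or_concat' q |>.resolve_left hq
    have hb' : (x, y) :: (Q ++ q' ++ [f]) = (y', z') :: (r ++ [(x', y')]) := by
      rw [← hb]; simp
    obtain ⟨h0, h2⟩ := List.cons.inj hb'
    obtain ⟨rfl, rfl⟩ := Prod.mk.inj h0
    obtain ⟨rfl, h3⟩ := List.append_inj' h2 rfl
    simp only [List.cons.injEq, and_true] at h3
    subst h3
    have hadj : (K.link x).Adj y z :=
      K.isTriangle_rotate (K.isTriangle_rotate (K.isTriangle_swap hT))
    refine ⟨x, x', z, Q' ++ q', W.concat hadj, n' + l, by simp, ?_, by simp; omega, ?_⟩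
    · have h4 := h [] (q' ++ K.fan W) n' (h1.cast_eq rfl (by simp))
      refine (NullWord.rotate (fun _ _ _ => K.isTriangle_rotate) (a := [(y, z)])
        (b := Q' ++ q' ++ K.fan W) (h4.cast_eq rfl (by simp))).cast_eq rfl ?_
      simp [fan, SimpleGraph.Walk.darts_concat]
    · have : K.linkLength k x (W.concat hadj) = K.linkLength k x W + K.angle k x y z := by
        simp [linkLength, SimpleGraph.Walk.darts_concat]
      linarith

/-- The corner at the second endpoint of an edge on which a triangle is glued. -/
theorem Corner.glue_right {k : ℝ} {n l : ℕ} {x y z : V} {Q Q' q : List (V × V)} {s : ℝ}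
    (hT : K.IsTriangle x y z) (hq : q ≠ [])
    (h : ∀ u v m, NullWord K.IsTriangle m (u ++ Q ++ v) →
      NullWord K.IsTriangle (m + l) (u ++ (Q' ++ [(x, y)]) ++ v))
    (hs : K.Uncut n q Q [(y, z)])
    (hc : K.Corner k n (q ++ Q ++ [(y, z)]) s)
    (hQ : ∀ m, Q ≠ [] → ¬ NullWord K.IsTriangle m [(y, z)]) :
    K.Corner k (n + l + 1) (q ++ Q' ++ [(x, z)]) (s - K.angle k z x y) := by
  have hrot : ∀ x y z, K.IsTriangle x y z → K.IsTriangle y z x := fun _ _ _ => K.isTriangle_rotate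
  rcases hc with ⟨hs0, b₁, b₂, m₁, m₂, hb₁, hb₂, hb, h1, h2, hn⟩ |
    ⟨y', x', z', r, W, n', hb, h1, hn, hsW⟩
  · left
    refine ⟨by linarith [K.angle_nonneg k z x y], ?_⟩
    have key : ∃ q₁, b₂ = q₁ ++ Q ++ [(y, z)] ∧ q = b₁ ++ q₁ := by
      rcases hs b₁ b₂ m₁ m₂ hb₁ hb₂ hb h1 h2 hn with ⟨q₁, rfl, hp⟩ | ⟨p₂, rfl, rfl⟩
      · obtain ⟨b, e, rfl⟩ := List.eq_nil_or_concat' b₂ |>.resolve_left hb₂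
        have hp' : [] ++ [(y, z)] = (q₁ ++ b) ++ [e] := by rw [List.append_assoc]; simpa using hp
        obtain ⟨h5, h6⟩ := List.append_inj' hp' rfl
        obtain ⟨rfl, rfl⟩ := List.append_eq_nil_iff.1 h5.symm
        simp only [List.cons.injEq, and_true] at h6
        subst h6
        by_cases hQ0 : Q = []
        · subst hQ0; exact ⟨[], rfl, by simp⟩
        · exact absurd (h2.cast_eq rfl (by simp)) (hQ _ hQ0)
      · exact ⟨p₂, rfl, rfl⟩
    obtain ⟨q₁, rfl, rfl⟩ := key
    refine ⟨b₁, q₁ ++ Q' ++ [(x, z)], m₁, m₂ + l + 1, hb₁, by simp, by simp, h1, ?_, by omega⟩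
    have h3 := h q₁ [(y, z)] m₂ h2
    exact (NullWord.tri_mid hrot hT (u := q₁ ++ Q') (v := []) (h3.cast_eq rfl (by simp)))
  · right
    obtain ⟨e, q', rfl⟩ := List.exists_cons_of_ne_nil hq
    have hb' : e :: (q' ++ Q ++ [(y, z)]) = (y', z') :: (r ++ [(x', y')]) := by
      rw [← hb]; simp
    obtain ⟨rfl, h2⟩ := List.cons.inj hb'
    obtain ⟨rfl, h3⟩ := List.append_inj' h2 rfl
    simp only [List.cons.injEq, and_true, Prod.mk.injEq] at h3
    obtain ⟨rfl, rfl⟩ := h3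
    have hadj : (K.link z).Adj x y := K.isTriangle_swap hT
    refine ⟨z, x, z', q' ++ Q', .cons hadj W, n' + l, by simp, ?_, by simp; omega, ?_⟩
    · exact (h q' (K.fan W) n' h1).cast_eq rfl (by simp [fan])
    · have : K.linkLength k z (.cons hadj W) = K.angle k z x y + K.linkLength k z W := by
        simp [linkLength]
      linarith

/-- The corner that arises when a triangle fills the gap between two diagrams that touch in one
point. -/
theorem Corner.glue_apex {k : ℝ} {m₁ m₂ : ℕ} {x y z : V} {v₁ v₂ : List (V × V)} {s₁ s₂ : ℝ}
    (hT : K.IsTriangle x y z) (hv₁ : v₁ ≠ []) (hv₂ : v₂ ≠ [])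
    (h₁ : NullWord K.IsTriangle m₁ ((y, z) :: v₁)) (h₂ : NullWord K.IsTriangle m₂ (v₂ ++ [(x, y)]))
    (c₁ : K.Corner k m₁ ((y, z) :: v₁) s₁) (c₂ : K.Corner k m₂ (v₂ ++ [(x, y)]) s₂) :
    ∃ s, K.Corner k (m₁ + m₂ + 1) (v₂ ++ (x, z) :: v₁) s ∧
      s₁ + s₂ - Real.pi - K.angle k y x z ≤ s := by
  have hrot : ∀ x y z, K.IsTriangle x y z → K.IsTriangle y z x := fun _ _ _ => K.isTriangle_rotate
  have a0 := K.angle_nonneg k y x z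
  have l1 := c₁.le_pi
  have l2 := c₂.le_pi
  rcases c₁ with ⟨hs0, b₁, b₂, n₁, n₂, hb₁, hb₂, hb, h3, h4, hn⟩ |
    ⟨y₁, p, z₁, r₁, W₁, n₁, hb, w1, hn, hsW⟩
  · refine ⟨0, Or.inl ⟨le_rfl, ?_⟩, by linarith⟩
    obtain ⟨e, b, rfl⟩ := List.exists_cons_of_ne_nil hb₁
    simp only [List.cons_append, List.cons.injEq] at hb
    obtain ⟨rfl, rfl⟩ := hb
    refine ⟨v₂ ++ (x, z) :: b, b₂, m₂ + n₁ + 1, n₂, by simp, hb₂, by simp, ?_, h4, by omega⟩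
    exact NullWord.tri_mid hrot hT ((h₂.concat h3).cast_eq rfl (by simp))
  rcases c₂ with ⟨hs0, b₁, b₂, n₃, n₄, hb₁, hb₂, hb', h3, h4, hn'⟩ |
    ⟨y₂, x₂, q, r₂, W₂, n₂, hb', w2, hn', hsW'⟩
  · refine ⟨0, Or.inl ⟨le_rfl, ?_⟩, by linarith⟩
    obtain ⟨b, e, rfl⟩ := List.eq_nil_or_concat' b₂ |>.resolve_left hb₂
    rw [← List.append_assoc] at hb'
    obtain ⟨rfl, h6⟩ := List.append_inj' hb' rfl
    simp only [List.cons.injEq, and_true] at h6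
    subst h6
    refine ⟨b₁, b ++ (x, z) :: v₁, n₃, n₄ + m₁ + 1, hb₁, by simp, by simp, h3, ?_, by omega⟩
    exact NullWord.tri_mid hrot hT ((h4.concat h₁).cast_eq rfl (by simp))
  · simp only [List.cons.injEq, Prod.mk.injEq] at hb
    obtain ⟨⟨rfl, rfl⟩, rfl⟩ := hb
    obtain ⟨e, v, rfl⟩ := List.exists_cons_of_ne_nil hv₂
    simp only [List.cons_append, List.cons.injEq] at hb'
    obtain ⟨rfl, hb'⟩ := hb'
    obtain ⟨rfl, h6⟩ := List.append_inj' hb' rfl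
    simp only [List.cons.injEq, and_true, Prod.mk.injEq] at h6
    obtain ⟨rfl, rfl⟩ := h6
    have hadj : (K.link y).Adj z x :=
      K.isTriangle_swap (K.isTriangle_rotate (K.isTriangle_rotate hT))
    refine ⟨Real.pi - K.linkLength k y (W₁.append (.cons hadj W₂)), Or.inr
      ⟨y, p, q, v ++ (x, z) :: r₁, W₁.append (.cons hadj W₂), n₁ + n₂, by simp, ?_, ?_, le_rfl⟩, ?_⟩
    · exact (NullWord.pair_mid (x := x) (y := z) w1 w2).cast_eq rfl (by simp [fan])
    · simp only [SimpleGraph.Walk.length_append, SimpleGraph.Walk.length_cons]; omega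
    · have : K.linkLength k y (W₁.append (.cons hadj W₂)) =
          K.linkLength k y W₁ + (K.angle k y z x + K.linkLength k y W₂) := by
        simp [linkLength, SimpleGraph.Walk.darts_append]
      rw [this, K.angle_comm k y z x]
      linarith

end HyperbolicTwoComplex

/-! ### The combinatorial Gauss–Bonnet inequality -/

namespace HyperbolicTwoComplex

variable {V : Type*} {K : HyperbolicTwoComplex V}

/-- `C` is a segment of a cyclic word, the rest of which is `B`. Each of its edges is decorated
with a number, by which the turning at the starting point of this edge may be counted. -/
def Corners (K : HyperbolicTwoComplex V) (k : ℝ) (n : ℕ) (C : List ((V × V) × ℝ))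
    (B : List (V × V)) : Prop :=
  ∀ U p U', C = U ++ p :: U' →
    K.Corner k n (p.1 :: (U'.map Prod.fst ++ B ++ U.map Prod.fst)) p.2

theorem corners_nil (k : ℝ) (n : ℕ) (B : List (V × V)) : K.Corners k n [] B :=
  fun U p U' h => by simp at h

theorem corners_cons {k : ℝ} {n : ℕ} {p : (V × V) × ℝ} {C : List ((V × V) × ℝ)}
    {B : List (V × V)} :
    K.Corners k n (p :: C) B ↔
      K.Corner k n (p.1 :: (C.map Prod.fst ++ B)) p.2 ∧ K.Corners k n C (B ++ [p.1]) := by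
  constructor
  · intro h
    refine ⟨by simpa using h [] p C rfl, fun U q U' hC => ?_⟩
    have := h (p :: U) q U' (by simp [hC])
    simpa using this
  · rintro ⟨h1, h2⟩ U q U' hC
    cases U with
    | nil =>
      simp only [List.nil_append, List.cons.injEq] at hC
      obtain ⟨rfl, rfl⟩ := hC
      simpa using h1
    | cons r U =>
      simp only [List.cons_append, List.cons.injEq] at hC
      obtain ⟨rfl, hC⟩ := hC
      simpa using h2 U q U' hC

theorem corners_append {k : ℝ} {n : ℕ} {C C' : List ((V × V) × ℝ)} {B : List (V × V)} :
    K.Corners k n (C ++ C') B ↔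
      K.Corners k n C (C'.map Prod.fst ++ B) ∧ K.Corners k n C' (B ++ C.map Prod.fst) := by
  induction C generalizing B with
  | nil => simp [corners_nil]
  | cons p C ih =>
    rw [List.cons_append, corners_cons, corners_cons, ih]
    simp only [List.map_append, List.append_assoc, List.map_cons, List.cons_append,
      List.nil_append]
    tauto

/-- Decorations survive changes of the boundary elsewhere, provided that no corner in question cuts
the changed part. -/
theorem Corners.subst {k : ℝ} {n l : ℕ} {C : List ((V × V) × ℝ)} {B D D' B' : List (V × V)}
    (hB' : B' ≠ [])
    (h : ∀ u v m, NullWord K.IsTriangle m (u ++ D ++ v) →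
      NullWord K.IsTriangle (m + l) (u ++ D' ++ v))
    (hs : ∀ p q, B' ++ C.map Prod.fst ++ B = q ++ p → K.Uncut n p D q)
    (hC : K.Corners k n C (B ++ D ++ B')) : K.Corners k (n + l) C (B ++ D' ++ B') := by
  intro U p U' hU
  have h1 := hC U p U' hU
  have h2 := Corner.subst (p := p.1 :: (U'.map Prod.fst ++ B)) (q := B' ++ U.map Prod.fst)
    (D := D) (D' := D') (k := k) (n := n) (l := l) (s := p.2) (by simp) (by simp [hB']) h
    (hs _ _ (by simp [hU])) (by simpa using h1)
  simpa using h2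

/-- `n` is the least area of a disc diagram with boundary word `c`. -/
def IsArea (K : HyperbolicTwoComplex V) (n : ℕ) (c : List (V × V)) : Prop :=
  NullWord K.IsTriangle n c ∧ ∀ m, NullWord K.IsTriangle m c → n ≤ m

/-- The word `c`, which bounds a disc diagram with `n` triangles, can be decorated such that the
sum over all corners of the turnings is at least `2π`. -/
def GaussBonnet (K : HyperbolicTwoComplex V) (k : ℝ) (n : ℕ) (c : List (V × V)) : Prop :=
  ∃ C : List ((V × V) × ℝ), C.map Prod.fst = c ∧ K.Corners k n C [] ∧
    2 * Real.pi ≤ (C.map Prod.snd).sum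

theorem GaussBonnet.rotate {k : ℝ} {n : ℕ} {a b : List (V × V)}
    (h : K.GaussBonnet k n (a ++ b)) : K.GaussBonnet k n (b ++ a) := by
  obtain ⟨C, hC, h1, h2⟩ := h
  obtain ⟨A, B, rfl, rfl, rfl⟩ := List.map_eq_append_iff.1 hC
  refine ⟨B ++ A, by simp, ?_, by simpa [add_comm] using h2⟩
  rw [corners_append] at h1 ⊢
  simpa using h1.symm

/-- Each of the two discs on the sides of a bridge has turning at least `π`, apart from the
turning at its attaching point. -/
theorem exists_corners_lobe {k : ℝ} {m n : ℕ} {x z : V} {c v : List (V × V)}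
    (hc : NullWord K.IsTriangle m c) (hv : NullWord K.IsTriangle n v)
    (ih : c ≠ [] → K.GaussBonnet k m c) :
    ∃ C : List ((V × V) × ℝ), C.map Prod.fst = c ++ [(z, x)] ∧
      K.Corners k (m + n) C (v ++ [(x, z)]) ∧ Real.pi ≤ (C.map Prod.snd).sum := by
  have hpi := Real.pi_pos
  have hX : NullWord K.IsTriangle n ((z, x) :: (v ++ [(x, z)])) :=
    (NullWord.pair (x := z) (y := x) hv NullWord.nil).cast_eq (by simp) (by simp)
  by_cases hc0 : c = []
  · subst hc0
    refine ⟨[((z, x), Real.pi)], by simp, ?_, by simp⟩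
    rw [corners_cons]
    refine ⟨Or.inr ⟨z, x, x, v, .nil, n, by simp, hv.cast_eq rfl (by simp [fan]), by simp,
      by simp [linkLength]⟩, corners_nil _ _ _⟩
  · obtain ⟨C, rfl, h1, h2⟩ := ih hc0
    obtain ⟨⟨d, s⟩, C, rfl⟩ := List.exists_cons_of_ne_nil (l := C) (by rintro rfl; simp at hc0)
    rw [corners_cons] at h1
    have hs := h1.1.le_pi
    refine ⟨(d, 0) :: (C ++ [((z, x), 0)]), by simp, ?_, ?_⟩
    · rw [corners_cons, corners_append, corners_cons]
      refine ⟨Or.inl ⟨le_rfl, d :: C.map Prod.fst, (z, x) :: (v ++ [(x, z)]), m, n, by simp,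
        by simp, by simp, by simpa using hc, hX, le_rfl⟩, ?_,
        Or.inl ⟨le_rfl, (z, x) :: (v ++ [(x, z)]), d :: C.map Prod.fst, n, m, by simp,
        by simp, by simp, hX, by simpa using hc, by omega⟩, corners_nil _ _ _⟩
      have := Corners.subst (k := k) (n := m) (l := n) (C := C) (B := []) (D := [])
        (D' := (z, x) :: (v ++ [(x, z)])) (B' := [d]) (by simp)
        (fun a b i h => (hX.insert (u := a) (v := b) (by simpa using h)).cast_eq (by omega) rfl)
        (fun _ _ _ => uncut_nil _ _ _) (by simpa using h1.2)
      simpa using this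
    · simp only [List.map_cons, List.map_append, List.sum_cons, List.sum_append, List.map_nil,
        List.sum_nil] at h2 ⊢
      linarith

/-- In a diagram of least area, a fan around the vertex `y` that a triangle `x y z` closes up has
angle sum at least `2π`, as otherwise the diagram could be folded. -/
theorem two_pi_le_of_fan_closes {k : ℝ} (hK : K.IsNegativelyCurved k) {n n' : ℕ} {x y z : V}
    {v : List (V × V)} (hT : K.IsTriangle x y z) (hmin : K.IsArea (n + 1) ((x, z) :: v))
    (W : (K.link y).Walk x z) (hW : NullWord K.IsTriangle n' (v ++ K.fan W))
    (hn : n' + W.length ≤ n) : 2 * Real.pi ≤ K.angle k y x z + K.linkLength k y W := by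
  have hrot : ∀ x y z, K.IsTriangle x y z → K.IsTriangle y z x := fun _ _ _ => K.isTriangle_rotate
  have hadj : (K.link y).Adj z x := K.isTriangle_swap (K.isTriangle_rotate (K.isTriangle_rotate hT))
  have hsum : K.linkLength k y (.cons hadj W) = K.angle k y x z + K.linkLength k y W := by
    simp [linkLength, K.angle_comm k y z x]
  rw [← hsum]
  refine K.two_pi_le_linkLength_of_not_backtrack (hK.2 y) _ SimpleGraph.Walk.not_nil_cons ?_
  rintro ⟨p', a, b, d, h1, h2⟩
  -- a shorter fan gives a diagram of smaller area
  have key : ∀ (W' : (K.link y).Walk x z) (m : ℕ), NullWord K.IsTriangle m (v ++ K.fan W') →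
      m + W'.length < n → False := by
    intro W' m hm hlt
    have h3 := fan_fill W' hm
    have h4 := NullWord.rotate hrot h3
    have := hmin.2 _ (NullWord.tri hT h4)
    omega
  rw [SimpleGraph.Walk.darts_cons] at h1
  cases a with
  | nil =>
    simp only [List.nil_append, List.cons.injEq] at h1
    obtain ⟨rfl, h1⟩ := h1
    cases W with
    | nil => simp at h1
    | @cons _ q _ hq W =>
      rw [SimpleGraph.Walk.darts_cons, List.cons.injEq] at h1
      have hqz : q = z := congrArg (fun d => d.toProd.2) h1.1
      subst hqz
      have h3 := fan_fill W (n := n') (r := v ++ [(x, q)]) (hW.cast_eq rfl (by simp [fan]))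
      obtain ⟨n'', hn'', h4⟩ := NullWord.fold hrot (u := v ++ [(x, q)]) (v := [])
        (x := q) (y := y) (h3.cast_eq rfl (by simp))
      have h5 := NullWord.rotate hrot (a := v) (b := [(x, q)]) (by simpa using h4)
      have := hmin.2 _ h5
      simp only [SimpleGraph.Walk.length_cons] at hn
      omega
  | cons e a =>
    simp only [List.cons_append, List.cons.injEq] at h1
    obtain ⟨rfl, h1⟩ := h1
    cases p' with
    | nil => simp at h2
    | @cons _ q _ hq W' =>
      rw [SimpleGraph.Walk.darts_cons, List.cons_append, List.cons.injEq] at h2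
      have hqx : q = x := congrArg (fun d => d.toProd.2) h2.1
      subst hqx
      have hlen := length_darts_append h1 h2.2
      have hf : K.fan W = a.map (·.toProd) ++ (d.fst, d.snd) :: (d.snd, d.fst) ::
          b.map (·.toProd) := by
        simp [fan, h1]; rfl
      have hf' : K.fan W' = a.map (·.toProd) ++ b.map (·.toProd) := by simp [fan, h2.2]
      obtain ⟨n'', hn'', h4⟩ := NullWord.fold hrot (u := v ++ a.map (·.toProd))
        (v := b.map (·.toProd)) (x := d.fst) (y := d.snd) (hW.cast_eq rfl (by simp [hf]))
      exact key W' n'' (h4.cast_eq rfl (by simp [hf'])) (by omega)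

/-- The combinatorial Gauss–Bonnet inequality: the turnings of the boundary of a disc diagram of
least area in a negatively curved complex add up to at least `2π`. -/
theorem gaussBonnet {k : ℝ} (hK : K.IsNegativelyCurved k) {n : ℕ} {c : List (V × V)} (hc : c ≠ [])
    (hmin : K.IsArea n c) : K.GaussBonnet k n c := by
  have hrot : ∀ x y z, K.IsTriangle x y z → K.IsTriangle y z x := fun _ _ _ => K.isTriangle_rotate
  have hne : ∀ x y z, K.IsTriangle x y z → x ≠ z := fun _ _ _ h => h.2.2.1
  have hpi := Real.pi_pos
  suffices H : ∀ (N n : ℕ) (c : List (V × V)), 2 * n + c.length < N → c ≠ [] → K.IsArea n c →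
      K.GaussBonnet k n c from H _ n c (Nat.lt_succ_self _) hc hmin
  intro N
  induction N with
  | zero => intro n c hN; omega
  | succ N ih =>
    intro n c hN hc hmin
    obtain ⟨⟨x, z⟩, v, rfl⟩ := List.exists_cons_of_ne_nil hc
    rcases NullWord.of_cons hmin.1 with ⟨c, v, m₁, m₂, rfl, rfl, h1, h2⟩ | ⟨y, n, rfl, hT, h'⟩
    · -- the first edge is a bridge
      have hm₁ : K.IsArea m₁ c := ⟨h1, fun m hm => by
        have := hmin.2 _ (NullWord.pair hm h2); omega⟩
      have hm₂ : K.IsArea m₂ v := ⟨h2, fun m hm => by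
        have := hmin.2 _ (NullWord.pair h1 hm); omega⟩
      simp only [List.length_cons, List.length_append] at hN
      obtain ⟨C, hC, c1, c2⟩ := exists_corners_lobe (k := k) (x := x) (z := z) h1 h2
        (fun h => ih m₁ c (by omega) h hm₁)
      obtain ⟨D, hD, d1, d2⟩ := exists_corners_lobe (k := k) (x := z) (z := x) h2 h1
        (fun h => ih m₂ v (by omega) h hm₂)
      have : K.GaussBonnet k (m₁ + m₂) ((c ++ (z, x) :: v) ++ [(x, z)]) := by
        refine ⟨C ++ D, by simp [hC, hD], ?_, ?_⟩
        · rw [corners_append, hC, hD]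
          exact ⟨by simpa using c1, by simpa [add_comm] using d1⟩
        · rw [List.map_append, List.sum_append]; linarith
      exact this.rotate
    · -- the first edge is a side of the triangle `x y z`
      have hminc : K.IsArea n ((x, y) :: (y, z) :: v) := ⟨h', fun m hm => by
        have := hmin.2 _ (NullWord.tri hT hm); omega⟩
      have htri : ∀ u w m, NullWord K.IsTriangle m (u ++ [(x, y), (y, z)] ++ w) →
          NullWord K.IsTriangle (m + 1) (u ++ [(x, z)] ++ w) := fun u w m h =>
        (NullWord.tri_mid hrot hT (u := u) (v := w) (h.cast_eq rfl (by simp))).cast_eq rfl (by simp)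
      have hyz : ∀ m, ¬ NullWord K.IsTriangle m [(y, z)] := fun m =>
        NullWord.not_singleton hne
      have hxy : ∀ m, ¬ NullWord K.IsTriangle m [(x, y)] := fun m =>
        NullWord.not_singleton hne
      have hxz : ∀ m, ¬ NullWord K.IsTriangle m [(x, z)] := fun m =>
        NullWord.not_singleton hne
      have hangle := K.angle_sum_le hK.1 hT
      simp only [List.length_cons] at hN
      by_cases hcut : ∃ v₁ v₂ m₁ m₂, v = v₁ ++ v₂ ∧ NullWord K.IsTriangle m₁ ((y, z) :: v₁) ∧
          NullWord K.IsTriangle m₂ (v₂ ++ [(x, y)]) ∧ m₁ + m₂ ≤ n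
      · -- the rest of the diagram consists of two diagrams that touch at `y`
        obtain ⟨v₁, v₂, m₁, m₂, rfl, h1, h2, hm⟩ := hcut
        have hadd : ∀ i j, NullWord K.IsTriangle i ((y, z) :: v₁) →
            NullWord K.IsTriangle j (v₂ ++ [(x, y)]) → n ≤ i + j := fun i j hi hj =>
          hminc.2 _ ((NullWord.rotate hrot (a := (y, z) :: (v₁ ++ v₂)) (b := [(x, y)])
            ((hi.concat hj).cast_eq rfl (by simp))).cast_eq rfl (by simp))
        have hmn : m₁ + m₂ = n := le_antisymm hm (hadd _ _ h1 h2)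
        subst hmn
        have hm₁ : K.IsArea m₁ ((y, z) :: v₁) := ⟨h1, fun m hm => by
          have := hadd _ _ hm h2; omega⟩
        have hm₂ : K.IsArea m₂ (v₂ ++ [(x, y)]) := ⟨h2, fun m hm => by
          have := hadd _ _ h1 hm; omega⟩
        have hv₁ : v₁ ≠ [] := by rintro rfl; exact hyz _ h1
        have hv₂ : v₂ ≠ [] := by rintro rfl; exact hxy _ h2
        obtain ⟨d₁, v₁, rfl⟩ := List.exists_cons_of_ne_nil hv₁
        obtain ⟨d₂, v₂, rfl⟩ := List.exists_cons_of_ne_nil hv₂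
        simp only [List.length_append, List.length_cons] at hN
        obtain ⟨C₁, e1, c1, s1⟩ := ih m₁ _ (by simp; omega) (by simp) hm₁
        obtain ⟨C₂, e2, c2, s2⟩ := ih m₂ _ (by simp; omega) (by simp) hm₂
        obtain ⟨⟨_, a0⟩, _, rfl, rfl, f1⟩ := List.map_eq_cons_iff.1 e1
        obtain ⟨⟨d₁, a1⟩, C₁, rfl, rfl, rfl⟩ := List.map_eq_cons_iff.1 f1
        rw [List.cons_append] at e2
        obtain ⟨⟨d₂, b0⟩, _, rfl, rfl, f2⟩ := List.map_eq_cons_iff.1 e2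
        obtain ⟨C₂, _, rfl, rfl, f3⟩ := List.map_eq_append_iff.1 f2
        obtain ⟨⟨_, b1⟩, _, rfl, rfl, f4⟩ := List.map_eq_cons_iff.1 f3
        obtain rfl := List.map_eq_nil_iff.1 f4
        simp only at h1 h2 c1 c2 s1 s2 hm₁ hm₂ hadd hminc hmin
        simp only [corners_cons, corners_append, List.map_cons, List.map_append, List.map_nil,
          List.append_nil, List.nil_append, List.cons_append] at c1 c2
        simp only [List.map_cons, List.map_append, List.sum_cons, List.sum_append, List.map_nil,
          List.sum_nil] at s1 s2
        obtain ⟨s, hs, hs'⟩ := Corner.glue_apex hT hv₁ hv₂ h1 h2 c1.1 c2.1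
        refine ⟨((x, z), b1 - K.angle k x y z) :: (d₁, a1 - K.angle k z x y) ::
          (C₁ ++ (d₂, s) :: C₂), by simp, ?_, ?_⟩
        · simp only [corners_cons, corners_append, List.map_cons, List.map_append,
            List.append_nil, List.nil_append, List.cons_append]
          refine ⟨?_, ?_, ?_, ?_, ?_⟩
          · have := Corner.glue_left (k := k) (n := m₂) (l := m₁) (Q := [])
              (Q' := d₁ :: C₁.map Prod.fst) (q := d₂ :: C₂.map Prod.fst) (s := b1) hT (by simp)
              (fun u w m h => ((h1.insert (u := u) (v := w) (by simpa using h))).cast_eq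
                (by omega) rfl) (uncut_nil _ _ _) (by simpa using c2.2.2.1)
              (fun m h => absurd rfl h)
            rw [add_comm m₂ m₁] at this
            simpa using this
          · have := Corner.glue_right (k := k) (n := m₁) (l := m₂) (Q := [])
              (q := d₁ :: C₁.map Prod.fst) (Q' := d₂ :: C₂.map Prod.fst) (s := a1) hT (by simp)
              (fun u w m h => ((h2.insert (u := u) (v := w) (by simpa using h))).cast_eq
                (by omega) rfl) (uncut_nil _ _ _) (by simpa using c1.2.1)
              (fun m h => absurd rfl h)
            simpa using this
          · have := Corners.subst (k := k) (n := m₁) (l := m₂ + 1) (C := C₁) (B := [])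
              (D := [(y, z)]) (D' := d₂ :: C₂.map Prod.fst ++ [(x, z)]) (B' := [d₁]) (by simp)
              (fun u w m h => ((NullWord.tri_mid hrot hT (u := u ++ d₂ :: C₂.map Prod.fst)
                (v := w) ((h2.insert (u := u) (v := (y, z) :: w) (by simpa using h)).cast_eq rfl
                (by simp)))).cast_eq (by omega) (by simp))
              (fun _ _ _ => uncut_singleton _ _ _ _) (by simpa using c1.2.2)
            simpa [add_assoc] using this
          · simpa using hs
          · have := Corners.subst (k := k) (n := m₂) (l := m₁ + 1) (C := C₂) (B := [])
              (D := [(x, y)]) (D' := (x, z) :: d₁ :: C₁.map Prod.fst) (B' := [d₂]) (by simp)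
              (fun u w m h => ((NullWord.tri_mid hrot hT (u := u)
                (v := d₁ :: C₁.map Prod.fst ++ w)
                ((h1.insert (u := u ++ [(x, y)]) (v := w) (by simpa using h)).cast_eq rfl
                (by simp)))).cast_eq (by omega) (by simp))
              (fun _ _ _ => uncut_singleton _ _ _ _) (by simpa using c2.2.1)
            rw [show m₁ + m₂ + 1 = m₂ + (m₁ + 1) by omega]
            simpa using this
        · simp only [List.map_cons, List.map_append, List.sum_cons, List.sum_append]
          linarith
      · -- the triangles at `y` form a fan, so `y` is an interior vertex
        push Not at hcut
        obtain ⟨C, e1, c1, s1⟩ := ih n _ (by simp; omega) (by simp) hminc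
        have hv : v ≠ [] := by rintro rfl; exact hxz _ hmin.1
        obtain ⟨d, v, rfl⟩ := List.exists_cons_of_ne_nil hv
        obtain ⟨⟨_, a0⟩, _, rfl, rfl, f1⟩ := List.map_eq_cons_iff.1 e1
        obtain ⟨⟨_, a1⟩, _, rfl, rfl, f2⟩ := List.map_eq_cons_iff.1 f1
        obtain ⟨⟨d, a2⟩, C, rfl, rfl, rfl⟩ := List.map_eq_cons_iff.1 f2
        simp only at h' c1 s1 hminc hmin hcut
        simp only [corners_cons, List.map_cons, List.append_nil, List.nil_append,
          List.cons_append] at c1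
        simp only [List.map_cons, List.sum_cons] at s1
        obtain ⟨cx, cy, cz, cC⟩ := c1
        have ha1 : a1 ≤ K.angle k y x z - Real.pi := by
          rcases cy with ⟨hs0, b₁, b₂, m₁, m₂, hb₁, hb₂, hb, h1, h2, hn⟩ |
            ⟨y', x', z', r, W, n', hb, h1, hn, hsW⟩
          · obtain ⟨e, b, rfl⟩ := List.exists_cons_of_ne_nil hb₁
            obtain ⟨b', f, rfl⟩ := List.eq_nil_or_concat' b₂ |>.resolve_left hb₂
            have hb2 : (y, z) :: ((d :: C.map Prod.fst) ++ [(x, y)]) = e :: ((b ++ b') ++ [f]) := by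
              simpa using hb
            obtain ⟨rfl, h3⟩ := List.cons.inj hb2
            obtain ⟨h5, h4⟩ := List.append_inj' h3 rfl
            simp only [List.cons.injEq, and_true] at h4
            subst h4
            exact absurd hn (not_le.2 (hcut _ _ _ _ h5 h1 h2))
          · have hb2 : (y, z) :: ((d :: C.map Prod.fst) ++ [(x, y)]) =
                (y', z') :: (r ++ [(x', y')]) := by simpa using hb
            obtain ⟨h0, h3⟩ := List.cons.inj hb2
            obtain ⟨rfl, rfl⟩ := Prod.mk.inj h0
            obtain ⟨rfl, h4⟩ := List.append_inj' h3 rfl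
            simp only [List.cons.injEq, and_true, Prod.mk.injEq] at h4
            subst h4
            have := two_pi_le_of_fan_closes hK hT hmin W h1 hn
            linarith
        -- no corner cuts the diagram at `y`
        have hun : ∀ p q, q ++ p = d :: C.map Prod.fst → K.Uncut n p [(x, y), (y, z)] q :=
          fun p q hpq => uncut_pair fun m₁ m₂ h1 h2 => not_le.2
            ((hcut q p m₂ m₁ hpq.symm h2 h1).trans_eq (by omega))
        refine ⟨((x, z), a0 - K.angle k x y z) :: (d, a2 - K.angle k z x y) :: C, by simp, ?_, ?_⟩
        · simp only [corners_cons, List.map_cons, List.append_nil, List.nil_append,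
            List.cons_append]
          refine ⟨?_, ?_, ?_⟩
          · have := Corner.glue_left (k := k) (n := n) (l := 0) (Q := [(y, z)])
              (Q' := []) (q := d :: C.map Prod.fst) (s := a0) hT (by simp)
              (fun u w m h => h)
              (uncut_singleton _ _ _ _) (by simpa using cx)
              (fun m _ => hxy m)
            simpa using this
          · have := Corner.glue_right (k := k) (n := n) (l := 0) (Q := [(x, y)])
              (q := d :: C.map Prod.fst) (Q' := []) (s := a2) hT (by simp)
              (fun u w m h => h)
              (uncut_singleton _ _ _ _) (by simpa using cz)
              (fun m _ => hyz m)
            simpa using this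
          · have := Corners.subst (k := k) (n := n) (l := 1) (C := C) (B := [])
              (D := [(x, y), (y, z)]) (D' := [(x, z)]) (B' := [d]) (by simp) htri
              (fun p q h => hun p q (by simpa using h.symm)) (by simpa using cC)
            simpa using this
        · simp only [List.map_cons, List.sum_cons]
          linarith

/-- The word of the edge path `f 0`, `f 1`, …, `f d`. -/
def edgeWord (f : ℕ → V) (d : ℕ) : List (V × V) :=
  (List.range d).map fun t => (f t, f (t + 1))

/-- A closed geodesic does not bound a disc diagram: at each corner of a diagram of least area the
turning is at most `0`. -/
theorem not_nullWord_of_geodesic {k : ℝ} (hK : K.IsNegativelyCurved k) {f : ℕ → V} {d : ℕ}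
    (hd : 0 < d) (hf : ∀ t, f (t + d) = f t)
    (hgeo : ∀ t (W : (K.link (f (t + 1))).Walk (f t) (f (t + 2))),
      Real.pi ≤ K.linkLength k (f (t + 1)) W) (n : ℕ) :
    ¬ NullWord K.IsTriangle n (edgeWord f d) := by
  classical
  intro hn
  have hex : ∃ n, NullWord K.IsTriangle n (edgeWord f d) := ⟨n, hn⟩
  have hne : edgeWord f d ≠ [] := by simp [edgeWord]; omega
  obtain ⟨C, hC, hcor, hsum⟩ := gaussBonnet hK hne
    ⟨Nat.find_spec hex, fun m hm => Nat.find_min' hex hm⟩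
  have hlen : C.length = d := by simpa [edgeWord] using congrArg List.length hC
  have hget : ∀ i, i < d → (C.map Prod.fst)[i]? = some (f i, f (i + 1)) := by
    intro i hi
    rw [hC]
    simp [edgeWord, hi]
  have hle : ∀ p ∈ C, p.2 ≤ 0 := by
    intro p hp
    obtain ⟨U, U', rfl⟩ := List.append_of_mem hp
    rcases hcor U p U' rfl with ⟨h, -⟩ | ⟨y, x, z, r, W, n', hb, -, -, hs⟩
    · exact h
    have hpe : p.1 = (f U.length, f (U.length + 1)) := by
      have := hget U.length (by rw [← hlen]; simp)
      simpa using this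
    rw [List.append_nil] at hb
    obtain ⟨hp1, hb'⟩ := List.cons.inj hb
    rw [hpe] at hp1
    obtain ⟨rfl, rfl⟩ := Prod.mk.inj hp1
    refine hs.trans ?_
    rcases List.eq_nil_or_concat' U with rfl | ⟨U, e, rfl⟩
    · -- the corner at the starting point of the closed path
      obtain ⟨d, rfl⟩ : ∃ e, d = e + 1 := ⟨d - 1, by omega⟩
      have h1 := hget d (by omega)
      have hd0 : d ≠ 0 := by
        rintro rfl
        simp at hlen
        simp [hlen] at hb'
      have h2 : (U'.map Prod.fst)[d - 1]? = some (f d, f (d + 1)) := by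
        have : d = (d - 1) + 1 := by omega
        rw [List.nil_append, List.map_cons, this, List.getElem?_cons_succ, ← this] at h1
        exact h1
      have hl : U'.length = d := by simpa using hlen
      have hr : r.length = d - 1 := by
        have := congrArg List.length hb'
        simp [hl] at this; omega
      simp only [List.map_nil, List.append_nil] at hb'
      rw [hb', ← hr, List.getElem?_append_right le_rfl] at h2
      simp only [Nat.sub_self, List.length_nil, List.getElem?_cons_zero, Option.some.injEq,
        Prod.mk.injEq] at h2
      obtain ⟨rfl, h3⟩ := h2
      have e1 : f 0 = f (d + 1) := by simpa using (hf 0).symm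
      have e2 : f (0 + 1) = f (d + 2) := by
        have := (hf 1).symm
        rw [show 1 + (d + 1) = d + 2 by omega] at this
        simpa using this
      have key : ∀ (v w : V) (W : (K.link v).Walk (f d) w), v = f (d + 1) → w = f (d + 2) →
          Real.pi ≤ K.linkLength k v W := by
        rintro _ _ W rfl rfl
        exact hgeo d W
      have := key _ _ W (by simpa using e1) (by simpa using e2)
      linarith
    · have h1 := hget U.length (by rw [← hlen]; simp)
      simp only [List.map_append, List.map_cons, List.map_nil] at hb'
      rw [← List.append_assoc] at hb'
      obtain ⟨-, h4⟩ := List.append_inj' hb' rfl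
      simp only [List.cons.injEq, and_true] at h4
      simp [h4] at h1
      obtain ⟨rfl, h3⟩ := h1
      have key : ∀ (m : ℕ) (W : (K.link (f m)).Walk (f U.length) (f (m + 1))), m = U.length + 1 →
          Real.pi ≤ K.linkLength k (f m) W := by
        rintro _ W rfl
        exact hgeo _ W
      have := key _ W (by simp)
      linarith
  have : (C.map Prod.snd).sum ≤ 0 :=
    (List.sum_le_card_nsmul _ 0 fun s hs => by
      obtain ⟨p, hp, rfl⟩ := List.mem_map.1 hs
      exact hle p hp).trans_eq (by simp)
  linarith [Real.pi_pos]

end HyperbolicTwoComplex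

/-! ### Coverings of simplicial complexes -/

namespace AbstractSimplicialComplex

variable {V W : Type*}

/-- The barycentric coordinates of a point. -/
def Realization.coord {K : AbstractSimplicialComplex V} (t : K.Realization) : V → ℝ :=
  Subtype.val t

/-- The point with given barycentric coordinates. -/
def Realization.mk (K : AbstractSimplicialComplex V) (t : V → ℝ) (h0 : ∀ v, 0 ≤ t v)
    (h : ∃ s ∈ K.faces, (∀ v, v ∉ s → t v = 0) ∧ ∑ v ∈ s, t v = 1) : K.Realization :=
  ⟨t, h0, h⟩

@[simp]
theorem Realization.coord_mk (K : AbstractSimplicialComplex V) (t : V → ℝ) (h0 : ∀ v, 0 ≤ t v)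
    (h : ∃ s ∈ K.faces, (∀ v, v ∉ s → t v = 0) ∧ ∑ v ∈ s, t v = 1) :
    (Realization.mk K t h0 h).coord = t := rfl

theorem Realization.ext {K : AbstractSimplicialComplex V} {t t' : K.Realization}
    (h : ∀ v, t.coord v = t'.coord v) : t = t' := Subtype.ext (funext h)

theorem Realization.coord_nonneg {K : AbstractSimplicialComplex V} (t : K.Realization) (v : V) :
    0 ≤ t.coord v := (Subtype.property t).1 v

theorem continuous_coord (K : AbstractSimplicialComplex V) (v : V) :
    Continuous fun t : K.Realization => t.coord v :=
  (continuous_apply v).comp continuous_subtype_val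

theorem continuous_realization {K : AbstractSimplicialComplex V} {X : Type*} [TopologicalSpace X]
    {f : X → K.Realization} (h : ∀ v, Continuous fun x => (f x).coord v) : Continuous f :=
  continuous_induced_rng.2 (continuous_pi h)

/-- The simplex in which a point of the realization lies. -/
theorem exists_face_pos (K : AbstractSimplicialComplex V) (t : K.Realization) :
    ∃ s ∈ K.faces, (∀ v, v ∉ s → t.coord v = 0) ∧ ∑ v ∈ s, t.coord v = 1 ∧
      ∀ v, t.coord v ≠ 0 → v ∈ s := by
  obtain ⟨s, hs, h0, h1⟩ := (Subtype.property t).2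
  exact ⟨s, hs, h0, h1, fun v hv => by_contra fun hvs => hv (h0 v hvs)⟩

theorem exists_coord_pos (K : AbstractSimplicialComplex V) (t : K.Realization) :
    ∃ v, 0 < t.coord v := by
  by_contra! h
  obtain ⟨s, -, -, h1, -⟩ := K.exists_face_pos t
  have : ∑ v ∈ s, t.coord v ≤ 0 := Finset.sum_nonpos fun v _ => h v
  linarith

theorem coord_vertexPoint [DecidableEq V] (K : AbstractSimplicialComplex V) (v w : V) :
    (K.vertexPoint v).coord w = if w = v then 1 else 0 := by
  change Set.indicator {v} 1 w = _
  rw [Set.indicator_apply]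
  rfl

theorem vertexPoint_injective (K : AbstractSimplicialComplex V) :
    Function.Injective K.vertexPoint := by
  classical
  intro v w h
  have := K.coord_vertexPoint v v
  rw [h, coord_vertexPoint] at this
  by_contra hne
  simp [hne] at this

theorem coord_edgePath [DecidableEq V] {K : AbstractSimplicialComplex V} {x y : V}
    (h : K.Adj x y) (t : I) (v : V) :
    (K.edgePath h t).coord v = (1 - (t : ℝ)) * (if v = x then 1 else 0) +
      (t : ℝ) * (if v = y then 1 else 0) := by
  change (1 - (t : ℝ)) * Set.indicator {x} 1 v + (t : ℝ) * Set.indicator {y} 1 v = _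
  rw [Set.indicator_apply, Set.indicator_apply]
  rfl

/-- A local system of sets on a simplicial complex: transport along edges, such that the transport
around a simplex is trivial. -/
structure LocalSystem (K : AbstractSimplicialComplex V) (F : Type*) where
  transport : V → V → F → F
  self : ∀ x f, transport x x f = f
  comp : ∀ s ∈ K.faces, ∀ x ∈ s, ∀ y ∈ s, ∀ z ∈ s, ∀ f,
    transport y z (transport x y f) = transport x z f

namespace LocalSystem

variable {K : AbstractSimplicialComplex V} {F : Type*} (S : K.LocalSystem F)

open Classical in
/-- The covering complex of a local system. -/
def cover : AbstractSimplicialComplex (V × F) where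
  faces := {s | s.image Prod.fst ∈ K.faces ∧ ∀ a ∈ s, ∀ b ∈ s, b.2 = S.transport a.1 b.1 a.2}
  isRelLowerSet_faces := by
    rintro s ⟨hs, hc⟩
    refine ⟨Finset.image_nonempty.1 (K.isRelLowerSet_faces hs).1, fun t hts ht => ⟨?_, ?_⟩⟩
    · exact (K.isRelLowerSet_faces hs).2 (Finset.image_subset_image hts) (ht.image _)
    · exact fun a ha b hb => hc a (hts ha) b (hts hb)
  singleton_mem := by
    rintro ⟨v, f⟩
    refine ⟨by simpa using K.singleton_mem v, ?_⟩
    simp [S.self]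

theorem snd_eq_of_pos {t : S.cover.Realization} {a b : V × F} (ha : t.coord a ≠ 0)
    (hb : t.coord b ≠ 0) :
    b.2 = S.transport a.1 b.1 a.2 := by
  obtain ⟨s, hs, -, -, h⟩ := S.cover.exists_face_pos t
  exact hs.2 a (h a ha) b (h b hb)

theorem finsum_eq {t : S.cover.Realization} {a : V × F} (ha : t.coord a ≠ 0) (v : V) :
    ∑ᶠ f, t.coord (v, f) = t.coord (v, S.transport a.1 v a.2) :=
  finsum_eq_single _ _ fun f hf => by
    by_contra hne
    exact hf (S.snd_eq_of_pos ha hne)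

/-- The covering map. -/
def proj (t : S.cover.Realization) : K.Realization :=
  Realization.mk K (fun v => ∑ᶠ f, t.coord (v, f))
    (fun v => finsum_nonneg fun f => t.coord_nonneg _) <| by
    classical
    obtain ⟨s, hs, h0, h1, -⟩ := S.cover.exists_face_pos t
    obtain ⟨a, ha⟩ := S.cover.exists_coord_pos t
    have has : a ∈ s := by_contra fun h => ha.ne' (h0 a h)
    refine ⟨s.image Prod.fst, hs.1, fun v hv => ?_, ?_⟩
    · rw [S.finsum_eq ha.ne']
      exact h0 _ fun h => hv (Finset.mem_image_of_mem _ h)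
    · rw [Finset.sum_image, ← h1]
      · refine Finset.sum_congr rfl fun b hb => ?_
        rw [S.finsum_eq ha.ne', ← hs.2 a has b hb]
      · rintro ⟨x, f⟩ hb ⟨y, g⟩ hc hxy
        obtain rfl : x = y := hxy
        have := hs.2 _ hb _ hc
        simp only [S.self] at this
        rw [this]

theorem proj_apply {t : S.cover.Realization} {a : V × F} (ha : t.coord a ≠ 0) (v : V) :
    (S.proj t).coord v = t.coord (v, S.transport a.1 v a.2) := S.finsum_eq ha v

theorem continuous_proj : Continuous S.proj := by
  refine continuous_realization fun v => continuous_iff_continuousAt.2 fun t => ?_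
  obtain ⟨a, ha⟩ := S.cover.exists_coord_pos t
  have hopen : {t' : S.cover.Realization | 0 < t'.coord a} ∈ nhds t :=
    (isOpen_lt continuous_const (S.cover.continuous_coord a)).mem_nhds ha
  refine ((S.cover.continuous_coord (v, S.transport a.1 v a.2)).continuousAt).congr ?_
  filter_upwards [hopen] with t' ht'
  exact (S.proj_apply (ne_of_gt ht') v).symm

theorem exists_lift_pos {w : V} {t : S.cover.Realization} (h : 0 < (S.proj t).coord w) :
    ∃ g, 0 < t.coord (w, g) := by
  obtain ⟨a, ha⟩ := S.cover.exists_coord_pos t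
  rw [S.proj_apply ha.ne'] at h
  exact ⟨_, h⟩

open Classical in
/-- The lift of a point of the open star of `w` to the open star of `(w, g)`. -/
def lift (w : V) (t : {t : K.Realization // 0 < t.coord w}) (g : F) : S.cover.Realization :=
  Realization.mk S.cover (fun a => if a.2 = S.transport w a.1 g then t.1.coord a.1 else 0)
    (fun a => by
      split_ifs
      exacts [t.1.coord_nonneg _, le_rfl]) <| by
    obtain ⟨s, hs, h0, h1, h2⟩ := K.exists_face_pos t.1
    have hw : w ∈ s := h2 w (ne_of_gt t.2)
    refine ⟨s.image fun v => (v, S.transport w v g), ⟨?_, ?_⟩, ?_, ?_⟩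
    · rw [Finset.image_image]
      convert hs
      exact Finset.image_id
    · intro a ha b hb
      obtain ⟨v, hv, rfl⟩ := Finset.mem_image.1 ha
      obtain ⟨v', hv', rfl⟩ := Finset.mem_image.1 hb
      exact (S.comp s hs w hw v hv v' hv' g).symm
    · rintro ⟨v, f⟩ hv
      split_ifs with hf
      · refine h0 v fun hvs => hv (Finset.mem_image.2 ⟨v, hvs, ?_⟩)
        simp only at hf
        rw [hf]
      · rfl
    · rw [Finset.sum_image (fun v _ v' _ h => congrArg Prod.fst h), ← h1]
      exact Finset.sum_congr rfl fun v _ => by simp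

theorem lift_apply_self (w : V) (t : {t : K.Realization // 0 < t.coord w}) (g : F) :
    (S.lift w t g).coord (w, g) = t.1.coord w := by
  simp [lift, S.self]

theorem isCoveringMap_proj : IsCoveringMap S.proj := by
  classical
  let _ : TopologicalSpace F := ⊥
  have _ : DiscreteTopology F := ⟨rfl⟩
  intro t
  obtain ⟨w, hw⟩ := K.exists_coord_pos t
  suffices h : IsEvenlyCovered S.proj t F from h.to_isEvenlyCovered_preimage
  refine ⟨inferInstance,
    {t | 0 < t.coord w}, hw, isOpen_lt continuous_const (K.continuous_coord w),
    (isOpen_lt continuous_const (K.continuous_coord w)).preimage S.continuous_proj, ?_⟩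
  choose sheet hsheet using fun t : S.proj ⁻¹' {t | 0 < t.coord w} => S.exists_lift_pos t.2
  have sheet_eq : ∀ t g, t.1.coord (w, g) ≠ 0 → sheet t = g := fun t g hg => by
    simpa [S.self] using S.snd_eq_of_pos hg (ne_of_gt (hsheet t))
  have hlift : ∀ (t : {t : K.Realization // 0 < t.coord w}) g, S.proj (S.lift w t g) = t.1 := by
    intro t g
    have h1 : (S.lift w t g).coord (w, g) ≠ 0 := by rw [lift_apply_self]; exact ne_of_gt t.2
    refine Realization.ext fun v => ?_
    rw [S.proj_apply h1]
    simp [lift]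
  refine ⟨⟨⟨fun t => (⟨S.proj t.1, t.2⟩, sheet t), fun t => ⟨S.lift w t.1 t.2, ?_⟩, ?_, ?_⟩,
    ?_, ?_⟩, fun t => rfl⟩
  · rw [Set.mem_preimage, hlift]
    exact t.1.2
  · intro t
    apply Subtype.ext
    refine Realization.ext fun ⟨v, f⟩ => ?_
    have h1 := ne_of_gt (hsheet t)
    simp only [lift, Realization.coord_mk]
    split_ifs with hf
    · rw [S.proj_apply h1]
      simp only [hf]
    · by_contra hne
      exact hf (S.snd_eq_of_pos h1 (Ne.symm hne))
  · rintro ⟨t, g⟩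
    refine Prod.ext (Subtype.ext (hlift t g)) ?_
    refine sheet_eq _ _ ?_
    simp only
    rw [lift_apply_self]
    exact ne_of_gt t.2
  · refine Continuous.prodMk ((S.continuous_proj.comp continuous_subtype_val).subtype_mk _) ?_
    refine continuous_discrete_rng.2 fun g => ?_
    have : (sheet ⁻¹' {g}) = {t | 0 < t.1.coord (w, g)} := by
      ext t
      constructor
      · rintro rfl
        exact hsheet t
      · exact fun h => sheet_eq t g (ne_of_gt h)
    rw [this]
    exact isOpen_lt continuous_const ((S.cover.continuous_coord _).comp continuous_subtype_val)
  · refine Continuous.subtype_mk ?_ _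
    refine continuous_prod_of_discrete_right.2 fun g => continuous_realization fun a => ?_
    simp only [lift, Realization.coord_mk]
    split_ifs
    · exact (K.continuous_coord _).comp continuous_subtype_val
    · exact continuous_const

theorem adj_cover {x y : V} (h : K.Adj x y) (f : F) :
    S.cover.Adj (x, f) (y, S.transport x y f) := by
  classical
  obtain ⟨hne, s, hs, hx, hy⟩ := h
  refine ⟨fun h => hne (congrArg Prod.fst h), {(x, f), (y, S.transport x y f)}, ⟨?_, ?_⟩,
    by simp, by simp⟩
  · refine (K.isRelLowerSet_faces hs).2 ?_ (by simp)
    simp [Finset.insert_subset_iff, hx, hy]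
  · have := S.comp s hs x hx y hy x hx f
    simp only [Finset.mem_insert, Finset.mem_singleton]
    rintro a (rfl | rfl) b (rfl | rfl) <;> simp [S.self, this]

theorem proj_vertexPoint (a : V × F) : S.proj (S.cover.vertexPoint a) = K.vertexPoint a.1 := by
  classical
  refine Realization.ext fun v => ?_
  have h1 : (S.cover.vertexPoint a).coord a ≠ 0 := by simp [coord_vertexPoint]
  rw [S.proj_apply h1, coord_vertexPoint, coord_vertexPoint]
  by_cases hv : v = a.1
  · subst hv; simp [S.self]
  · have : (v, S.transport a.1 v a.2) ≠ a := fun h => hv (congrArg Prod.fst h)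
    simp [hv, this]

theorem proj_edgePath {a b : V × F} (h : K.Adj a.1 b.1) (h' : S.cover.Adj a b) (t : I) :
    S.proj (S.cover.edgePath h' t) = K.edgePath h t := by
  classical
  refine Realization.ext fun v => ?_
  have hsum : ∀ c : V × F,
      ∑ᶠ f, (if (v, f) = c then (1 : ℝ) else 0) = if v = c.1 then 1 else 0 := by
    intro c
    rw [finsum_eq_single _ c.2 (fun f hf => if_neg fun h => hf (congrArg Prod.snd h))]
    by_cases hv : v = c.1
    · subst hv; simp
    · rw [if_neg hv, if_neg fun h => hv (congrArg Prod.fst h)]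
  have hfin : ∀ (r : ℝ) (c : V × F),
      (Function.support fun f => r * (if (v, f) = c then (1 : ℝ) else 0)).Finite := fun r c =>
    (Set.finite_singleton c.2).subset fun f hf => by
      by_contra hne
      refine hf ?_
      have : (v, f) ≠ c := fun h => hne (congrArg Prod.snd h : f = c.2)
      simp [this]
  rw [coord_edgePath]
  show ∑ᶠ f, (S.cover.edgePath h' t).coord (v, f) = _
  simp only [coord_edgePath]
  rw [finsum_add_distrib (hfin _ _) (hfin _ _), ← mul_finsum, ← mul_finsum, hsum, hsum]

theorem proj_pathAlong {f : ℕ → V} {g : ℕ → F} (hf : ∀ j, K.Adj (f j) (f (j + 1)))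
    (hg : ∀ j, S.cover.Adj (f j, g j) (f (j + 1), g (j + 1))) (n : ℕ) (t : I) :
    S.proj (S.cover.pathAlong (fun j => (f j, g j)) hg n t) = K.pathAlong f hf n t := by
  induction n generalizing t with
  | zero => exact S.proj_vertexPoint _
  | succ n ih =>
    simp only [pathAlong, Path.trans_apply]
    split_ifs
    · exact ih _
    · exact S.proj_edgePath (hf n) (hg n) _

/-- The transport along a null-homotopic closed edge path is trivial. -/
theorem transport_eq_of_homotopic {f : ℕ → V} {g : ℕ → F} (hf : ∀ j, K.Adj (f j) (f (j + 1)))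
    (hg : ∀ j, g (j + 1) = S.transport (f j) (f (j + 1)) (g j)) {d : ℕ} (hd : f d = f 0)
    (h : ((K.pathAlong f hf d).cast rfl (congrArg K.vertexPoint hd.symm)).Homotopic (.refl _)) :
    g d = g 0 := by
  have hg' : ∀ j, S.cover.Adj (f j, g j) (f (j + 1), g (j + 1)) := fun j => by
    rw [hg]
    exact S.adj_cover (hf j) _
  have cov := S.isCoveringMap_proj
  let e₀ : S.proj ⁻¹' {K.vertexPoint (f 0)} := ⟨_, S.proj_vertexPoint (f 0, g 0)⟩
  let e₁ : S.proj ⁻¹' {K.vertexPoint (f 0)} := ⟨S.cover.vertexPoint (f d, g d),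
    (S.proj_vertexPoint (f d, g d)).trans (congrArg K.vertexPoint hd)⟩
  have h1 : cov.monodromy (.mk ((K.pathAlong f hf d).cast rfl (congrArg K.vertexPoint hd.symm)))
      e₀ = e₁ := by
    refine cov.monodromy_eq_of_map_eq (.mk (S.cover.pathAlong (fun j => (f j, g j)) hg' d)) ?_
    refine Eq.trans (congrArg Path.Homotopic.Quotient.mk (Path.ext ?_))
      (Path.Homotopic.Quotient.mk_cast _ _ _)
    ext t : 1
    exact S.proj_pathAlong hf hg' d t
  have h2 : Path.Homotopic.Quotient.mk
      ((K.pathAlong f hf d).cast rfl (congrArg K.vertexPoint hd.symm)) = .refl _ :=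
    Path.Homotopic.Quotient.eq.2 h
  rw [h2, cov.monodromy_refl] at h1
  have := S.cover.vertexPoint_injective (congrArg Subtype.val h1)
  exact (congrArg Prod.snd this).symm

end LocalSystem

end AbstractSimplicialComplex

/-! ### Null-homotopic edge paths bound disc diagrams -/

namespace AbstractSimplicialComplex

variable {V : Type*} (K : AbstractSimplicialComplex V)

/-- Two words of edges are equivalent if they can be exchanged as heads of null words. -/
def wordSetoid : Setoid (List (V × V)) where
  r w w' := ∀ v, (∃ n, NullWord K.IsTriangle n (w ++ v)) ↔ ∃ n, NullWord K.IsTriangle n (w' ++ v)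
  iseqv := ⟨fun _ _ => Iff.rfl, fun h v => (h v).symm, fun h h' v => (h v).trans (h' v)⟩

theorem wordSetoid_append {w w' : List (V × V)} (h : K.wordSetoid w w') (u : List (V × V)) :
    K.wordSetoid (w ++ u) (w' ++ u) := fun v => by
  simpa only [List.append_assoc] using h (u ++ v)

theorem wordSetoid_backtrack (w : List (V × V)) (x y : V) :
    K.wordSetoid (w ++ [(x, y)] ++ [(y, x)]) w := fun v => by
  constructor
  · rintro ⟨n, h⟩
    obtain ⟨n', -, h'⟩ := NullWord.fold (fun _ _ _ => K.isTriangle_rotate)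
      (u := w) (v := v) (x := x) (y := y) (by simpa using h)
    exact ⟨n', h'⟩
  · rintro ⟨n, h⟩
    exact ⟨_, (NullWord.pair_mid (x := x) (y := y) NullWord.nil h).cast_eq rfl (by simp)⟩

theorem wordSetoid_triangle (w : List (V × V)) {x y z : V} (hT : K.IsTriangle x y z) :
    K.wordSetoid (w ++ [(x, y)] ++ [(y, z)]) (w ++ [(x, z)]) := fun v => by
  constructor
  · rintro ⟨n, h⟩
    exact ⟨_, (NullWord.tri_mid (fun _ _ _ => K.isTriangle_rotate) hT
      (u := w) (v := v) (by simpa using h)).cast_eq rfl (by simp)⟩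
  · rintro ⟨n, h⟩
    -- insert the backtrack `z y z` after `x z`, and fill in the triangle `x z y`
    have h1 := NullWord.pair_mid (u := w ++ [(x, z)]) (v := v) (x := z) (y := y) NullWord.nil h
    have hT' : K.IsTriangle x z y := by
      obtain ⟨h1, h2, h3, s, hs, hx, hy, hz⟩ := hT
      exact ⟨h3, h2.symm, h1, s, hs, hx, hz, hy⟩
    exact ⟨_, (NullWord.tri_mid (fun _ _ _ => K.isTriangle_rotate) hT'
      (u := w) (v := (y, z) :: v) (h1.cast_eq rfl (by simp))).cast_eq rfl (by simp)⟩

open Classical in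
/-- The local system of words up to equivalence; transport along an edge appends this edge. -/
def wordSystem : K.LocalSystem (Quotient K.wordSetoid) where
  transport x y := if x = y then id else
    Quotient.map (fun w => w ++ [(x, y)]) fun _ _ h => K.wordSetoid_append h _
  self x f := by simp
  comp s hs x hx y hy z hz f := by
    induction f using Quotient.inductionOn with | _ w
    by_cases hxy : x = y
    · subst hxy; simp
    by_cases hyz : y = z
    · subst hyz; simp
    by_cases hxz : x = z
    · subst hxz
      simp only [hxy, hyz, if_false, if_true, Quotient.map_mk, id]
      exact Quotient.sound (K.wordSetoid_backtrack w x y)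
    · simp only [hxy, hyz, hxz, if_false, Quotient.map_mk]
      exact Quotient.sound (K.wordSetoid_triangle w ⟨hxy, hyz, hxz, s, hs, hx, hy, hz⟩)

theorem exists_nullWord_of_homotopic {f : ℕ → V} (hf : ∀ j, K.Adj (f j) (f (j + 1)))
    {d : ℕ} (hd : f d = f 0)
    (h : ((K.pathAlong f hf d).cast rfl (congrArg K.vertexPoint hd.symm)).Homotopic (.refl _)) :
    ∃ n, NullWord K.IsTriangle n (HyperbolicTwoComplex.edgeWord f d) := by
  have := K.wordSystem.transport_eq_of_homotopic (f := f)
    (g := fun j => Quotient.mk _ (HyperbolicTwoComplex.edgeWord f j)) hf (fun j => by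
      simp only [wordSystem, (hf j).1, if_false, Quotient.map_mk]
      simp [HyperbolicTwoComplex.edgeWord, List.range_succ]) hd h
  have := (Quotient.exact this [])
  simpa using this.2 ⟨0, by simpa [HyperbolicTwoComplex.edgeWord] using NullWord.nil⟩

end AbstractSimplicialComplex

namespace HyperbolicTwoComplex

variable {V : Type*} {K : HyperbolicTwoComplex V}

/-- A closed local geodesic is not null-homotopic. -/
theorem not_homotopic_refl_of_geodesic {k : ℝ} (hK : K.IsNegativelyCurved k) {f : ℕ → V}
    (hadj : ∀ j, K.Adj (f j) (f (j + 1))) {d : ℕ} (hd : 0 < d) (hf : ∀ t, f (t + d) = f t)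
    (hgeo : ∀ t (W : (K.link (f (t + 1))).Walk (f t) (f (t + 2))),
      Real.pi ≤ K.linkLength k (f (t + 1)) W) (hd0 : f d = f 0) :
    ¬ ((K.pathAlong f hadj d).cast rfl (congrArg K.vertexPoint hd0.symm)).Homotopic (.refl _) :=
  fun h => by
    obtain ⟨n, hn⟩ := K.exists_nullWord_of_homotopic hadj hd0 h
    exact not_nullWord_of_geodesic hK hd hf hgeo n hn

end HyperbolicTwoComplex

/-! ### Angles in halved and in nearly degenerate triangles -/

/-- Halving the sides of a hyperbolic triangle increases its angles: up to scale, a smaller triangle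
is a flatter one. -/
theorem hyperbolicAngle_lt_half {k a b c : ℝ} (hk : k < 0) (ha : 0 < a) (hb : 0 < b)
    (h1 : a < b + c) (h2 : b < a + c) (h3 : c < a + b) :
    hyperbolicAngle k a b c < hyperbolicAngle k (a / 2) (b / 2) (c / 2) := by
  have hs : 0 < √(-k) := Real.sqrt_pos.2 (by linarith)
  obtain ⟨A, hA⟩ : ∃ A, A = √(-k) * (a / 2) := ⟨_, rfl⟩
  obtain ⟨B, hB⟩ : ∃ B, B = √(-k) * (b / 2) := ⟨_, rfl⟩
  obtain ⟨C, hC⟩ : ∃ C, C = √(-k) * (c / 2) := ⟨_, rfl⟩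
  have A0 : 0 < A := hA ▸ mul_pos hs (by linarith)
  have B0 : 0 < B := hB ▸ mul_pos hs (by linarith)
  have hCAB : C < A + B := by
    rw [hA, hB, hC, ← mul_add]
    exact mul_lt_mul_of_pos_left (by linarith) hs
  have hABC : A < B + C := by
    rw [hA, hB, hC, ← mul_add]
    exact mul_lt_mul_of_pos_left (by linarith) hs
  have hBAC : B < A + C := by
    rw [hA, hB, hC, ← mul_add]
    exact mul_lt_mul_of_pos_left (by linarith) hs
  have ea : √(-k) * a = 2 * A := by rw [hA]; ring
  have eb : √(-k) * b = 2 * B := by rw [hB]; ring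
  have ec : √(-k) * c = 2 * C := by rw [hC]; ring
  unfold hyperbolicAngle
  rw [ea, eb, ec, ← hA, ← hB, ← hC]
  have sA : 0 < Real.sinh A := Real.sinh_pos_iff.2 A0
  have sB : 0 < Real.sinh B := Real.sinh_pos_iff.2 B0
  have cA := Real.cosh_pos A
  have cB := Real.cosh_pos B
  have l1 : Real.cosh C < Real.cosh (A + B) := by
    rw [Real.cosh_lt_cosh, abs_of_pos (by linarith), abs_of_pos (by linarith)]
    exact hCAB
  have l2 : Real.cosh (A - B) < Real.cosh C := by
    rw [Real.cosh_lt_cosh, abs_of_pos (a := C) (by linarith), abs_lt]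
    constructor <;> linarith
  rw [Real.cosh_add] at l1
  rw [Real.cosh_sub] at l2
  have hS : 0 < Real.sinh A * Real.sinh B := mul_pos sA sB
  have qA := Real.cosh_sq A
  have qB := Real.cosh_sq B
  have qC := Real.cosh_sq C
  rw [Real.cosh_two_mul, Real.cosh_two_mul, Real.cosh_two_mul, Real.sinh_two_mul,
    Real.sinh_two_mul]
  set X := (Real.cosh A * Real.cosh B - Real.cosh C) / (Real.sinh A * Real.sinh B) with hX
  set t := (Real.cosh C + (Real.cosh A * Real.cosh B - Real.sinh A * Real.sinh B)) /
    (2 * (Real.cosh A * Real.cosh B)) with ht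
  -- in terms of `1 - cos`, the angle of the large triangle is `t < 1` times that of the small one
  have key : ((Real.cosh A ^ 2 + Real.sinh A ^ 2) * (Real.cosh B ^ 2 + Real.sinh B ^ 2) -
      (Real.cosh C ^ 2 + Real.sinh C ^ 2)) /
      (2 * Real.sinh A * Real.cosh A * (2 * Real.sinh B * Real.cosh B)) = 1 - t * (1 - X) := by
    rw [hX, ht]
    field_simp
    grind
  have t1 : t < 1 := by
    rw [ht, div_lt_one (by positivity)]
    linarith
  have l3 := Real.cosh_pos (A - B)
  rw [Real.cosh_sub] at l3
  have t0 : 0 < t := div_pos (by linarith [Real.cosh_pos C]) (by positivity)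
  have X1 : X < 1 := by
    rw [hX, div_lt_one hS]
    linarith
  have X2 : -1 ≤ X := by
    rw [hX, le_div_iff₀ hS]
    linarith
  rw [key]
  exact Real.strictAntiOn_arccos ⟨X2, X1.le⟩ ⟨by nlinarith, by nlinarith⟩ (by nlinarith)

theorem continuousAt_hyperbolicAngle {X : Type*} [TopologicalSpace X] {k : ℝ} (hk : k < 0)
    {f g h : X → ℝ} {x : X} (hf : ContinuousAt f x) (hg : ContinuousAt g x)
    (hh : ContinuousAt h x) (f0 : 0 < f x) (g0 : 0 < g x) :
    ContinuousAt (fun x => hyperbolicAngle k (f x) (g x) (h x)) x := by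
  have hs : 0 < √(-k) := Real.sqrt_pos.2 (by linarith)
  unfold hyperbolicAngle
  refine Real.continuous_arccos.continuousAt.comp (ContinuousAt.div (by fun_prop) (by fun_prop) ?_)
  exact mul_ne_zero (Real.sinh_pos_iff.2 (mul_pos hs f0)).ne'
    (Real.sinh_pos_iff.2 (mul_pos hs g0)).ne'

/-- The angle opposite to a side that is as long as the two others together. -/
theorem hyperbolicAngle_degenerate {k a b : ℝ} (hk : k < 0) (ha : 0 < a) (hb : 0 < b) :
    hyperbolicAngle k a b (a + b) = Real.pi := by
  have hs : 0 < √(-k) := Real.sqrt_pos.2 (by linarith)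
  have h1 := Real.sinh_pos_iff.2 (mul_pos hs ha)
  have h2 := Real.sinh_pos_iff.2 (mul_pos hs hb)
  unfold hyperbolicAngle
  rw [mul_add, Real.cosh_add, Real.arccos_eq_pi, sub_add_cancel_left, neg_div,
    div_self (by positivity)]

theorem hyperbolicAngle_pos {k a b c : ℝ} (hk : k < 0) (ha : 0 < a) (hb : 0 < b)
    (h1 : a < b + c) (h2 : b < a + c) : 0 < hyperbolicAngle k a b c := by
  have hs : 0 < √(-k) := Real.sqrt_pos.2 (by linarith)
  have s1 := Real.sinh_pos_iff.2 (mul_pos hs ha)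
  have s2 := Real.sinh_pos_iff.2 (mul_pos hs hb)
  unfold hyperbolicAngle
  rw [Real.arccos_pos, div_lt_one (by positivity), sub_lt_comm, ← Real.cosh_sub, Real.cosh_lt_cosh,
    ← mul_sub, abs_mul, abs_mul, abs_of_pos hs]
  refine mul_lt_mul_of_pos_left ?_ hs
  rw [abs_of_pos (a := c) (by linarith), abs_lt]
  constructor <;> linarith

open Filter Topology in
/-- The triangles with sides `a + τ`, `b + τ`, `a + b - ρ` and the isosceles ones with
sides `a + τ`, `a + τ`, `2a` are almost degenerate. If `ρ` is small then the large angle of the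
former is almost `π`, and if `τ` is much smaller then the defects of the latter are small even in
comparison to the small angles of the former. -/
theorem exists_thin_triangles {J : Type*} [Finite J] {k ε : ℝ} (hk : k < 0) (hε : 0 < ε)
    {a : J → ℝ} (ha : ∀ j, 0 < a j) :
    ∃ ρ > 0, ∃ τ > 0, ∀ i j, ρ < 2 * a i ∧
      Real.pi - ε ≤ hyperbolicAngle k (a i + τ) (a j + τ) (a i + a j - ρ) ∧
      (Real.pi - hyperbolicAngle k (a i + τ) (a i + τ) (2 * a i)) / 2 ≤
        hyperbolicAngle k (a i + τ) (a i + a j - ρ) (a j + τ) := by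
  -- in the limit `ρ = τ = 0` all triangles are degenerate; in the limit `τ = 0` only the isosceles
  -- ones are, whereas the small angles of the other ones are positive
  have key : ∀ᶠ ρ in 𝓝[>] (0 : ℝ), ∀ i j, ρ < 2 * a i ∧ ∀ᶠ τ in 𝓝[>] (0 : ℝ),
      Real.pi - ε ≤ hyperbolicAngle k (a i + τ) (a j + τ) (a i + a j - ρ) ∧
      (Real.pi - hyperbolicAngle k (a i + τ) (a i + τ) (2 * a i)) / 2 ≤
        hyperbolicAngle k (a i + τ) (a i + a j - ρ) (a j + τ) := by
    refine eventually_all.2 fun i => eventually_all.2 fun j => ?_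
    have hi := ha i
    have hj := ha j
    have c1 : ContinuousAt (fun q : ℝ × ℝ =>
        hyperbolicAngle k (a i + q.2) (a j + q.2) (a i + a j - q.1)) (0, 0) :=
      continuousAt_hyperbolicAngle hk (by fun_prop) (by fun_prop) (by fun_prop) (by simpa)
        (by simpa)
    have e1 : ∀ᶠ q in 𝓝 ((0, 0) : ℝ × ℝ),
        Real.pi - ε < hyperbolicAngle k (a i + q.2) (a j + q.2) (a i + a j - q.1) :=
      c1.eventually_const_lt (by
        simp only [add_zero, sub_zero, hyperbolicAngle_degenerate hk hi hj]; linarith)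
    rw [nhds_prod_eq] at e1
    filter_upwards [e1.curry.filter_mono nhdsWithin_le_nhds, self_mem_nhdsWithin,
      (eventually_lt_nhds (mul_pos two_pos hi)).filter_mono nhdsWithin_le_nhds,
      (eventually_lt_nhds (mul_pos two_pos hj)).filter_mono nhdsWithin_le_nhds]
      with ρ h1 (h2 : 0 < ρ) h3 h4
    refine ⟨h3, ?_⟩
    have h5 : 0 < hyperbolicAngle k (a i) (a i + a j - ρ) (a j) :=
      hyperbolicAngle_pos hk hi (by linarith) (by linarith) (by linarith)
    have c2 : ContinuousAt (fun τ : ℝ => hyperbolicAngle k (a i + τ) (a i + a j - ρ) (a j + τ)) 0 :=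
      continuousAt_hyperbolicAngle hk (by fun_prop) (by fun_prop) (by fun_prop) (by simpa)
        (by linarith)
    have c3 : ContinuousAt (fun τ : ℝ =>
        (Real.pi - hyperbolicAngle k (a i + τ) (a i + τ) (2 * a i)) / 2) 0 :=
      ContinuousAt.div_const (continuousAt_const.sub (continuousAt_hyperbolicAngle hk (by fun_prop)
        (by fun_prop) (by fun_prop) (by simpa) (by simpa))) _
    have e2 := c3.eventually_lt c2 (by
      simp only [add_zero]
      rw [two_mul, hyperbolicAngle_degenerate hk hi hi]
      simpa using h5)
    filter_upwards [h1.filter_mono nhdsWithin_le_nhds, e2.filter_mono nhdsWithin_le_nhds]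
      with τ h6 h7
    exact ⟨h6.le, h7.le⟩
  obtain ⟨ρ, h1, h2⟩ := (key.and self_mem_nhdsWithin).exists
  obtain ⟨τ, h3, h4⟩ := ((eventually_all.2 fun i => eventually_all.2 fun j => (h1 i j).2).and
    self_mem_nhdsWithin).exists
  exact ⟨ρ, h2, τ, h4, fun i j => ⟨(h1 i j).1, h3 i j⟩⟩

/-! ### The complex with one new vertex for each edge of the geodesics -/

namespace HyperbolicTwoComplex

variable {V : Type*}

theorem setOf_isTriangle_finite (K : HyperbolicTwoComplex V) (v : V) :
    {q : V × V | K.IsTriangle q.1 v q.2}.Finite := by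
  have h : (⋃ s ∈ {s | s ∈ K.faces ∧ v ∈ s}, (s : Set V)).Finite :=
    (K.locallyFinite v).biUnion fun s _ => s.finite_toSet
  refine (h.prod h).subset ?_
  rintro ⟨u, w⟩ ⟨-, -, -, s, hs, hu, hv, hw⟩
  exact ⟨Set.mem_biUnion (⟨hs, hv⟩ : s ∈ {s | s ∈ K.faces ∧ v ∈ s}) hu,
    Set.mem_biUnion (⟨hs, hv⟩ : s ∈ {s | s ∈ K.faces ∧ v ∈ s}) hw⟩

/-- A family of closed geodesics, all of whose edges are indexed by `J`: the edge `j` leads from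
`vertex j` to `vertex (next j)`, and is followed by the edge `next j`. -/
structure GeodesicSystem (K : HyperbolicTwoComplex V) (k : ℝ) (J : Type*) where
  next : Equiv.Perm J
  vertex : J → V
  adj : ∀ j, K.Adj (vertex j) (vertex (next j))
  pi_le : ∀ j (W : (K.link (vertex (next j))).Walk (vertex j) (vertex (next (next j)))),
    Real.pi ≤ K.linkLength k (vertex (next j)) W

namespace GeodesicSystem

variable {K : HyperbolicTwoComplex V} {k : ℝ} {J : Type*} (S : K.GeodesicSystem k J)

/-- The edge `j` without its orientation. -/
def edge (j : J) : Sym2 V := s(S.vertex j, S.vertex (S.next j))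

/-- The edges of `K` that the geodesics run through. -/
abbrev Edge : Type _ := Set.range S.edge

/-- At `v`, one of the geodesics passes from `e` to `e'` or conversely. -/
def Turn (e : S.Edge) (v : V) (e' : S.Edge) : Prop :=
  ∃ j, v = S.vertex (S.next j) ∧
    ((e.1 = S.edge j ∧ e'.1 = S.edge (S.next j)) ∨ (e'.1 = S.edge j ∧ e.1 = S.edge (S.next j)))

theorem vertex_ne (j : J) : S.vertex j ≠ S.vertex (S.next (S.next j)) := by
  intro h
  have key : ∀ w (_ : S.vertex j = w)
      (_ : ∀ W : (K.link (S.vertex (S.next j))).Walk (S.vertex j) w,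
        Real.pi ≤ K.linkLength k (S.vertex (S.next j)) W), False := by
    rintro _ rfl h
    have := h .nil
    simp [linkLength] at this
    linarith [Real.pi_pos]
  exact key _ h (S.pi_le j)

theorem edge_ne (j : J) : S.edge j ≠ S.edge (S.next j) := by
  intro h
  unfold edge at h
  rcases Sym2.eq_iff.1 h with ⟨h1, -⟩ | ⟨h1, -⟩
  · exact (S.adj j).1 h1
  · exact S.vertex_ne j h1

variable {S}

theorem Turn.symm {e e' : S.Edge} {v : V} (h : S.Turn e v e') : S.Turn e' v e := by
  obtain ⟨j, hv, h⟩ := h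
  exact ⟨j, hv, h.symm⟩

theorem Turn.ne {e e' : S.Edge} {v : V} (h : S.Turn e v e') : e ≠ e' := by
  obtain ⟨j, -, ⟨h1, h2⟩ | ⟨h1, h2⟩⟩ := h
  · rintro rfl
    exact S.edge_ne j (h1.symm.trans h2)
  · rintro rfl
    exact S.edge_ne j (h1.symm.trans h2)

theorem Turn.mem {e e' : S.Edge} {v : V} (h : S.Turn e v e') : v ∈ e.1 := by
  obtain ⟨j, rfl, ⟨h1, h2⟩ | ⟨h1, h2⟩⟩ := h
  · rw [h1]; exact Sym2.mem_mk_right _ _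
  · rw [h2]; exact Sym2.mem_mk_left _ _

theorem Turn.mem' {e e' : S.Edge} {v : V} (h : S.Turn e v e') : v ∈ e'.1 := h.symm.mem

theorem eq_of_mem {e e' : S.Edge} {u v : V} (huv : u ≠ v) (h1 : u ∈ e.1) (h2 : v ∈ e.1)
    (h3 : u ∈ e'.1) (h4 : v ∈ e'.1) : e = e' :=
  Subtype.ext <| ((Sym2.mem_and_mem_iff huv).1 ⟨h1, h2⟩).trans
    ((Sym2.mem_and_mem_iff huv).1 ⟨h3, h4⟩).symm

theorem Turn.eq_of_mem {e e' : S.Edge} {v u : V} (h : S.Turn e v e') (h1 : u ∈ e.1)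
    (h2 : u ∈ e'.1) : u = v := by
  by_contra hne
  exact h.ne (GeodesicSystem.eq_of_mem hne h1 h.mem h2 h.mem')

theorem adj_of_mem {e : S.Edge} {u v : V} (huv : u ≠ v) (h1 : u ∈ e.1) (h2 : v ∈ e.1) :
    K.Adj u v := by
  obtain ⟨_, j, rfl⟩ := e
  obtain ⟨h0, s, hs, h3, h4⟩ := S.adj j
  simp only [edge, Sym2.mem_iff] at h1 h2
  refine ⟨huv, s, hs, ?_, ?_⟩
  · rcases h1 with rfl | rfl <;> assumption
  · rcases h2 with rfl | rfl <;> assumption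

variable (S)

/-- The vertex sets of the simplices that the enlarged complex is generated by: the simplices of
`K`, for each edge `e` of the geodesics a triangle with base `e` and apex the new vertex `e`, and
for each turn of the geodesics from `e` to `e'` at `v` a triangle with vertices `v` and the new
ones `e`, `e'`. -/
inductive IsCell : Set (V ⊕ S.Edge) → Prop
  | base (s : Finset V) (hs : s ∈ K.faces) : IsCell (Sum.inl '' (s : Set V))
  | tent (e : S.Edge) : IsCell ({Sum.inr e} ∪ Sum.inl '' {v | v ∈ e.1})
  | turn (e : S.Edge) (v : V) (e' : S.Edge) (h : S.Turn e v e') :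
      IsCell {Sum.inr e, Sum.inl v, Sum.inr e'}

/-- The enlarged complex. -/
def enlarge : AbstractSimplicialComplex (V ⊕ S.Edge) where
  faces := {s | s.Nonempty ∧ ∃ C, S.IsCell C ∧ (s : Set (V ⊕ S.Edge)) ⊆ C}
  isRelLowerSet_faces := by
    rintro s ⟨hs, C, hC, hsC⟩
    exact ⟨hs, fun t hts ht => ⟨ht, C, hC, fun a ha => hsC (hts ha)⟩⟩
  singleton_mem := by
    rintro (v | e)
    · exact ⟨Finset.singleton_nonempty _, _, .base {v} (K.singleton_mem v), by simp⟩
    · exact ⟨Finset.singleton_nonempty _, _, .tent e, by simp⟩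

variable {S}

theorem enlarge_adj_iff {a b : V ⊕ S.Edge} :
    S.enlarge.Adj a b ↔ a ≠ b ∧ ∃ C, S.IsCell C ∧ a ∈ C ∧ b ∈ C := by
  classical
  refine and_congr_right fun _ => ⟨?_, ?_⟩
  · rintro ⟨s, ⟨-, C, hC, hs⟩, ha, hb⟩
    exact ⟨C, hC, hs ha, hs hb⟩
  · rintro ⟨C, hC, ha, hb⟩
    exact ⟨{a, b}, ⟨by simp, C, hC, by simp [Set.insert_subset_iff, *]⟩, by simp, by simp⟩

theorem enlarge_isTriangle_iff {a b c : V ⊕ S.Edge} :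
    S.enlarge.IsTriangle a b c ↔
      a ≠ b ∧ b ≠ c ∧ a ≠ c ∧ ∃ C, S.IsCell C ∧ a ∈ C ∧ b ∈ C ∧ c ∈ C := by
  classical
  refine and_congr_right fun _ => and_congr_right fun _ => and_congr_right fun _ => ⟨?_, ?_⟩
  · rintro ⟨s, ⟨-, C, hC, hs⟩, ha, hb, hc⟩
    exact ⟨C, hC, hs ha, hs hb, hs hc⟩
  · rintro ⟨C, hC, ha, hb, hc⟩
    exact ⟨{a, b, c}, ⟨by simp, C, hC, by simp [Set.insert_subset_iff, *]⟩, by simp, by simp,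
      by simp⟩

theorem enlarge_adj_inl_inl {u w : V} (h : S.enlarge.Adj (.inl u) (.inl w)) : K.Adj u w := by
  obtain ⟨hne, C, hC, h1, h2⟩ := enlarge_adj_iff.1 h
  have hne' : u ≠ w := fun h => hne (congrArg _ h)
  cases hC with
  | base s hs => exact ⟨hne', s, hs, by simpa using h1, by simpa using h2⟩
  | tent e => exact adj_of_mem (e := e) hne' (by simpa using h1) (by simpa using h2)
  | turn e v e' h =>
    simp at h1 h2
    exact absurd (h1.trans h2.symm) hne'

theorem enlarge_adj_inl_inr {u : V} {e : S.Edge} (h : S.enlarge.Adj (.inl u) (.inr e)) :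
    u ∈ e.1 := by
  obtain ⟨hne, C, hC, h1, h2⟩ := enlarge_adj_iff.1 h
  cases hC with
  | base s hs => simp at h2
  | tent e' =>
    simp at h1 h2
    rwa [h2]
  | turn e' v e'' h =>
    simp at h1 h2
    subst h1
    rcases h2 with rfl | rfl
    exacts [h.mem, h.mem']

theorem isTriangle_inl_inl_inl {u v w : V}
    (h : S.enlarge.IsTriangle (.inl u) (.inl v) (.inl w)) : K.IsTriangle u v w := by
  obtain ⟨h1, h2, h3, C, hC, hu, hv, hw⟩ := enlarge_isTriangle_iff.1 h
  have h1' : u ≠ v := fun h => h1 (congrArg _ h)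
  have h2' : v ≠ w := fun h => h2 (congrArg _ h)
  have h3' : u ≠ w := fun h => h3 (congrArg _ h)
  cases hC with
  | base s hs =>
    exact ⟨h1', h2', h3', s, hs, by simpa using hu, by simpa using hv, by simpa using hw⟩
  | tent e =>
    simp at hu hv hw
    rw [(Sym2.mem_and_mem_iff h1').1 ⟨hu, hv⟩, Sym2.mem_iff] at hw
    exact (hw.elim (fun h => h3' h.symm) (fun h => h2' h.symm)).elim
  | turn e v e' h =>
    simp at hu hv
    exact absurd (hu.trans hv.symm) h1'

theorem isTriangle_inl_inl_inl_of {u v w : V} (h : K.IsTriangle u v w) :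
    S.enlarge.IsTriangle (.inl u) (.inl v) (.inl w) := by
  obtain ⟨h1, h2, h3, s, hs, hu, hv, hw⟩ := h
  exact enlarge_isTriangle_iff.2 ⟨by simpa, by simpa, by simpa, _, .base s hs, by simpa, by simpa,
    by simpa⟩

theorem isTriangle_inl_inl_inr {u v : V} {e : S.Edge}
    (h : S.enlarge.IsTriangle (.inl u) (.inl v) (.inr e)) : u ≠ v ∧ u ∈ e.1 ∧ v ∈ e.1 := by
  obtain ⟨h1, h2, h3, C, hC, hu, hv, hw⟩ := enlarge_isTriangle_iff.1 h
  exact ⟨fun h => h1 (congrArg _ h), enlarge_adj_inl_inr (enlarge_adj_iff.2 ⟨h3, C, hC, hu, hw⟩),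
    enlarge_adj_inl_inr (enlarge_adj_iff.2 ⟨h2, C, hC, hv, hw⟩)⟩

theorem isTriangle_inl_inr_inr {v : V} {e e' : S.Edge}
    (h : S.enlarge.IsTriangle (.inl v) (.inr e) (.inr e')) : S.Turn e v e' := by
  obtain ⟨h1, h2, h3, C, hC, hu, hv, hw⟩ := enlarge_isTriangle_iff.1 h
  cases hC with
  | base s hs => simp at hv
  | tent e' =>
    simp at hv hw
    exact absurd (by rw [hv, hw]) h2
  | turn e' v e'' h =>
    simp at hu hv hw
    subst hu
    rcases hv with rfl | rfl <;> rcases hw with rfl | rfl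
    exacts [absurd rfl h2, h, h.symm, absurd rfl h2]

theorem not_isTriangle_inr_inr_inr {e e' e'' : S.Edge} :
    ¬ S.enlarge.IsTriangle (.inr e) (.inr e') (.inr e'') := by
  rintro h
  obtain ⟨h1, h2, h3, C, hC, hu, hv, hw⟩ := enlarge_isTriangle_iff.1 h
  cases hC with
  | base s hs => simp at hv
  | tent e =>
    simp at hu hv
    exact h1 (by rw [hu, hv])
  | turn e₁ v e₂ h =>
    simp at hu hv hw
    grind

variable (S) in
/-- The lengths of the edges of the enlarged complex. All edges of `K` are halved. The new vertex
of an edge is by `τ` farther from its endpoints than the midpoint would be, and the edge between two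
new vertices is by `ρ` shorter than the way along the old edges between the midpoints. -/
def enlargeLength (ρ τ : ℝ) : Sym2 (V ⊕ S.Edge) → ℝ :=
  Sym2.lift ⟨fun
    | .inl u, .inl w => K.length s(u, w) / 2
    | .inl _, .inr e => K.length e.1 / 4 + τ
    | .inr e, .inl _ => K.length e.1 / 4 + τ
    | .inr e, .inr e' => K.length e.1 / 4 + K.length e'.1 / 4 - ρ, by
    rintro (u | e) (w | e')
    · simp only [Sym2.eq_swap (a := u)]
    · rfl
    · rfl
    · simp only [add_comm]⟩

theorem edge_length_pos (e : S.Edge) : 0 < K.length e.1 := by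
  obtain ⟨_, j, rfl⟩ := e
  exact K.length_pos _ _ (S.adj j)

variable (S) in
/-- Parameters for the lengths of the new edges that make the new triangles thin: `ρ` and `τ` are
those of `enlargeLength`. All angles of triangles of turns at vertices of `K` are at least `π - ε`
(`le_turn`). The angles of triangles of `K` at vertices that the geodesics run through increase by
at least `η ≥ 2 * ε` when the lengths are halved (`angle_add_le`). The angle at a new vertex `e` of
a triangle with base `e` differs from `π` by at most twice the angle there of any triangle of a
turn (`defect_le`). -/
structure Thinness where
  ρ : ℝ
  τ : ℝ
  ε : ℝ
  η : ℝ
  τ_pos : 0 < τ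
  ρ_pos : 0 < ρ
  η_pos : 0 < η
  ε_le_one : ε ≤ 1
  two_mul_ε_le : 2 * ε ≤ η
  ρ_lt : ∀ e : S.Edge, ρ < 2 * (K.length e.1 / 4)
  le_turn : ∀ e e' : S.Edge, Real.pi - ε ≤ hyperbolicAngle k (K.length e.1 / 4 + τ)
    (K.length e'.1 / 4 + τ) (K.length e.1 / 4 + K.length e'.1 / 4 - ρ)
  defect_le : ∀ e e' : S.Edge, (Real.pi - hyperbolicAngle k (K.length e.1 / 4 + τ)
      (K.length e.1 / 4 + τ) (2 * (K.length e.1 / 4))) / 2 ≤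
    hyperbolicAngle k (K.length e.1 / 4 + τ) (K.length e.1 / 4 + K.length e'.1 / 4 - ρ)
      (K.length e'.1 / 4 + τ)
  angle_add_le : ∀ j u w, K.IsTriangle u (S.vertex (S.next j)) w →
    K.angle k (S.vertex (S.next j)) u w + η ≤
      hyperbolicAngle k (K.length s(S.vertex (S.next j), u) / 2)
        (K.length s(S.vertex (S.next j), w) / 2) (K.length s(u, w) / 2)

/-- The angles of `K` increase when all lengths are halved. -/
theorem angle_lt_half (hk : k < 0) {u v w : V} (h : K.IsTriangle u v w) :
    K.angle k v u w < hyperbolicAngle k (K.length s(v, u) / 2) (K.length s(v, w) / 2)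
      (K.length s(u, w) / 2) := by
  have h1 := K.length_lt_add _ _ _ h
  have h2 := K.length_lt_add _ _ _ (K.isTriangle_rotate h)
  have h3 := K.length_lt_add _ _ _ (K.isTriangle_rotate (K.isTriangle_rotate h))
  have p : ∀ {u v w}, K.IsTriangle u v w → 0 < K.length s(v, u) := fun h => by
    obtain ⟨h1, -, -, s, hs, hu, hv, -⟩ := h
    exact K.length_pos _ _ ⟨h1.symm, s, hs, hv, hu⟩
  unfold angle
  rw [Sym2.eq_swap (a := u) (b := v)] at *
  rw [Sym2.eq_swap (a := w) (b := u)] at *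
  rw [Sym2.eq_swap (a := w) (b := v)] at *
  refine hyperbolicAngle_lt_half hk (p h) ?_ (by linarith) (by linarith) (by linarith)
  have := p (K.isTriangle_rotate h)
  rwa [Sym2.eq_swap] at this

open Filter Topology in
variable (S) in
theorem nonempty_thinness [Finite J] (hk : k < 0) : Nonempty S.Thinness := by
  have h1 : ∀ᶠ η in 𝓝[>] (0 : ℝ), ∀ j,
      ∀ q ∈ {q : V × V | K.IsTriangle q.1 (S.vertex (S.next j)) q.2},
      K.angle k (S.vertex (S.next j)) q.1 q.2 + η ≤
      hyperbolicAngle k (K.length s(S.vertex (S.next j), q.1) / 2)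
        (K.length s(S.vertex (S.next j), q.2) / 2) (K.length s(q.1, q.2) / 2) := by
    refine eventually_all.2 fun j => (eventually_all_finite (K.setOf_isTriangle_finite _)).2 ?_
    rintro ⟨u, w⟩ h
    have h0 := sub_pos.2 (angle_lt_half hk h)
    filter_upwards [(eventually_lt_nhds h0).filter_mono nhdsWithin_le_nhds] with η hη
    linarith
  obtain ⟨η, h2, h3 : 0 < η⟩ := (h1.and self_mem_nhdsWithin).exists
  obtain ⟨ρ, hρ, τ, hτ, h⟩ := exists_thin_triangles (ε := min (η / 2) 1) hk
    (lt_min (by linarith) one_pos) (a := fun e : S.Edge => K.length e.1 / 4)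
    (fun e => by linarith [edge_length_pos e])
  exact ⟨{
    ρ := ρ, τ := τ, ε := min (η / 2) 1, η := η, τ_pos := hτ, ρ_pos := hρ, η_pos := h3
    ε_le_one := min_le_right _ _
    two_mul_ε_le := by linarith [min_le_left (η / 2) 1]
    ρ_lt := fun e => (h e e).1
    le_turn := fun e e' => (h e e').2.1
    defect_le := fun e e' => (h e e').2.2
    angle_add_le := fun j u w ht => h2 j (u, w) ht }⟩

/-- The enlarged complex with its metric. -/
def complex [Finite J] (T : S.Thinness) : HyperbolicTwoComplex (V ⊕ S.Edge) where
  toAbstractSimplicialComplex := S.enlarge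
  card_le_three := by
    classical
    rintro s ⟨-, C, hC, hs⟩
    cases hC with
    | base t ht =>
      have : s ⊆ t.map ⟨Sum.inl, Sum.inl_injective⟩ := fun a ha => by
        simpa using hs ha
      exact (Finset.card_le_card this).trans ((Finset.card_map _).le.trans (K.card_le_three t ht))
    | tent e =>
      obtain ⟨_, j, rfl⟩ := e
      have : s ⊆ {Sum.inr ⟨S.edge j, j, rfl⟩, Sum.inl (S.vertex j),
          Sum.inl (S.vertex (S.next j))} :=
        fun a ha => by
          have := hs ha
          simp only [edge, Set.mem_union, Set.mem_singleton_iff, Set.mem_image, Set.mem_ofPred_eq,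
            Sym2.mem_iff] at this
          simp only [edge, Finset.mem_insert, Finset.mem_singleton]
          rcases this with h | ⟨v, rfl | rfl, h⟩
          exacts [Or.inl h, Or.inr (Or.inl h.symm), Or.inr (Or.inr h.symm)]
      exact (Finset.card_le_card this).trans Finset.card_le_three
    | turn e v e' h =>
      have : s ⊆ {Sum.inr e, Sum.inl v, Sum.inr e'} := fun a ha => by simpa using hs ha
      exact (Finset.card_le_card this).trans Finset.card_le_three
  locallyFinite a := by
    classical
    have hF : (Set.range Sum.inr ∪ Sum.inl '' (⋃ e : S.Edge, {v | v ∈ e.1}) :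
        Set (V ⊕ S.Edge)).Finite := by
      refine (Set.finite_range _).union (Set.Finite.image _ (Set.finite_iUnion fun e => ?_))
      obtain ⟨_, j, rfl⟩ := e
      refine (Set.toFinite {S.vertex j, S.vertex (S.next j)}).subset fun v hv => ?_
      simpa [edge] using hv
    have hB : (⋃ v ∈ {v | Sum.inl v = a},
        (Finset.map ⟨Sum.inl, Sum.inl_injective⟩ : Finset V → Finset (V ⊕ S.Edge)) ''
          {t | t ∈ K.faces ∧ v ∈ t}).Finite := by
      refine Set.Finite.biUnion ?_ fun v _ => (K.locallyFinite v).image _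
      exact (Set.finite_singleton a).preimage Sum.inl_injective.injOn
    refine (hB.union (hF.finite_subsets.preimage Finset.coe_injective.injOn)).subset ?_
    rintro s ⟨⟨hne, C, hC, hs⟩, ha⟩
    cases hC with
    | base t ht =>
      left
      obtain ⟨v, hv, rfl⟩ := hs ha
      refine Set.mem_biUnion (x := v) rfl ⟨s.preimage Sum.inl Sum.inl_injective.injOn, ⟨?_, ?_⟩, ?_⟩
      · refine (K.isRelLowerSet_faces ht).2 (fun u hu => ?_) ⟨v, by simpa using ha⟩
        obtain ⟨x, hx, h⟩ := hs (Finset.mem_preimage.1 hu)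
        rwa [Sum.inl_injective h] at hx
      · simpa using ha
      · ext b
        simp only [Finset.mem_map, Finset.mem_preimage, Function.Embedding.coeFn_mk]
        constructor
        · rintro ⟨u, hu, rfl⟩
          exact hu
        · intro hb
          obtain ⟨u, hu, rfl⟩ := hs hb
          exact ⟨u, hb, rfl⟩
    | tent e =>
      right
      intro b hb
      rcases hs hb with rfl | ⟨v, hv, rfl⟩
      · exact Or.inl ⟨_, rfl⟩
      · exact Or.inr ⟨v, Set.mem_iUnion.2 ⟨e, hv⟩, rfl⟩
    | turn e v e' h =>
      right
      intro b hb
      rcases hs hb with rfl | rfl | rfl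
      · exact Or.inl ⟨_, rfl⟩
      · exact Or.inr ⟨v, Set.mem_iUnion.2 ⟨e, h.mem⟩, rfl⟩
      · exact Or.inl ⟨_, rfl⟩
  length := S.enlargeLength T.ρ T.τ
  length_pos := by
    rintro (u | e) (w | e') h
    · have := K.length_pos _ _ (enlarge_adj_inl_inl h)
      simp only [enlargeLength, Sym2.lift_mk]
      linarith
    · have := edge_length_pos e'
      have := T.τ_pos
      simp only [enlargeLength, Sym2.lift_mk]
      linarith
    · have := edge_length_pos e
      have := T.τ_pos
      simp only [enlargeLength, Sym2.lift_mk]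
      linarith
    · have := T.ρ_lt e
      have := T.ρ_lt e'
      simp only [enlargeLength, Sym2.lift_mk]
      linarith
  length_lt_add := by
    have key : ∀ {u v : V} {e : S.Edge}, u ≠ v ∧ u ∈ e.1 ∧ v ∈ e.1 →
        K.length e.1 = K.length s(u, v) :=
      fun h => by rw [(Sym2.mem_and_mem_iff h.1).1 h.2]
    have rot : ∀ {a b c}, S.enlarge.IsTriangle a b c → S.enlarge.IsTriangle b c a :=
      fun h => S.enlarge.isTriangle_rotate h
    have hτ := T.τ_pos
    have hρ := T.ρ_pos
    rintro (u | e) (v | e') (w | e'') h <;> simp only [enlargeLength, Sym2.lift_mk]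
    · have := K.length_lt_add _ _ _ (isTriangle_inl_inl_inl h)
      linarith
    · have := key (isTriangle_inl_inl_inr h)
      have := edge_length_pos e''
      linarith
    · have := key (isTriangle_inl_inl_inr (rot (rot h)))
      rw [Sym2.eq_swap] at this
      linarith
    · have := T.ρ_lt e'
      have := T.ρ_lt e''
      linarith
    · have := key (isTriangle_inl_inl_inr (rot h))
      have := edge_length_pos e
      linarith
    · linarith
    · have := T.ρ_lt e
      have := T.ρ_lt e'
      linarith
    · exact absurd h not_isTriangle_inr_inr_inr

end GeodesicSystem

end HyperbolicTwoComplex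

/-! ### The links of the enlarged complex -/

namespace SimpleGraph.Walk

variable {V : Type*} {G : SimpleGraph V}

theorem exists_darts_eq_append {u w : V} {p : G.Walk u w} {d : G.Dart} (h : d ∈ p.darts) :
    ∃ (q : G.Walk u d.fst) (q' : G.Walk d.snd w), p.darts = q.darts ++ d :: q'.darts := by
  induction p with
  | nil => simp at h
  | cons hadj p ih =>
    rcases List.mem_cons.1 (by simpa using h) with rfl | h
    · exact ⟨nil, p, by simp⟩
    · obtain ⟨q, q', hq⟩ := ih h
      exact ⟨cons hadj q, q', by simp [hq]⟩

/-- A cycle leaves each of its vertices along two different edges. -/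
theorem IsCycle.exists_mem_edges {u v : V} {p : G.Walk u u} (hp : p.IsCycle) (hv : v ∈ p.support) :
    ∃ z z', z ≠ z' ∧ s(v, z) ∈ p.edges ∧ s(v, z') ∈ p.edges := by
  obtain ⟨z, z', hne, h⟩ := Set.ncard_eq_two.1 (hp.ncard_neighborSet_toSubgraph_eq_two hv)
  refine ⟨z, z', hne, ?_, ?_⟩
  · have : z ∈ p.toSubgraph.neighborSet v := by rw [h]; simp
    exact adj_toSubgraph_iff_mem_edges.1 this
  · have : z' ∈ p.toSubgraph.neighborSet v := by rw [h]; simp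
    exact adj_toSubgraph_iff_mem_edges.1 this

theorem exists_dart_of_mem_edges {u w a b : V} {p : G.Walk u w} (h : s(a, b) ∈ p.edges) :
    ∃ d ∈ p.darts, (d.fst = a ∧ d.snd = b) ∨ (d.fst = b ∧ d.snd = a) := by
  obtain ⟨d, hd, he⟩ := List.mem_map.1 h
  exact ⟨d, hd, (dart_edge_eq_mk'_iff' (d := d)).1 he⟩

/-- A walk between vertices in the image of an embedding of graphs, all of whose vertices are in
this image, comes from a walk. -/
theorem exists_map_eq {W : Type*} {H : SimpleGraph W} (φ : H ↪g G) {a b : V} (p : G.Walk a b)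
    (hp : ∀ z ∈ p.support, z ∈ Set.range φ) :
    ∀ {u w : W} (ha : φ u = a) (hb : φ w = b),
      ∃ q : H.Walk u w, (q.map φ.toHom).copy ha hb = p := by
  induction p with
  | nil =>
    rintro u w rfl hb
    obtain rfl := φ.injective hb
    exact ⟨nil, rfl⟩
  | cons h p ih =>
    rintro u w rfl rfl
    obtain ⟨z, rfl⟩ := hp _ (List.mem_cons_of_mem _ p.start_mem_support)
    obtain ⟨q, hq⟩ := ih (fun y hy => hp y (List.mem_cons_of_mem _ hy)) rfl rfl
    refine ⟨cons (φ.map_adj_iff.1 h) q, ?_⟩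
    rw [← hq]
    rfl

end SimpleGraph.Walk

namespace HyperbolicTwoComplex

variable {V : Type*}

/-- A function on the link that is 1-Lipschitz bounds the length of walks from below. -/
theorem sub_le_linkLength (K : HyperbolicTwoComplex V) {k : ℝ} {v : V} {φ : V → ℝ}
    (hφ : ∀ a b, (K.link v).Adj a b → φ b - φ a ≤ K.angle k v a b) {a b : V}
    (p : (K.link v).Walk a b) : φ b - φ a ≤ K.linkLength k v p := by
  induction p with
  | nil => simp [linkLength]
  | cons h p ih =>
    have := hφ _ _ h
    simp only [linkLength, SimpleGraph.Walk.darts_cons, List.map_cons, List.sum_cons] at ih ⊢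
    linarith

theorem linkLength_cons (K : HyperbolicTwoComplex V) {k : ℝ} {v a b c : V}
    (h : (K.link v).Adj a b) (p : (K.link v).Walk b c) :
    K.linkLength k v (.cons h p) = K.angle k v a b + K.linkLength k v p := by
  simp [linkLength]

theorem linkLength_reverse (K : HyperbolicTwoComplex V) {k : ℝ} {v a b : V}
    (p : (K.link v).Walk a b) : K.linkLength k v p.reverse = K.linkLength k v p := by
  simp only [linkLength, SimpleGraph.Walk.darts_reverse, List.map_reverse, List.sum_reverse,
    List.map_map]
  congr 2
  funext d
  exact K.angle_comm _ _ _ _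

namespace GeodesicSystem

variable {K : HyperbolicTwoComplex V} {k : ℝ} {J : Type*} {S : K.GeodesicSystem k J}

open Classical in
variable (S) in
/-- The other endpoint of an edge at `v`; the direction of the new edge from `v` to the new vertex
`e` is collapsed to the direction of `e`. -/
def collapse (v : V) : V ⊕ S.Edge → V
  | .inl u => u
  | .inr e => if h : v ∈ e.1 then Sym2.Mem.other h else v

theorem collapse_inr {v u : V} {e : S.Edge} (hne : u ≠ v) (hu : u ∈ e.1) (hv : v ∈ e.1) :
    S.collapse v (.inr e) = u := by
  have h1 := Sym2.other_spec hv
  simp only [collapse, hv, dif_pos]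
  rw [← h1, Sym2.mem_iff] at hu
  exact (hu.resolve_left hne).symm

/-- The edges `e` and `e'` of a turn subtend an angle of at least `π` in `K`. Hence a cycle in a
link of the enlarged complex that runs through a single triangle of a turn has a remainder which is
longer than `π`, as passing to the enlarged complex lengthens the edges of this remainder. -/
theorem pi_le_of_turn {v : V} {e e' : S.Edge} (h : S.Turn e v e')
    (R : (K.link v).Walk (S.collapse v (.inr e')) (S.collapse v (.inr e))) :
    Real.pi ≤ K.linkLength k v R ∧ 1 ≤ R.length := by
  obtain ⟨j, rfl, h⟩ := h
  have hne := S.vertex_ne j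
  have c1 : ∀ e : S.Edge, e.1 = S.edge j →
      S.collapse (S.vertex (S.next j)) (.inr e) = S.vertex j := fun e he =>
    collapse_inr (S.adj _).1 (by rw [he]; exact Sym2.mem_mk_left _ _)
      (by rw [he]; exact Sym2.mem_mk_right _ _)
  have c2 : ∀ e : S.Edge, e.1 = S.edge (S.next j) →
      S.collapse (S.vertex (S.next j)) (.inr e) = S.vertex (S.next (S.next j)) := fun e he =>
    collapse_inr (S.adj _).1.symm (by rw [he]; exact Sym2.mem_mk_right _ _)
      (by rw [he]; exact Sym2.mem_mk_left _ _)
  have key : ∀ {b c} (R : (K.link (S.vertex (S.next j))).Walk b c),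
      (b = S.vertex j ∧ c = S.vertex (S.next (S.next j))) ∨
        (c = S.vertex j ∧ b = S.vertex (S.next (S.next j))) →
      Real.pi ≤ K.linkLength k _ R ∧ 1 ≤ R.length := by
    rintro b c R hbc
    constructor
    · rcases hbc with ⟨rfl, rfl⟩ | ⟨rfl, rfl⟩
      · exact S.pi_le j R
      · rw [← linkLength_reverse]
        exact S.pi_le j R.reverse
    · by_contra! h0
      have := SimpleGraph.Walk.eq_of_length_eq_zero (p := R) (by omega)
      rcases hbc with ⟨h1, h2⟩ | ⟨h1, h2⟩
      · exact hne (h1.symm.trans (this.trans h2))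
      · exact hne (h1.symm.trans (this.symm.trans h2))
  refine key R ?_
  rcases h with ⟨h1, h2⟩ | ⟨h1, h2⟩
  · exact Or.inr ⟨c1 _ h1, c2 _ h2⟩
  · exact Or.inl ⟨c1 _ h1, c2 _ h2⟩

variable [Finite J] (T : S.Thinness)

theorem angle_complex_inl_inr_inr (v : V) (e e' : S.Edge) :
    Real.pi - T.ε ≤ (S.complex T).angle k (.inl v) (.inr e) (.inr e') := T.le_turn e e'

/-- Collapsing a walk in a link of the enlarged complex that does not run through new triangles of
turns. Each of the other edges of the link is either collapsed to a point or shortened. -/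
theorem exists_collapse_walk {v : V} {η : ℝ} (hη : ∀ u w, K.IsTriangle u v w →
      K.angle k v u w + η ≤ hyperbolicAngle k (K.length s(v, u) / 2)
        (K.length s(v, w) / 2) (K.length s(u, w) / 2))
    {a b : V ⊕ S.Edge} (p : ((S.complex T).link (.inl v)).Walk a b)
    (hp : ∀ d ∈ p.darts, ¬ (d.fst.isRight ∧ d.snd.isRight)) :
    ∃ q : (K.link v).Walk (S.collapse v a) (S.collapse v b),
      K.linkLength k v q + η * q.length ≤ (S.complex T).linkLength k (.inl v) p := by
  induction p with
  | nil => exact ⟨.nil, by simp [linkLength]⟩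
  | @cons a b c h p ih =>
    obtain ⟨q, hq⟩ := ih fun d hd => hp d (by simp [hd])
    have h0 := (S.complex T).angle_nonneg k (.inl v) a b
    have hp' : ¬ (a.isRight ∧ b.isRight) := hp ⟨(a, b), h⟩ (by simp)
    rw [linkLength_cons]
    rcases a with u | e <;> rcases b with w | e'
    · have hT := isTriangle_inl_inl_inl h
      have hadj : (K.link v).Adj u w := hT
      obtain ⟨q, hq⟩ : ∃ q : (K.link v).Walk w (S.collapse v c), K.linkLength k v q +
        η * q.length ≤ (S.complex T).linkLength k (.inl v) p := ⟨q, hq⟩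
      have h1 : K.angle k v u w + η ≤ (S.complex T).angle k (.inl v) (.inl u) (.inl w) :=
        hη u w hT
      have key : K.linkLength k v (.cons hadj q) + η * (SimpleGraph.Walk.cons hadj q).length ≤
          (S.complex T).angle k (.inl v) (.inl u) (.inl w) +
            (S.complex T).linkLength k (.inl v) p := by
        rw [linkLength_cons, SimpleGraph.Walk.length_cons]
        push_cast
        linarith
      exact ⟨_, key⟩
    · obtain ⟨h1, h2, h3⟩ := isTriangle_inl_inl_inr h
      have hc : S.collapse v (.inl u) = S.collapse v (.inr e') := (collapse_inr h1 h2 h3).symm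
      rw [hc]
      exact ⟨q, by linarith⟩
    · obtain ⟨h1, h2, h3⟩ := isTriangle_inl_inl_inr (S.enlarge.isTriangle_rotate h)
      have hc : S.collapse v (.inr e) = S.collapse v (.inl w) := collapse_inr h1.symm h3 h2
      rw [hc]
      exact ⟨q, by linarith⟩
    · simp at hp'


theorem exists_turn_of_isRight {v : V} {d : ((S.complex T).link (.inl v)).Dart}
    (h : d.fst.isRight ∧ d.snd.isRight) :
    ∃ e e' : S.Edge, d.fst = .inr e ∧ d.snd = .inr e' ∧ S.Turn e v e' := by
  obtain ⟨⟨a, b⟩, hab⟩ := d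
  rcases a with u | e <;> rcases b with w | e' <;> simp at h
  exact ⟨e, e', rfl, rfl, isTriangle_inl_inr_inr (S.enlarge.isTriangle_swap
    (S.enlarge.isTriangle_rotate hab))⟩

variable (S) in
/-- The link of a vertex of `K` is a subgraph of its link in the enlarged complex. -/
def linkEmbedding (v : V) : K.link v ↪g (S.complex T).link (.inl v) where
  toFun := Sum.inl
  inj' := Sum.inl_injective
  map_rel_iff' := ⟨isTriangle_inl_inl_inl, isTriangle_inl_inl_inl_of⟩

theorem linkLength_le_map (hk : k < 0) {v u w : V} (q : (K.link v).Walk u w) :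
    K.linkLength k v q ≤
      (S.complex T).linkLength k (.inl v) (q.map (S.linkEmbedding T v).toHom) := by
  induction q with
  | nil => simp [linkLength]
  | cons h q ih =>
    rw [SimpleGraph.Walk.map_cons, linkLength_cons, linkLength_cons]
    exact add_le_add (angle_lt_half hk h).le ih

theorem mem_edges_inr {v : V} {a : V ⊕ S.Edge} {p : ((S.complex T).link (.inl v)).Walk a a}
    {e : S.Edge} {w : V} (h : s(Sum.inr e, Sum.inl w) ∈ p.edges) : e.1 = s(v, w) := by
  obtain ⟨h1, h2, h3⟩ := isTriangle_inl_inl_inr (S.enlarge.isTriangle_rotate (p.adj_of_mem_edges h))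
  exact (Sym2.mem_and_mem_iff h1).1 ⟨h2, h3⟩

/-- A cycle in the link of a vertex of `K` that does not run through new triangles of turns. -/
theorem two_pi_le_linkLength_of_not_isRight (hK : K.IsNegativelyCurved k) {v : V} {a : V ⊕ S.Edge}
    {p : ((S.complex T).link (.inl v)).Walk a a} (hp : p.IsCycle)
    (hθ : ∀ d ∈ p.darts, ¬ (d.fst.isRight ∧ d.snd.isRight)) :
    2 * Real.pi ≤ (S.complex T).linkLength k (.inl v) p := by
  have hsupp : ∀ z ∈ p.support, z ∈ Set.range (S.linkEmbedding T v) := by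
    rintro (u | e) h
    · exact ⟨u, rfl⟩
    · -- the new vertices are leaves of the link without the edges of turns
      obtain ⟨z, z', hne, hz, hz'⟩ := hp.exists_mem_edges h
      have key : ∀ z, s(Sum.inr e, z) ∈ p.edges → ∃ u, z = .inl u ∧ e.1 = s(v, u) := by
        rintro (u | e') h
        · exact ⟨u, rfl, mem_edges_inr T h⟩
        · obtain ⟨d, hd, h⟩ := SimpleGraph.Walk.exists_dart_of_mem_edges h
          refine absurd ?_ (hθ d hd)
          rcases h with ⟨h1, h2⟩ | ⟨h1, h2⟩ <;> simp [h1, h2]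
      obtain ⟨u, rfl, hu⟩ := key z hz
      obtain ⟨u', rfl, hu'⟩ := key z' hz'
      rw [hu, Sym2.congr_right] at hu'
      exact absurd (congrArg _ hu') hne
  obtain ⟨u, rfl⟩ := hsupp a p.start_mem_support
  obtain ⟨q, rfl⟩ := SimpleGraph.Walk.exists_map_eq (S.linkEmbedding T v) p hsupp rfl rfl
  have hq : q.IsCycle := (SimpleGraph.Walk.isCycle_map_iff_of_injective
    (S.linkEmbedding T v).injective).1 hp
  exact (hK.2 v u q hq).trans (linkLength_le_map T hK.1 q)

theorem linkLength_append (K : HyperbolicTwoComplex V) {k : ℝ} {v a b c : V}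
    (p : (K.link v).Walk a b) (q : (K.link v).Walk b c) :
    K.linkLength k v (p.append q) = K.linkLength k v p + K.linkLength k v q := by
  simp [linkLength]

theorem countP_mul_le_sum {α : Type*} {l : List α} {f : α → ℝ} {P Q : α → Bool} {s t : ℝ}
    (h0 : ∀ a ∈ l, 0 ≤ f a) (hP : ∀ a ∈ l, P a → s ≤ f a) (hQ : ∀ a ∈ l, Q a → t ≤ f a)
    (hPQ : ∀ a ∈ l, ¬ (P a ∧ Q a)) :
    s * l.countP P + t * l.countP Q ≤ (l.map f).sum := by
  induction l with
  | nil => simp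
  | cons a l ih =>
    have ih := ih (fun b hb => h0 b (by simp [hb])) (fun b hb => hP b (by simp [hb]))
      (fun b hb => hQ b (by simp [hb])) (fun b hb => hPQ b (by simp [hb]))
    have a0 := h0 a (by simp)
    have aP := hP a (by simp)
    have aQ := hQ a (by simp)
    have aPQ := hPQ a (by simp)
    rw [List.map_cons, List.sum_cons, List.countP_cons, List.countP_cons]
    by_cases h1 : P a <;> by_cases h2 : Q a
    · exact absurd ⟨h1, h2⟩ aPQ
    · have := aP h1
      simp only [h1, h2, if_true]
      push_cast
      simp
      linarith
    · have := aQ h2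
      simp only [h1, h2, if_true]
      push_cast
      simp
      linarith
    · simp only [h1, h2]
      simp
      linarith

/-- The link of the enlarged complex at a vertex of `K` satisfies the link condition. A cycle
through several triangles of turns, each of which contributes almost `π`, is long enough with the help of
one more edge: a third such triangle, or a triangle of `K`, whose angle is at least `η`. If there is
one such triangle only, then the remainder of the cycle is at least as long as a walk in the old
link between two edges of a turn, and longer by `η` at least. -/
theorem two_pi_le_linkLength_inl (hK : K.IsNegativelyCurved k) {v : V} {a : V ⊕ S.Edge}
    (p : ((S.complex T).link (.inl v)).Walk a a) (hp : p.IsCycle) :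
    2 * Real.pi ≤ (S.complex T).linkLength k (.inl v) p := by
  by_cases hθ : ∀ d ∈ p.darts, ¬ (d.fst.isRight ∧ d.snd.isRight)
  · exact two_pi_le_linkLength_of_not_isRight T hK hp hθ
  push Not at hθ
  obtain ⟨d, hd, hd'⟩ := hθ
  obtain ⟨e, e', he, he', ht⟩ := exists_turn_of_isRight T hd'
  obtain ⟨j, hj, -⟩ := id ht
  have hη : ∀ u w, K.IsTriangle u v w → K.angle k v u w + T.η ≤
      hyperbolicAngle k (K.length s(v, u) / 2) (K.length s(v, w) / 2) (K.length s(u, w) / 2) := by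
    subst hj
    exact T.angle_add_le j
  have hangle : ∀ d ∈ p.darts, (d.fst.isRight && d.snd.isRight) →
      Real.pi - T.ε ≤ (S.complex T).angle k (.inl v) d.fst d.snd := by
    intro d _ h
    obtain ⟨e, e', he, he', -⟩ := exists_turn_of_isRight T (by simpa using h)
    rw [he, he']
    exact angle_complex_inl_inr_inr T v e e'
  have hangle' : ∀ d ∈ p.darts, (d.fst.isLeft && d.snd.isLeft) →
      T.η ≤ (S.complex T).angle k (.inl v) d.fst d.snd := by
    rintro ⟨⟨u | e, w | e'⟩, h⟩ _ h' <;> simp at h'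
    have h1 := hη u w (isTriangle_inl_inl_inl h)
    have h2 := K.angle_nonneg k v u w
    exact (by linarith : T.η ≤ _).trans h1
  have hsum := countP_mul_le_sum (l := p.darts)
    (f := fun d => (S.complex T).angle k (.inl v) d.fst d.snd)
    (P := fun d => d.fst.isRight && d.snd.isRight)
    (Q := fun d => d.fst.isLeft && d.snd.isLeft)
    (fun d _ => (S.complex T).angle_nonneg _ _ _ _) hangle hangle'
    (by rintro ⟨⟨u | e, w | e'⟩, h⟩ _ <;> simp)
  change _ ≤ (S.complex T).linkLength k (.inl v) p at hsum
  set m := p.darts.countP fun d => d.fst.isRight && d.snd.isRight with hm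
  set n := p.darts.countP fun d => d.fst.isLeft && d.snd.isLeft with hn
  have hε1 := T.ε_le_one
  have hε2 := T.two_mul_ε_le
  have hη0 := T.η_pos
  have hpi := Real.pi_gt_three
  -- an old vertex is joined to at most one new one in the link, so a cycle through an old vertex
  -- runs along an old edge
  have hmn : 3 ≤ m ∨ 1 ≤ n := by
    by_cases h : ∃ u, Sum.inl u ∈ p.support
    · obtain ⟨u, hu⟩ := h
      right
      obtain ⟨z, z', hne, hz, hz'⟩ := hp.exists_mem_edges hu
      have key : ∀ w, s(Sum.inl u, Sum.inl w) ∈ p.edges → 1 ≤ n := by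
        intro w hw
        obtain ⟨d, hd, h⟩ := SimpleGraph.Walk.exists_dart_of_mem_edges hw
        refine List.countP_pos_iff.2 ⟨d, hd, ?_⟩
        rcases h with ⟨h1, h2⟩ | ⟨h1, h2⟩ <;> simp [h1, h2]
      rcases z with w | f
      · exact key w hz
      rcases z' with w | f'
      · exact key w hz'
      rw [Sym2.eq_swap] at hz hz'
      exact absurd
        (congrArg _ (Subtype.ext ((mem_edges_inr T hz).trans (mem_edges_inr T hz').symm)))
        hne
    · left
      push Not at h
      have : m = p.darts.length := List.countP_eq_length.2 fun d hd => by
        have h1 := p.dart_fst_mem_support_of_mem_darts hd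
        have h2 := p.dart_snd_mem_support_of_mem_darts hd
        obtain ⟨⟨u | e, w | e'⟩, h'⟩ := d
        exacts [absurd h1 (h _), absurd h1 (h _), absurd h2 (h _), rfl]
      rw [this, SimpleGraph.Walk.length_darts]
      exact hp.three_le_length
  have hmul : ∀ {i l : ℕ}, i ≤ m → l ≤ n → (Real.pi - T.ε) * i + T.η * l ≤
      (S.complex T).linkLength k (.inl v) p := by
    intro i l hi hl
    have h1 : (i : ℝ) ≤ m := by exact_mod_cast hi
    have h2 : (l : ℝ) ≤ n := by exact_mod_cast hl
    have h3 := mul_le_mul_of_nonneg_left h1 (by linarith : 0 ≤ Real.pi - T.ε)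
    have h4 := mul_le_mul_of_nonneg_left h2 hη0.le
    linarith
  by_cases h3 : 3 ≤ m
  · have := hmul h3 (Nat.zero_le n)
    push_cast at this
    linarith
  have hn1 := hmn.resolve_left h3
  by_cases h2 : 2 ≤ m
  · have := hmul h2 hn1
    push_cast at this
    linarith
  obtain ⟨q, q', hq⟩ := SimpleGraph.Walk.exists_darts_eq_append hd
  have hcount : (q.darts.countP fun d => d.fst.isRight && d.snd.isRight) = 0 ∧
      (q'.darts.countP fun d => d.fst.isRight && d.snd.isRight) = 0 := by
    rw [hq, List.countP_append, List.countP_cons_of_pos (by simpa using hd')] at hm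
    omega
  simp only [List.countP_eq_zero, Bool.and_eq_true] at hcount
  have hlen : (S.complex T).linkLength k (.inl v) p = (S.complex T).linkLength k (.inl v) q +
      ((S.complex T).angle k (.inl v) d.fst d.snd + (S.complex T).linkLength k (.inl v) q') := by
    simp only [linkLength, hq, List.map_append, List.map_cons, List.sum_append, List.sum_cons]
  have hda := hangle d hd (by simpa using hd')
  obtain ⟨Q, hQ⟩ := exists_collapse_walk T hη q hcount.1
  obtain ⟨Q', hQ'⟩ := exists_collapse_walk T hη q' hcount.2
  have key : ∀ {b c} (Q : (K.link v).Walk (S.collapse v a) (S.collapse v b))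
      (Q' : (K.link v).Walk (S.collapse v c) (S.collapse v a)), b = .inr e → c = .inr e' →
      Real.pi + T.η ≤ K.linkLength k v Q + T.η * Q.length +
        (K.linkLength k v Q' + T.η * Q'.length) := by
    rintro _ _ Q Q' rfl rfl
    obtain ⟨h1, h2⟩ := pi_le_of_turn ht (Q'.append Q)
    rw [linkLength_append] at h1
    rw [SimpleGraph.Walk.length_append] at h2
    have h3 : (1 : ℝ) ≤ Q'.length + Q.length := by exact_mod_cast h2
    have h4 := mul_le_mul_of_nonneg_left h3 hη0.le
    linarith
  have := key Q Q' he he'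
  linarith

/-- The link of a new vertex is a tree. -/
theorem not_isCycle_inr {e : S.Edge} {a : V ⊕ S.Edge}
    (p : ((S.complex T).link (.inr e)).Walk a a) : ¬ p.IsCycle := by
  intro hp
  have hadj : ∀ {a b}, s(a, b) ∈ p.edges → S.enlarge.IsTriangle a (.inr e) b :=
    fun h => p.adj_of_mem_edges h
  -- the new vertices are leaves of the link
  have h1 : ∀ e', Sum.inr e' ∉ p.support := by
    intro e' h
    obtain ⟨z, z', hne, hz, hz'⟩ := hp.exists_mem_edges h
    have key : ∀ z, s(Sum.inr e', z) ∈ p.edges → ∃ v, z = .inl v ∧ S.Turn e v e' := by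
      rintro (v | e'') h
      · exact ⟨v, rfl, (isTriangle_inl_inr_inr (S.enlarge.isTriangle_rotate
          (S.enlarge.isTriangle_rotate (hadj h)))).symm⟩
      · exact absurd (hadj h) not_isTriangle_inr_inr_inr
    obtain ⟨v, rfl, hv⟩ := key z hz
    obtain ⟨v', rfl, hv'⟩ := key z' hz'
    exact hne (congrArg _ (hv'.eq_of_mem hv.mem hv.mem'))
  have h2 : ∀ v, Sum.inl v ∉ p.support := by
    intro v h
    obtain ⟨z, z', hne, hz, hz'⟩ := hp.exists_mem_edges h
    have key : ∀ z, s(Sum.inl v, z) ∈ p.edges → ∃ u, z = .inl u ∧ e.1 = s(v, u) := by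
      rintro (u | e'') h
      · obtain ⟨h3, h4, h5⟩ := isTriangle_inl_inl_inr (S.enlarge.isTriangle_rotate
          (S.enlarge.isTriangle_rotate (hadj h)))
        exact ⟨u, rfl, (Sym2.mem_and_mem_iff h3.symm).1 ⟨h5, h4⟩⟩
      · exact absurd (p.snd_mem_support_of_mem_edges h) (h1 _)
    obtain ⟨u, rfl, hu⟩ := key z hz
    obtain ⟨u', rfl, hu'⟩ := key z' hz'
    rw [hu, Sym2.congr_right] at hu'
    exact hne (congrArg _ hu')
  rcases a with v | e'
  · exact h2 v p.start_mem_support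
  · exact h1 e' p.start_mem_support

theorem isNegativelyCurved_complex (hK : K.IsNegativelyCurved k) :
    (S.complex T).IsNegativelyCurved k := by
  refine ⟨hK.1, ?_⟩
  rintro (v | e) a p hp
  · exact two_pi_le_linkLength_inl T hK p hp
  · exact absurd hp (not_isCycle_inr T p)

/-- The new edges form closed geodesics again: at the new vertex `e` they subtend the angle of the
triangle with base `e` together with the angles of two triangles of turns. -/
def lift : (S.complex T).GeodesicSystem k J where
  next := S.next
  vertex j := .inr ⟨S.edge j, j, rfl⟩
  adj j := by
    have h : S.Turn ⟨S.edge j, j, rfl⟩ (S.vertex (S.next j)) ⟨S.edge (S.next j), _, rfl⟩ :=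
      ⟨j, rfl, Or.inl ⟨rfl, rfl⟩⟩
    exact enlarge_adj_iff.2 ⟨fun h' => h.ne (Sum.inr_injective h'), _, .turn _ _ _ h, by simp⟩
  pi_le j W := by
    classical
    obtain ⟨e, he⟩ : ∃ e : S.Edge, e = ⟨S.edge (S.next j), _, rfl⟩ := ⟨_, rfl⟩
    obtain ⟨e₁, he₁⟩ : ∃ e : S.Edge, e = ⟨S.edge j, _, rfl⟩ := ⟨_, rfl⟩
    obtain ⟨e₂, he₂⟩ : ∃ e : S.Edge, e = ⟨S.edge (S.next (S.next j)), _, rfl⟩ := ⟨_, rfl⟩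
    obtain ⟨v, hv⟩ : ∃ v, v = S.vertex (S.next j) := ⟨_, rfl⟩
    obtain ⟨u, hu⟩ : ∃ u, u = S.vertex (S.next (S.next j)) := ⟨_, rfl⟩
    have t₁ : S.Turn e₁ v e := ⟨j, hv, Or.inl ⟨by rw [he₁], by rw [he]⟩⟩
    have t₂ : S.Turn e u e₂ := ⟨S.next j, hu, Or.inl ⟨by rw [he], by rw [he₂]⟩⟩
    have hvu : v ≠ u := by
      rw [hv, hu]
      exact (S.adj _).1
    have hv₂ : v ∉ e₂.1 := fun h => hvu (t₂.eq_of_mem t₁.mem' h)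
    -- unfold the link of `e`, which is a tree, onto the real line, with `v` at the origin
    let μ := hyperbolicAngle k (K.length e.1 / 4 + T.τ) (K.length e.1 / 4 + T.τ)
      (2 * (K.length e.1 / 4))
    let α : S.Edge → ℝ := fun e' => hyperbolicAngle k (K.length e.1 / 4 + T.τ)
      (K.length e.1 / 4 + K.length e'.1 / 4 - T.ρ) (K.length e'.1 / 4 + T.τ)
    let φ : V ⊕ S.Edge → ℝ := fun
      | .inl w => if w = v then 0 else μ
      | .inr e' => if v ∈ e'.1 then -α e' else μ + α e'
    have hφ : ∀ a b, ((S.complex T).link (.inr e)).Adj a b →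
        φ b - φ a ≤ (S.complex T).angle k (.inr e) a b := by
      have hα : ∀ e', 0 ≤ α e' := fun e' => hyperbolicAngle_nonneg ..
      have hμ : 0 ≤ μ := hyperbolicAngle_nonneg ..
      have key : ∀ {w e'}, S.Turn e w e' → |φ (.inr e') - φ (.inl w)| ≤ α e' := by
        intro w e' h
        by_cases hw : w = v
        · have h1 : φ (.inl w) = 0 := if_pos hw
          have h2 : φ (.inr e') = -α e' := if_pos (hw ▸ h.mem')
          rw [h1, h2, sub_zero, abs_neg, abs_of_nonneg (hα e')]
        · have h1 : φ (.inl w) = μ := if_neg hw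
          have h2 : φ (.inr e') = μ + α e' := if_neg fun h' => hw (h.eq_of_mem t₁.mem' h').symm
          rw [h1, h2, add_sub_cancel_left, abs_of_nonneg (hα e')]
      rintro (w | e') (w' | e'') h
      · obtain ⟨h1, h2, h3⟩ := isTriangle_inl_inl_inr (S.enlarge.isTriangle_rotate
          (S.enlarge.isTriangle_rotate h))
        have h4 : (S.complex T).angle k (.inr e) (.inl w) (.inl w') = μ := by
          change hyperbolicAngle k (K.length e.1 / 4 + T.τ) (K.length e.1 / 4 + T.τ)
            (K.length s(w, w') / 2) = μ
          rw [← (Sym2.mem_and_mem_iff h1.symm).1 ⟨h3, h2⟩]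
          congr 1
          ring
        rw [h4]
        simp only [φ]
        split_ifs <;> linarith
      · exact (le_abs_self _).trans (key (isTriangle_inl_inr_inr h))
      · rw [angle_comm]
        have := key (isTriangle_inl_inr_inr (S.enlarge.isTriangle_rotate
          (S.enlarge.isTriangle_rotate h))).symm
        rw [abs_sub_comm] at this
        exact (le_abs_self _).trans this
      · exact absurd h not_isTriangle_inr_inr_inr
    suffices main : ∀ W : ((S.complex T).link (.inr e)).Walk (.inr e₁) (.inr e₂),
        Real.pi ≤ (S.complex T).linkLength k (.inr e) W by
      subst he he₁ he₂
      exact main W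
    intro W
    have h1 := sub_le_linkLength (S.complex T) hφ W
    have h2 : φ (.inr e₁) = -α e₁ := if_pos t₁.mem
    have h3 : φ (.inr e₂) = μ + α e₂ := if_neg hv₂
    rw [h2, h3] at h1
    have h4 : (Real.pi - μ) / 2 ≤ α e₁ := T.defect_le e e₁
    have h5 : (Real.pi - μ) / 2 ≤ α e₂ := T.defect_le e e₂
    linarith

end GeodesicSystem
end HyperbolicTwoComplex

/-! ### The deformation retraction of the enlarged complex -/

namespace AbstractSimplicialComplex

variable {V : Type*} {K : AbstractSimplicialComplex V}

theorem Realization.sum_eq_one (t : K.Realization) {s : Finset V}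
    (hs : ∀ v, v ∉ s → t.coord v = 0) :
    ∑ v ∈ s, t.coord v = 1 := by
  classical
  obtain ⟨s', -, h0, h1, -⟩ := K.exists_face_pos t
  rw [← h1, Finset.sum_subset (Finset.subset_union_left (s₂ := s')) fun v _ h => hs v h,
    Finset.sum_subset (Finset.subset_union_right (s₁ := s)) fun v _ h => h0 v h]

/-- Two maps to a simplicial complex are homotopic if their values at each point lie in a common
simplex; the homotopy is constant where they agree. -/
theorem homotopicRel_of_common_face {X : Type*} [TopologicalSpace X] {f g : C(X, K.Realization)}
    (h : ∀ x, ∃ s ∈ K.faces, ∀ v, v ∉ s → (f x).coord v = 0 ∧ (g x).coord v = 0) {A : Set X}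
    (hA : ∀ x ∈ A, f x = g x) : f.HomotopicRel g A := by
  refine ⟨{
    toFun := fun q => Realization.mk K
      (fun v => (1 - (q.1 : ℝ)) * (f q.2).coord v + q.1 * (g q.2).coord v)
      (fun v => add_nonneg (mul_nonneg (sub_nonneg.2 q.1.2.2) ((f q.2).coord_nonneg v))
        (mul_nonneg q.1.2.1 ((g q.2).coord_nonneg v))) ?_
    continuous_toFun := continuous_realization fun v => ?_
    map_zero_left := fun x => Realization.ext fun v => by simp
    map_one_left := fun x => Realization.ext fun v => by simp
    prop' := fun t x hx => Realization.ext fun v => ?_ }⟩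
  · obtain ⟨s, hs, h0⟩ := h q.2
    refine ⟨s, hs, fun v hv => by simp [h0 v hv], ?_⟩
    rw [Finset.sum_add_distrib, ← Finset.mul_sum, ← Finset.mul_sum,
      (f q.2).sum_eq_one fun v hv => (h0 v hv).1, (g q.2).sum_eq_one fun v hv => (h0 v hv).2]
    ring
  · have h1 : Continuous fun q : I × X => (f q.2).coord v :=
      (K.continuous_coord v).comp (f.continuous.comp continuous_snd)
    have h2 : Continuous fun q : I × X => (g q.2).coord v :=
      (K.continuous_coord v).comp (g.continuous.comp continuous_snd)
    simp only [Realization.coord_mk]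
    fun_prop
  · change (1 - (t : ℝ)) * (f x).coord v + t * (g x).coord v = (f x).coord v
    rw [← hA x hx]
    ring

theorem coord_inclusionMap {W : Type*} {L : AbstractSimplicialComplex W} {i : V ↪ W}
    (hi : IsInclusion K L i) (t : K.Realization) (w : W) :
    (inclusionMap hi t).coord w = Function.extend i t.coord 0 w := rfl

end AbstractSimplicialComplex

namespace HyperbolicTwoComplex.GeodesicSystem

open AbstractSimplicialComplex

variable {V : Type*} {K : HyperbolicTwoComplex V} {k : ℝ} {J : Type*} {S : K.GeodesicSystem k J}

theorem exists_edge_eq (e : S.Edge) : ∃ p q, K.Adj p q ∧ e.1 = s(p, q) := by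
  obtain ⟨_, j, rfl⟩ := e
  exact ⟨_, _, S.adj j, rfl⟩

theorem IsCell.exists_face {C : Set (V ⊕ S.Edge)} (hC : S.IsCell C) :
    ∃ s ∈ S.enlarge.faces, (s : Set (V ⊕ S.Edge)) = C := by
  classical
  suffices h : C.Nonempty ∧ C.Finite by
    lift C to Finset (V ⊕ S.Edge) using h.2
    exact ⟨C, ⟨by simpa using h.1, _, hC, subset_rfl⟩, rfl⟩
  cases hC with
  | base s hs => exact ⟨((K.isRelLowerSet_faces hs).1).to_set.image _, s.finite_toSet.image _⟩
  | tent e =>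
    refine ⟨⟨.inr e, by simp⟩, (Set.finite_singleton _).union (Set.Finite.image _ ?_)⟩
    obtain ⟨p, q, -, h⟩ := exists_edge_eq e
    refine (Set.toFinite {p, q}).subset fun v hv => ?_
    rw [h] at hv
    simpa using hv
  | turn e v e' h => exact ⟨⟨.inr e, by simp⟩, by simp⟩

theorem exists_cell (t : S.enlarge.Realization) : ∃ C, S.IsCell C ∧ ∀ a, a ∉ C → t.coord a = 0 := by
  obtain ⟨s, ⟨-, C, hC, hs⟩, h0, -⟩ := S.enlarge.exists_face_pos t
  exact ⟨C, hC, fun a ha => h0 a fun h => ha (hs h)⟩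

open Classical in
/-- The smaller one of the coordinates of two different new vertices. -/
def overlap (t : V ⊕ S.Edge → ℝ) (e e' : S.Edge) : ℝ :=
  if e = e' then 0 else min (t (.inr e)) (t (.inr e'))

open Classical in
theorem overlap_of_turn {t : V ⊕ S.Edge → ℝ} {e e' : S.Edge} {v : V} (h : S.Turn e v e')
    (h0 : ∀ a, 0 ≤ t a) (ht : ∀ f, f ≠ e → f ≠ e' → t (.inr f) = 0) (f f' : S.Edge) :
    overlap t f f' =
    (if f = e then if f' = e' then min (t (.inr e)) (t (.inr e')) else 0 else 0) +
      (if f = e' then if f' = e then min (t (.inr e)) (t (.inr e')) else 0 else 0) := by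
  have hne := h.ne
  unfold overlap
  by_cases hf : f = f'
  · subst hf
    rw [if_pos rfl]
    split_ifs <;> simp_all
  rw [if_neg hf]
  by_cases h1 : f = e
  · subst h1
    rw [if_pos rfl, if_neg hne, add_zero]
    split_ifs with h2
    · rw [h2]
    · rw [ht f' (Ne.symm hf) h2, min_eq_right (h0 _)]
  · rw [if_neg h1, zero_add]
    by_cases h2 : f = e'
    · subst h2
      rw [if_pos rfl]
      split_ifs with h3
      · rw [h3, min_comm]
      · rw [ht f' h3 (Ne.symm hf), min_eq_right (h0 _)]
    · rw [if_neg h2, ht f h1 h2, min_eq_left (h0 _)]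

variable (S) in
theorem isInclusion_inl : IsInclusion K.toAbstractSimplicialComplex S.enlarge .inl :=
  fun s hs => ⟨by simpa using (K.isRelLowerSet_faces hs).1, _, .base s hs, by simp⟩

variable [Finite J]

instance : Fintype S.Edge := Fintype.ofFinite _

open Classical in
/-- The retraction onto the complex without the triangles of turns: a point of such a triangle is
moved away from its side opposite to the vertex in `K`. -/
def shrink (t : V ⊕ S.Edge → ℝ) : V ⊕ S.Edge → ℝ
  | .inl x => t (.inl x) + ∑ e : S.Edge, ∑ e' : S.Edge,
      if x ∈ e.1 ∧ x ∈ e'.1 then overlap t e e' else 0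
  | .inr e => t (.inr e) - ∑ e' : S.Edge, overlap t e e'

open Classical in
/-- The projection that moves the new vertices to the midpoints of their edges. -/
def push (t : V ⊕ S.Edge → ℝ) (x : V) : ℝ :=
  t (.inl x) + (∑ e : S.Edge, if x ∈ e.1 then t (.inr e) else 0) / 2

theorem shrink_eq_self {t : V ⊕ S.Edge → ℝ} (h0 : ∀ a, 0 ≤ t a)
    (h : ∀ e e', e ≠ e' → t (.inr e) = 0 ∨ t (.inr e') = 0) : shrink t = t := by
  have ho : ∀ e e', overlap t e e' = 0 := fun e e' => by
    unfold overlap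
    split_ifs with he
    · rfl
    · rcases h e e' he with h | h <;> rw [h]
      · exact min_eq_left (h0 _)
      · exact min_eq_right (h0 _)
  funext a
  rcases a with x | e <;> simp [shrink, ho]

open Classical in
theorem shrink_inl_of_turn {t : V ⊕ S.Edge → ℝ} {e e' : S.Edge} {v : V} (h : S.Turn e v e')
    (h0 : ∀ a, 0 ≤ t a) (ht : ∀ f, f ≠ e → f ≠ e' → t (.inr f) = 0) (x : V) : shrink t (.inl x) =
    t (.inl x) + if x = v then 2 * min (t (.inr e)) (t (.inr e')) else 0 := by
  have key : ∀ f f' : S.Edge, (if x ∈ f.1 ∧ x ∈ f'.1 then overlap t f f' else 0) =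
      (if f = e then if f' = e' then if x = v then min (t (.inr e)) (t (.inr e')) else 0 else 0
        else 0) +
      (if f = e' then if f' = e then if x = v then min (t (.inr e)) (t (.inr e')) else 0 else 0
        else 0) := by
    intro f f'
    rw [overlap_of_turn h h0 ht]
    have hx : (x ∈ e.1 ∧ x ∈ e'.1) ↔ x = v :=
      ⟨fun h' => h.eq_of_mem h'.1 h'.2, by rintro rfl; exact ⟨h.mem, h.mem'⟩⟩
    have hne := h.ne
    by_cases h1 : f = e
    · subst h1
      by_cases h2 : f' = e'
      · subst h2
        simp [hx, hne]
      · simp [h2, hne]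
    · by_cases h3 : f = e'
      · subst h3
        by_cases h2 : f' = e
        · subst h2
          simp [and_comm.trans hx, hne.symm]
        · simp [h2, h1]
      · simp [h1, h3]
  simp only [shrink, key, Finset.sum_add_distrib, Finset.sum_ite_eq', Finset.mem_univ, if_true,
    Finset.sum_ite_irrel, Finset.sum_const_zero]
  split_ifs <;> ring

theorem shrink_inr_of_turn {t : V ⊕ S.Edge → ℝ} {e e' : S.Edge} {v : V} (h : S.Turn e v e')
    (h0 : ∀ a, 0 ≤ t a) (ht : ∀ f, f ≠ e → f ≠ e' → t (.inr f) = 0) :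
    shrink t (.inr e) = t (.inr e) - min (t (.inr e)) (t (.inr e')) := by
  classical
  simp [shrink, overlap_of_turn h h0 ht, h.ne]

theorem shrink_inr_of_turn_of_ne {t : V ⊕ S.Edge → ℝ} {e e' : S.Edge} {v : V} (h : S.Turn e v e')
    (h0 : ∀ a, 0 ≤ t a) (ht : ∀ f, f ≠ e → f ≠ e' → t (.inr f) = 0) {f : S.Edge} (h1 : f ≠ e)
    (h2 : f ≠ e') :
    shrink t (.inr f) = 0 := by
  classical
  simp [shrink, overlap_of_turn h h0 ht, h1, h2, ht]

theorem shrink_spec (t : S.enlarge.Realization) : (∀ a, 0 ≤ shrink t.coord a) ∧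
    (∀ e e', e ≠ e' → shrink t.coord (.inr e) = 0 ∨ shrink t.coord (.inr e') = 0) ∧
    ∃ s ∈ S.enlarge.faces, (∀ a, a ∉ s → t.coord a = 0 ∧ shrink t.coord a = 0) ∧
      ∑ a ∈ s, shrink t.coord a = 1 := by
  classical
  obtain ⟨C, hC, h0⟩ := exists_cell t
  obtain ⟨s, hs, rfl⟩ := hC.exists_face
  simp only [Finset.mem_coe] at h0
  have easy : (∀ e e', e ≠ e' → t.coord (.inr e) = 0 ∨ t.coord (.inr e') = 0) →
      (∀ a, 0 ≤ shrink t.coord a) ∧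
      (∀ e e', e ≠ e' → shrink t.coord (.inr e) = 0 ∨ shrink t.coord (.inr e') = 0) ∧
      ∃ s ∈ S.enlarge.faces, (∀ a, a ∉ s → t.coord a = 0 ∧ shrink t.coord a = 0) ∧
        ∑ a ∈ s, shrink t.coord a = 1 := fun h => by
    rw [shrink_eq_self t.coord_nonneg h]
    exact ⟨t.coord_nonneg, h, s, hs, fun a ha => ⟨h0 a ha, h0 a ha⟩, t.sum_eq_one h0⟩
  have hC' := hC
  generalize hCs : (s : Set (V ⊕ S.Edge)) = C at hC'
  have hmem : ∀ a, a ∈ s ↔ a ∈ C := fun a => by rw [← hCs, Finset.mem_coe]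
  simp only [hmem] at h0
  cases hC' with
  | base s' hs' => exact easy fun e e' _ => Or.inl (h0 _ (by simp))
  | tent f =>
    refine easy fun e e' hne => ?_
    by_cases h : e = f
    · exact Or.inr (h0 _ (by simpa [← h] using hne.symm))
    · exact Or.inl (h0 _ (by simpa using h))
  | turn e v e' h =>
    have ht : ∀ f, f ≠ e → f ≠ e' → t.coord (.inr f) = 0 := fun f h1 h2 => h0 _ (by simp [h1, h2])
    have ht' : ∀ f, f ≠ e' → f ≠ e → t.coord (.inr f) = 0 := fun f h1 h2 => ht f h2 h1
    have e1 := shrink_inl_of_turn h t.coord_nonneg ht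
    have e2 := shrink_inr_of_turn h t.coord_nonneg ht
    have e3 := shrink_inr_of_turn h.symm t.coord_nonneg ht'
    have e4 := fun f => shrink_inr_of_turn_of_ne h t.coord_nonneg ht (f := f)
    have p1 := t.coord_nonneg (.inr e)
    have p2 := t.coord_nonneg (.inr e')
    have m1 := min_le_left (t.coord (.inr e)) (t.coord (.inr e'))
    have m2 := min_le_right (t.coord (.inr e)) (t.coord (.inr e'))
    have m0 := le_min p1 p2
    rw [min_comm] at e3
    have hout : ∀ a, a ∉ s → t.coord a = 0 ∧ shrink t.coord a = 0 := by
      intro a ha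
      rw [hmem] at ha
      refine ⟨h0 a ha, ?_⟩
      rcases a with x | f
      · have hx : x ≠ v := by simpa using ha
        rw [e1, if_neg hx, add_zero]
        exact h0 _ ha
      · simp only [Set.mem_insert_iff, Set.mem_singleton_iff, Sum.inr.injEq, reduceCtorEq,
          false_or, not_or] at ha
        exact e4 f ha.1 ha.2
    refine ⟨?_, ?_, s, hs, hout, ?_⟩
    · rintro (x | f)
      · rw [e1]
        have := t.coord_nonneg (.inl x)
        split_ifs <;> linarith
      · by_cases h1 : f = e
        · rw [h1, e2]; linarith
        · by_cases h2 : f = e'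
          · rw [h2, e3]; linarith
          · rw [e4 f h1 h2]
    · have hor : shrink t.coord (.inr e) = 0 ∨ shrink t.coord (.inr e') = 0 := by
        rw [e2, e3]
        rcases min_choice (t.coord (.inr e)) (t.coord (.inr e')) with hm | hm <;> rw [hm] <;> simp
      intro f f' hff
      by_cases h1 : f = e
      · by_cases h2 : f' = e'
        · rw [h1, h2]; exact hor
        · exact Or.inr (e4 f' (fun h => hff (h1.trans h.symm)) h2)
      · by_cases h2 : f = e'
        · by_cases h3 : f' = e
          · rw [h2, h3]; exact hor.symm
          · exact Or.inr (e4 f' h3 (fun h => hff (h2.trans h.symm)))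
        · exact Or.inl (e4 f h1 h2)
    · have hs' : s = {.inr e, .inl v, .inr e'} := by
        ext a
        rw [hmem]
        simp
      have hsum := t.sum_eq_one (s := s) fun a ha => (hout a ha).1
      rw [hs'] at hsum ⊢
      rw [Finset.sum_insert (by simp [h.ne]), Finset.sum_pair (by simp)] at hsum ⊢
      rw [e1, e2, e3, if_pos rfl]
      linarith

theorem push_nonneg {t : V ⊕ S.Edge → ℝ} (h : ∀ a, 0 ≤ t a) (x : V) : 0 ≤ push t x := by
  refine add_nonneg (h _) (div_nonneg (Finset.sum_nonneg fun e _ => ?_) two_pos.le)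
  split_ifs
  exacts [h _, le_rfl]

theorem push_spec (t : S.enlarge.Realization)
    (ht : ∀ e e', e ≠ e' → t.coord (.inr e) = 0 ∨ t.coord (.inr e') = 0) :
    (∃ s ∈ K.faces, (∀ x, x ∉ s → push t.coord x = 0) ∧ ∑ x ∈ s, push t.coord x = 1) ∧
      ∃ s ∈ S.enlarge.faces, (∀ a, a ∉ s → t.coord a = 0) ∧
        ∀ x, .inl x ∉ s → push t.coord x = 0 := by
  classical
  have hB : ∀ e, (∀ e', e' ≠ e → t.coord (.inr e') = 0) → (∀ v, v ∉ e.1 → t.coord (.inl v) = 0) →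
      (∃ s ∈ K.faces, (∀ x, x ∉ s → push t.coord x = 0) ∧ ∑ x ∈ s, push t.coord x = 1) ∧
      ∃ s ∈ S.enlarge.faces, (∀ a, a ∉ s → t.coord a = 0) ∧
        ∀ x, .inl x ∉ s → push t.coord x = 0 := by
    intro e h1 h2
    have hp : ∀ x, push t.coord x = t.coord (.inl x) +
        (if x ∈ e.1 then t.coord (.inr e) else 0) / 2 := fun x => by
      unfold push
      rw [Finset.sum_eq_single e (fun e' _ h => by rw [h1 e' h, ite_self]) (by simp)]
    obtain ⟨p, q, ⟨hpq, s, hs, hps, hqs⟩, he⟩ := exists_edge_eq e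
    have hs' : ({p, q} : Finset V) ∈ K.faces := (K.isRelLowerSet_faces hs).2
      (by simp [Finset.insert_subset_iff, *]) (by simp)
    have hmem : ∀ x, x ∈ e.1 ↔ x = p ∨ x = q := fun x => by rw [he, Sym2.mem_iff]
    have hout : ∀ a, a ∉ ({.inr e, .inl p, .inl q} : Finset (V ⊕ S.Edge)) → t.coord a = 0 := by
      rintro (x | f) h
      · exact h2 x (by simpa [hmem] using h)
      · exact h1 f (by simpa using h)
    have hsum := t.sum_eq_one hout
    rw [Finset.sum_insert (by simp), Finset.sum_pair (by simpa using hpq)] at hsum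
    have hzero : ∀ x, ¬ (x = p ∨ x = q) → push t.coord x = 0 := fun x h => by
      rw [hp, if_neg (by rwa [hmem]), h2 x (by rwa [hmem])]
      simp
    refine ⟨⟨_, hs', fun x hx => hzero x (by simpa using hx), ?_⟩, {.inr e, .inl p, .inl q},
      ⟨by simp, _, .tent e, ?_⟩, hout, fun x hx => hzero x (by simpa using hx)⟩
    · rw [Finset.sum_pair hpq, hp, hp, if_pos ((hmem _).2 (Or.inl rfl)),
        if_pos ((hmem _).2 (Or.inr rfl))]
      linarith
    · intro a ha
      simp only [Finset.coe_insert, Finset.coe_singleton, Set.mem_insert_iff,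
        Set.mem_singleton_iff] at ha
      rcases ha with rfl | rfl | rfl <;> simp [hmem]
  obtain ⟨C, hC, h0⟩ := exists_cell t
  cases hC with
  | base s hs =>
    have h1 : ∀ e, t.coord (.inr e) = 0 := fun e => h0 _ (by simp)
    have hp : ∀ x, push t.coord x = t.coord (.inl x) := fun x => by simp [push, h1]
    obtain ⟨s', hs', hss⟩ := (IsCell.base (S := S) s hs).exists_face
    have hs's : s' = s.map ⟨Sum.inl, Sum.inl_injective⟩ := by
      ext a
      rw [← Finset.mem_coe, hss]
      simp
    have hsum := t.sum_eq_one (s := s') fun a ha => h0 a (by rwa [← hss, Finset.mem_coe])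
    refine ⟨⟨s, hs, fun x hx => ?_, ?_⟩, s', hs', fun a ha => ?_, fun x hx => ?_⟩
    · rw [hp]
      exact h0 _ (by simpa using hx)
    · rw [hs's, Finset.sum_map] at hsum
      simpa [hp] using hsum
    · exact h0 a (by rwa [← hss, Finset.mem_coe])
    · rw [hp]
      exact h0 _ (by rwa [← hss, Finset.mem_coe])
  | tent e =>
    refine hB e (fun e' h => h0 _ (by simpa using h)) fun v hv => h0 _ (by simpa using hv)
  | turn e v e' h =>
    rcases ht e e' h.ne with h1 | h1
    · refine hB e' (fun f hf => ?_) fun x hx => h0 _ ?_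
      · by_cases hfe : f = e
        · rw [hfe, h1]
        · exact h0 _ (by simp [hf, hfe])
      · have : x ≠ v := fun hxv => hx (hxv ▸ h.mem')
        simpa using this
    · refine hB e (fun f hf => ?_) fun x hx => h0 _ ?_
      · by_cases hfe : f = e'
        · rw [hfe, h1]
        · exact h0 _ (by simp [hf, hfe])
      · have : x ≠ v := fun hxv => hx (hxv ▸ h.mem)
        simpa using this

theorem continuous_shrink (a : V ⊕ S.Edge) :
    Continuous fun t : S.enlarge.Realization => shrink t.coord a := by
  classical
  have hc := S.enlarge.continuous_coord
  have ho : ∀ e e', Continuous fun t : S.enlarge.Realization => overlap t.coord e e' := by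
    intro e e'
    unfold overlap
    split_ifs
    · exact continuous_const
    · exact (hc _).min (hc _)
  rcases a with x | e <;> simp only [shrink]
  · refine (hc _).add (continuous_finsetSum _ fun e _ => continuous_finsetSum _ fun e' _ => ?_)
    split_ifs
    exacts [ho _ _, continuous_const]
  · exact (hc _).sub (continuous_finsetSum _ fun e' _ => ho _ _)

variable (S)

/-- The map of the realization to itself that `shrink` defines. -/
def shrinkMap : C(S.enlarge.Realization, S.enlarge.Realization) where
  toFun t := Realization.mk _ (shrink t.coord) (shrink_spec t).1 (by
    obtain ⟨-, -, s, hs, h, h'⟩ := shrink_spec t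
    exact ⟨s, hs, fun a ha => (h a ha).2, h'⟩)
  continuous_toFun := continuous_realization continuous_shrink

theorem coord_shrinkMap (t : S.enlarge.Realization) : (S.shrinkMap t).coord = shrink t.coord := rfl

/-- The retraction of the enlarged complex to `K`. -/
def retraction : C(S.enlarge.Realization, K.Space) where
  toFun t := Realization.mk _ (push (S.shrinkMap t).coord) (push_nonneg (shrink_spec t).1)
    (push_spec (S.shrinkMap t) (shrink_spec t).2.1).1
  continuous_toFun := by
    classical
    refine continuous_realization fun x => ?_
    simp only [Realization.coord_mk, push, coord_shrinkMap]
    refine (continuous_shrink _).add (Continuous.div_const (continuous_finsetSum _ fun e _ => ?_) _)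
    split_ifs
    exacts [continuous_shrink _, continuous_const]

theorem coord_retraction (t : S.enlarge.Realization) :
    (S.retraction t).coord = push (shrink t.coord) := rfl

theorem isDeformationRetraction_retraction :
    IsDeformationRetraction S.isInclusion_inl S.retraction := by
  classical
  have hinl : ∀ (t : K.Space) x, (inclusionMap S.isInclusion_inl t).coord (.inl x) = t.coord x :=
    fun t x => Sum.inl_injective.extend_apply t.coord 0 x
  have hinr : ∀ (t : K.Space) e, (inclusionMap S.isInclusion_inl t).coord (.inr e) = 0 :=
    fun t e => Function.extend_apply' _ _ _ (by simp)
  have hshrink : ∀ t : K.Space, shrink (inclusionMap S.isInclusion_inl t).coord =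
      (inclusionMap S.isInclusion_inl t).coord := fun t =>
    shrink_eq_self (Realization.coord_nonneg _) fun e _ _ => Or.inl (hinr t e)
  have h1 : ∀ t, S.retraction (inclusionMap S.isInclusion_inl t) = t := fun t =>
    Realization.ext fun x => by
      rw [coord_retraction, hshrink]
      simp [push, hinr, hinl]
  refine ⟨ContinuousMap.ext h1, ?_⟩
  have h2 : (ContinuousMap.id S.enlarge.Realization).HomotopicRel S.shrinkMap
      (Set.range (inclusionMap S.isInclusion_inl)) := by
    refine homotopicRel_of_common_face (fun t => ?_) ?_
    · obtain ⟨-, -, s, hs, h, -⟩ := shrink_spec t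
      exact ⟨s, hs, h⟩
    · rintro _ ⟨t, rfl⟩
      exact Realization.ext fun a => (congrFun (hshrink t) a).symm
  refine h2.trans (homotopicRel_of_common_face (fun t => ?_) ?_)
  · obtain ⟨-, s, hs, h, h'⟩ := push_spec (S.shrinkMap t) (shrink_spec t).2.1
    refine ⟨s, hs, fun a ha => ⟨h a ha, ?_⟩⟩
    rcases a with x | e
    · exact (hinl _ x).trans (h' x ha)
    · exact hinr _ e
  · rintro _ ⟨t, rfl⟩
    rw [ContinuousMap.comp_apply, h1]
    exact Realization.ext fun a => congrFun (hshrink t) a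

end HyperbolicTwoComplex.GeodesicSystem

/-! ### Iterating the construction -/

namespace AbstractSimplicialComplex

variable {V W X : Type*} {K : AbstractSimplicialComplex V} {L : AbstractSimplicialComplex W}
  {M : AbstractSimplicialComplex X}

theorem Adj.symm {u w : V} (h : K.Adj u w) : K.Adj w u := by
  obtain ⟨hne, s, hs, hu, hw⟩ := h
  exact ⟨hne.symm, s, hs, hw, hu⟩

theorem edgePath_symm {u w : V} (h : K.Adj u w) (t : I) :
    K.edgePath h.symm (σ t) = K.edgePath h t := by
  classical
  refine Realization.ext fun v => ?_
  rw [coord_edgePath, coord_edgePath, unitInterval.coe_symm_eq]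
  ring

theorem edgePath_congr {u w u' w' : V} (hu : u = u') (hw : w = w') (h : K.Adj u w)
    (h' : K.Adj u' w') {t t' : I} (ht : t = t') : K.edgePath h t = K.edgePath h' t' := by
  subst hu hw ht
  rfl

theorem IsInclusion.trans {i : V ↪ W} {i' : W ↪ X} (hi : IsInclusion K L i)
    (hi' : IsInclusion L M i') : IsInclusion K M (i.trans i') := fun s hs => by
  rw [← Finset.map_map]
  exact hi' _ (hi s hs)

theorem inclusionMap_trans {i : V ↪ W} {i' : W ↪ X} (hi : IsInclusion K L i)
    (hi' : IsInclusion L M i') (t : K.Realization) :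
    inclusionMap (hi.trans hi') t = inclusionMap hi' (inclusionMap hi t) := by
  refine Realization.ext fun x => ?_
  rw [coord_inclusionMap, coord_inclusionMap]
  by_cases hx : ∃ w, i' w = x
  · obtain ⟨w, rfl⟩ := hx
    rw [i'.injective.extend_apply, coord_inclusionMap]
    by_cases hw : ∃ v, i v = w
    · obtain ⟨v, rfl⟩ := hw
      rw [i.injective.extend_apply]
      exact (i.trans i').injective.extend_apply _ _ v
    · rw [Function.extend_apply' _ _ _ hw, Function.extend_apply']
      · rfl
      · rintro ⟨v, hv⟩
        exact hw ⟨v, i'.injective hv⟩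
  · rw [Function.extend_apply' _ _ _ hx, Function.extend_apply']
    rintro ⟨v, hv⟩
    exact hx ⟨_, hv⟩

theorem IsDeformationRetraction.trans {i : V ↪ W} {i' : W ↪ X} {hi : IsInclusion K L i}
    {hi' : IsInclusion L M i'} {r : C(L.Realization, K.Realization)}
    {r' : C(M.Realization, L.Realization)} (h : IsDeformationRetraction hi r)
    (h' : IsDeformationRetraction hi' r') :
    IsDeformationRetraction (hi.trans hi') (r.comp r') := by
  have e1 : ∀ t, r (inclusionMap hi t) = t := fun t => DFunLike.congr_fun h.1 t
  have e2 : ∀ t, r' (inclusionMap hi' t) = t := fun t => DFunLike.congr_fun h'.1 t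
  refine ⟨ContinuousMap.ext fun t => ?_, ?_⟩
  · rw [ContinuousMap.comp_apply, ContinuousMap.comp_apply, inclusionMap_trans hi hi', e2, e1,
      ContinuousMap.id_apply]
  · obtain ⟨F⟩ := h.2
    obtain ⟨F'⟩ := h'.2
    have h1 : (ContinuousMap.id M.Realization).HomotopicRel ((inclusionMap hi').comp r')
        (Set.range (inclusionMap (hi.trans hi'))) := by
      refine ⟨⟨F'.toHomotopy, fun s x hx => F'.prop' s x ?_⟩⟩
      obtain ⟨t, rfl⟩ := hx
      exact ⟨_, (inclusionMap_trans hi hi' t).symm⟩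
    refine h1.trans ⟨⟨{
      toFun := fun q => inclusionMap hi' (F (q.1, r' q.2))
      continuous_toFun := by fun_prop
      map_zero_left := fun x => by simp
      map_one_left := fun x => by simp [inclusionMap_trans hi hi'] }, ?_⟩⟩
    rintro s _ ⟨t, rfl⟩
    change inclusionMap hi' (F (s, r' (inclusionMap (hi.trans hi') t))) =
      inclusionMap hi' (r' (inclusionMap (hi.trans hi') t))
    rw [inclusionMap_trans hi hi', e2]
    exact congrArg _ (F.prop' s _ ⟨t, rfl⟩)

end AbstractSimplicialComplex

namespace HyperbolicTwoComplex.GeodesicSystem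

open AbstractSimplicialComplex

section

variable {V : Type*} {K : HyperbolicTwoComplex V} {k : ℝ} {J : Type*} {S : K.GeodesicSystem k J}

theorem lift_turn (j : J) : S.Turn ⟨S.edge j, j, rfl⟩ (S.vertex (S.next j))
    ⟨S.edge (S.next j), _, rfl⟩ := ⟨j, rfl, Or.inl ⟨rfl, rfl⟩⟩

variable [Finite J]

/-- The first half of a new edge is mapped to the second half of an old one. -/
theorem retraction_edgePath {e e' : S.Edge} {u v : V} (h : S.Turn e v e') (he : e.1 = s(u, v))
    (huv : K.Adj u v) (hadj : S.enlarge.Adj (.inr e) (.inr e')) {s s' : I}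
    (hs : (s' : ℝ) = s + 1 / 2) :
    S.retraction (S.enlarge.edgePath hadj s) = K.edgePath huv s' := by
  classical
  have hs1 : (s : ℝ) ≤ 1 / 2 := by linarith [s'.2.2]
  obtain ⟨t, ht⟩ : ∃ t, t = S.enlarge.edgePath hadj s := ⟨_, rfl⟩
  have hc : ∀ a, t.coord a = (1 - (s : ℝ)) * (if a = .inr e then 1 else 0) +
      (s : ℝ) * (if a = .inr e' then 1 else 0) := fun a => by rw [ht, coord_edgePath]
  have h0 : ∀ f, f ≠ e → f ≠ e' → t.coord (.inr f) = 0 := fun f h1 h2 => by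
    rw [hc, if_neg (by simpa using h1), if_neg (by simpa using h2)]
    simp
  have c1 : t.coord (.inr e) = 1 - s := by rw [hc]; simp [h.ne]
  have c2 : t.coord (.inr e') = s := by rw [hc]; simp [h.ne.symm]
  have c3 : ∀ x, t.coord (.inl x) = 0 := fun x => by rw [hc]; simp
  have hm : min (t.coord (.inr e)) (t.coord (.inr e')) = s := by
    rw [c1, c2]
    exact min_eq_right (by linarith)
  have hm' : min (t.coord (.inr e')) (t.coord (.inr e)) = s := by rw [min_comm, hm]
  refine Realization.ext fun x => ?_
  rw [← ht, coord_retraction, coord_edgePath, hs, push, shrink_inl_of_turn h t.coord_nonneg h0,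
    c3, hm, Finset.sum_eq_single e, shrink_inr_of_turn h t.coord_nonneg h0, hm, c1, he]
  · have := huv.1
    simp only [Sym2.mem_iff]
    by_cases h1 : x = u
    · subst h1
      simp [this]
      ring
    · simp only [h1, false_or, if_false]
      split_ifs <;> ring
  · intro f _ hf
    by_cases h1 : f = e'
    · rw [h1, shrink_inr_of_turn h.symm t.coord_nonneg (fun f a b => h0 f b a), hm', c2, sub_self,
        ite_self]
    · rw [shrink_inr_of_turn_of_ne h t.coord_nonneg h0 hf h1, ite_self]
  · simp

variable (T : S.Thinness)

theorem retraction_lift_left (j : J) {s s' : I} (hs : (s' : ℝ) = s + 1 / 2) :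
    S.retraction ((S.complex T).edgePath ((lift T).adj j) s) = K.edgePath (S.adj j) s' :=
  retraction_edgePath (lift_turn j) rfl (S.adj j) _ hs

theorem retraction_lift_right (j : J) {s s' : I} (hs : (s' : ℝ) = s - 1 / 2) :
    S.retraction ((S.complex T).edgePath ((lift T).adj j) s) =
      K.edgePath (S.adj (S.next j)) s' := by
  have h1 := retraction_edgePath (lift_turn j).symm Sym2.eq_swap (S.adj (S.next j)).symm
    ((lift T).adj j).symm (s := σ s) (s' := σ s')
    (by rw [unitInterval.coe_symm_eq, unitInterval.coe_symm_eq, hs]; ring)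
  rw [edgePath_symm (S.adj (S.next j))] at h1
  rw [← h1]
  exact congrArg _ (edgePath_symm ((lift T).adj j) s).symm

end

section

variable {V : Type*} {K : HyperbolicTwoComplex V} {k : ℝ} {J : Type*} (S : K.GeodesicSystem k J)

/-- The vertices that the geodesic with the edge `i` runs through, starting from this edge. -/
def seq (i : J) (z : ℤ) : V := S.vertex ((S.next ^ z) i)

theorem next_zpow (i : J) (z : ℤ) : S.next ((S.next ^ z) i) = (S.next ^ (z + 1)) i := by
  rw [add_comm, zpow_one_add, Equiv.Perm.mul_apply]

theorem seq_next (i : J) (z : ℤ) : S.seq (S.next i) z = S.seq i (z + 1) := by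
  unfold seq
  rw [zpow_add_one, Equiv.Perm.mul_apply]

theorem seq_adj (i : J) (z : ℤ) : K.Adj (S.seq i z) (S.seq i (z + 1)) := by
  have := S.adj ((S.next ^ z) i)
  rwa [next_zpow] at this

theorem seq_ne (i : J) (z : ℤ) : S.seq i z ≠ S.seq i (z + 2) := by
  have := S.vertex_ne ((S.next ^ z) i)
  rwa [next_zpow, next_zpow, add_assoc] at this

/-- Different geodesics, and a geodesic and its translates along itself, never run together along
`N` consecutive vertices, in the same or in opposite directions. -/
def IsSeparated (N : ℕ) : Prop :=
  (∀ i j, (∀ t : ℕ, t < N → S.seq i t = S.seq j t) → i = j) ∧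
    ∀ i j, ¬ ∀ t : ℕ, t < N → S.seq i t = S.seq j (-t)

/-- Two walks without backtracking through the same edges agree: from the second edge on, the
directions of the edges are determined. -/
theorem eq_of_sym2_eq {a b : ℕ → V} (hb : ∀ t, b t ≠ b (t + 1)) (hb' : ∀ t, b t ≠ b (t + 2))
    {N : ℕ} (hN : 2 ≤ N) (h : ∀ t < N, s(a t, a (t + 1)) = s(b t, b (t + 1))) :
    ∀ t < N + 1, a t = b t := by
  have hdir : ∀ t < N, a t = b t ∧ a (t + 1) = b (t + 1) := by
    intro t ht
    rcases Sym2.eq_iff.1 (h t ht) with h1 | h1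
    · exact h1
    exfalso
    by_cases ht' : t + 1 < N
    · rcases Sym2.eq_iff.1 (h (t + 1) ht') with h2 | h2
      · exact hb t (h1.2.symm.trans h2.1)
      · exact hb' t (h1.2.symm.trans h2.1)
    · obtain ⟨s, rfl⟩ : ∃ s, t = s + 1 := ⟨t - 1, by omega⟩
      rcases Sym2.eq_iff.1 (h s (by omega)) with h2 | h2
      · exact hb (s + 1) (h2.2.symm.trans h1.1)
      · exact hb' s (h2.2.symm.trans h1.1)
  intro t ht
  rcases Nat.lt_succ_iff_lt_or_eq.1 ht with h | rfl
  · exact (hdir t h).1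
  · obtain ⟨s, rfl⟩ : ∃ s, t = s + 1 := ⟨t - 1, by omega⟩
    exact (hdir s (by omega)).2

variable {S}

theorem IsSeparated.lift [Finite J] (T : S.Thinness) {N : ℕ} (hN : 2 ≤ N)
    (h : S.IsSeparated (N + 1)) : (lift T).IsSeparated N := by
  have hseq : ∀ i j z z', (GeodesicSystem.lift T).seq i z = (GeodesicSystem.lift T).seq j z' →
      s(S.seq i z, S.seq i (z + 1)) = s(S.seq j z', S.seq j (z' + 1)) := by
    intro i j z z' h
    have := congrArg Subtype.val (Sum.inr_injective h)
    change S.edge ((S.next ^ z) i) = S.edge ((S.next ^ z') j) at this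
    unfold edge at this
    rwa [next_zpow, next_zpow] at this
  refine ⟨fun i j hij => h.1 i j ?_, fun i j hij => h.2 i (S.next j) ?_⟩
  · refine eq_of_sym2_eq (a := fun t : ℕ => S.seq i t) (b := fun t : ℕ => S.seq j t)
      (fun t => ?_) (fun t => ?_) hN fun t ht => ?_
    · exact_mod_cast (S.seq_adj j t).1
    · exact_mod_cast S.seq_ne j t
    · exact_mod_cast hseq _ _ _ _ (hij t ht)
  · refine eq_of_sym2_eq (a := fun t : ℕ => S.seq i t) (b := fun t : ℕ => S.seq (S.next j) (-t))
      (fun t => ?_) (fun t => ?_) hN fun t ht => ?_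
    · have := (S.seq_adj (S.next j) (-(t + 1 : ℕ))).1.symm
      rwa [show -((t + 1 : ℕ) : ℤ) + 1 = -t by push_cast; ring] at this
    · have := (S.seq_ne (S.next j) (-(t + 2 : ℕ))).symm
      rwa [show -((t + 2 : ℕ) : ℤ) + 2 = -t by push_cast; ring] at this
    · have h1 := hseq _ _ _ _ (hij t ht)
      rw [Sym2.eq_swap (a := S.seq j _)] at h1
      simp only [seq_next]
      rw [show -((t + 1 : ℕ) : ℤ) + 1 = -t by push_cast; ring]
      exact_mod_cast h1

variable (S)

theorem pi_le_of_eq {j : J} {a b c : V} (ha : a = S.vertex j) (hb : b = S.vertex (S.next j))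
    (hc : c = S.vertex (S.next (S.next j))) (W : (K.link b).Walk a c) :
    Real.pi ≤ K.linkLength k b W := by
  subst ha hb hc
  exact S.pi_le j W

/-- The same geodesics, with the numbering of the edges shifted by one. -/
def shift : K.GeodesicSystem k J where
  next := S.next
  vertex j := S.vertex (S.next.symm j)
  adj j := by simpa using S.adj (S.next.symm j)
  pi_le j W := S.pi_le_of_eq (j := S.next.symm j) rfl (by simp) (by simp) W

variable {S}

theorem IsSeparated.shift {N : ℕ} (h : S.IsSeparated N) : S.shift.IsSeparated N := by
  have hseq : ∀ i z, S.shift.seq i z = S.seq (S.next.symm i) z := fun i z => by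
    change S.vertex (S.next.symm ((S.next ^ z) i)) = S.vertex ((S.next ^ z) (S.next.symm i))
    change S.vertex ((S.next⁻¹ * S.next ^ z) i) = S.vertex ((S.next ^ z * S.next⁻¹) i)
    rw [(Commute.refl S.next).inv_left.zpow_right z |>.eq]
  simp only [IsSeparated, hseq]
  exact ⟨fun i j hij => S.next.symm.injective (h.1 _ _ hij), fun i j => h.2 _ _⟩

end

/-- Iterated enlargement. Two steps at a time, so that the retraction maps the new edge `j` to the
old edge `j` linearly, rather than to halves of two consecutive edges. -/
theorem exists_separated {J : Type*} [Finite J] {k : ℝ} (n : ℕ) {V : Type u}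
    {K : HyperbolicTwoComplex V} (hK : K.IsNegativelyCurved k) (S : K.GeodesicSystem k J) :
    ∃ (W : Type u) (L : HyperbolicTwoComplex W) (S' : L.GeodesicSystem k J) (i : V ↪ W)
      (hi : IsInclusion K.toAbstractSimplicialComplex L.toAbstractSimplicialComplex i)
      (r : C(L.Space, K.Space)), L.IsNegativelyCurved k ∧ IsDeformationRetraction hi r ∧
      S'.next = S.next ∧
      (∀ j j' (_ : j' = S.next j) (h : L.Adj (S'.vertex j) (S'.vertex j'))
        (h' : K.Adj (S.vertex j) (S.vertex j')) t, r (L.edgePath h t) = K.edgePath h' t) ∧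
      ∀ N, 2 ≤ N → S.IsSeparated (N + 2 * n) → S'.IsSeparated N := by
  induction n generalizing V with
  | zero =>
    refine ⟨V, K, S, .refl V, fun s hs => by simpa using hs, .id _, hK, ⟨?_, ?_⟩, rfl,
      fun _ _ _ _ _ _ => rfl, fun N _ h => h⟩
    · refine ContinuousMap.ext fun t => Realization.ext fun v => ?_
      exact (Function.Embedding.refl V).injective.extend_apply t.coord 0 v
    · refine homotopicRel_of_common_face (fun t => ?_) fun t _ => ?_
      · obtain ⟨s, hs, h, -⟩ := K.exists_face_pos t
        refine ⟨s, hs, fun v hv => ⟨h v hv, ?_⟩⟩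
        exact ((Function.Embedding.refl V).injective.extend_apply t.coord 0 v).trans (h v hv)
      · exact Realization.ext fun v =>
          ((Function.Embedding.refl V).injective.extend_apply t.coord 0 v).symm
  | succ n ih =>
    obtain ⟨T⟩ := nonempty_thinness S hK.1
    have hK1 := isNegativelyCurved_complex T hK
    obtain ⟨T'⟩ := nonempty_thinness (lift T) hK1.1
    have hK2 := isNegativelyCurved_complex T' hK1
    obtain ⟨W, L, S', i, hi, r, hL, hr, hnext, hedge, hsep⟩ := ih hK2 (lift T').shift
    refine ⟨W, L, S', _, _, _, hL, (S.isDeformationRetraction_retraction.trans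
      (lift T).isDeformationRetraction_retraction).trans hr, hnext, ?_, ?_⟩
    · rintro j j' rfl h h' t
      have h1 := hedge j _ rfl h ((lift T').shift.adj j) t
      refine (congrArg (fun x => S.retraction ((lift T).retraction x)) h1).trans ?_
      obtain ⟨i, rfl⟩ := S.next.surjective j
      have e1 : (complex T').edgePath ((lift T').shift.adj (S.next i)) t =
          (complex T').edgePath ((lift T').adj i) t := by
        refine edgePath_congr ?_ ?_ _ _ rfl
        · exact congrArg (lift T').vertex (S.next.symm_apply_apply i)
        · exact congrArg (lift T').vertex (S.next.symm_apply_apply (S.next i))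
      have e2 : S.retraction ((lift T).retraction ((complex T').edgePath ((lift T').adj i) t)) =
          K.edgePath (S.adj (S.next i)) t := by
        rcases le_total (t : ℝ) (1 / 2) with ht | ht
        · obtain ⟨s, hs⟩ : ∃ s : I, (s : ℝ) = t + 1 / 2 :=
            ⟨⟨t + 1 / 2, by linarith [t.2.1], by linarith⟩, rfl⟩
          rw [retraction_lift_left T' i hs]
          exact retraction_lift_right T i (by linarith)
        · obtain ⟨s, hs⟩ : ∃ s : I, (s : ℝ) = t - 1 / 2 :=
            ⟨⟨t - 1 / 2, by linarith, by linarith [t.2.2]⟩, rfl⟩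
          rw [retraction_lift_right T' i hs]
          exact retraction_lift_left T (S.next i) (by linarith)
      exact (congrArg (fun x => S.retraction ((lift T).retraction x)) e1).trans e2
    · intro N hN h
      refine hsep N hN (IsSeparated.shift (IsSeparated.lift T' (by omega)
        (IsSeparated.lift T (by omega) ?_)))
      rwa [show N + 2 * n + 1 + 1 = N + 2 * (n + 1) by ring]

end HyperbolicTwoComplex.GeodesicSystem

/-! ### Edge paths in the fundamental group -/

namespace AbstractSimplicialComplex

open CategoryTheory

variable {V : Type*} (K : AbstractSimplicialComplex V)

/-- The class of an edge in the fundamental groupoid. -/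
def edgeHom {u w : V} (h : K.Adj u w) :
    FundamentalGroupoid.mk (K.vertexPoint u) ⟶ FundamentalGroupoid.mk (K.vertexPoint w) :=
  Path.Homotopic.Quotient.mk (K.edgePath h)

theorem edgeHom_symm {u w : V} (h : K.Adj u w) : K.edgeHom h.symm = Groupoid.inv (K.edgeHom h) := by
  have : K.edgePath h.symm = (K.edgePath h).symm := Path.ext <| funext fun t => by
    have := edgePath_symm h (σ t)
    rwa [unitInterval.symm_symm] at this
  unfold edgeHom
  rw [this]
  rfl

/-- The class of an edge path in the fundamental groupoid. -/
def pathHom {f : ℕ → V} (hf : ∀ j, K.Adj (f j) (f (j + 1))) (n : ℕ) :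
    FundamentalGroupoid.mk (K.vertexPoint (f 0)) ⟶ FundamentalGroupoid.mk (K.vertexPoint (f n)) :=
  Path.Homotopic.Quotient.mk (K.pathAlong f hf n)

theorem pathHom_zero {f : ℕ → V} (hf : ∀ j, K.Adj (f j) (f (j + 1))) :
    K.pathHom hf 0 = 𝟙 _ := rfl

theorem pathHom_succ {f : ℕ → V} (hf : ∀ j, K.Adj (f j) (f (j + 1))) (n : ℕ) :
    K.pathHom hf (n + 1) = K.pathHom hf n ≫ K.edgeHom (hf n) := rfl

variable (x₀ : K.Realization)

/-- A class of paths from the base point to a vertex in its component. -/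
def spoke (w : V) (h : Nonempty (Path x₀ (K.vertexPoint w))) :
    FundamentalGroupoid.mk x₀ ⟶ FundamentalGroupoid.mk (K.vertexPoint w) :=
  Path.Homotopic.Quotient.mk h.some

theorem nonempty_path_of_adj {u w : V} (h : K.Adj u w)
    (hu : Nonempty (Path x₀ (K.vertexPoint u))) : Nonempty (Path x₀ (K.vertexPoint w)) :=
  hu.map fun p => p.trans (K.edgePath h)

open Classical in
/-- The element of the fundamental group that an edge represents, once its endpoints are joined to
the base point by chosen paths. -/
def edgeElement (u w : V) : FundamentalGroup K.Realization x₀ :=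
  if h : K.Adj u w ∧ Nonempty (Path x₀ (K.vertexPoint u)) then
    K.spoke x₀ u h.2 ≫ K.edgeHom h.1 ≫
      Groupoid.inv (K.spoke x₀ w (K.nonempty_path_of_adj x₀ h.1 h.2))
  else 1

theorem edgeElement_mul (u w : V) : K.edgeElement x₀ u w * K.edgeElement x₀ w u = 1 := by
  have key : ∀ {u w : V}, K.Adj u w ∧ Nonempty (Path x₀ (K.vertexPoint u)) →
      K.Adj w u ∧ Nonempty (Path x₀ (K.vertexPoint w)) :=
    fun h => ⟨h.1.symm, K.nonempty_path_of_adj x₀ h.1 h.2⟩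
  by_cases h : K.Adj u w ∧ Nonempty (Path x₀ (K.vertexPoint u))
  · rw [edgeElement, edgeElement, dif_pos h, dif_pos (key h), K.edgeHom_symm h.1]
    rw [End.mul_def, End.one_def]
    simp
  · rw [edgeElement, edgeElement, dif_neg h, dif_neg fun h' => h (key h'), one_mul]

end AbstractSimplicialComplex

/-- The product of the values of a function of edges along a part of a bi-infinite sequence of
vertices; the factors are ordered as in the composition of maps. -/
def edgeProduct {V G : Type*} [Group G] (E : V → V → G) (f : ℤ → V) (z : ℤ) : ℕ → G
  | 0 => 1
  | n + 1 => E (f (z + n)) (f (z + n + 1)) * edgeProduct E f z n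

namespace AbstractSimplicialComplex

open CategoryTheory

variable {V : Type*} (K : AbstractSimplicialComplex V) (x₀ : K.Realization)

theorem spoke_comp_pathHom {f : ℤ → V} (hf : ∀ j, K.Adj (f j) (f (j + 1)))
    (h0 : Nonempty (Path x₀ (K.vertexPoint (f 0)))) (n : ℕ) :
    ∃ hn, K.spoke x₀ (f 0) h0 ≫
      K.pathHom (f := fun j : ℕ => f j) (fun j => by exact_mod_cast hf j) n ≫
      Groupoid.inv (K.spoke x₀ (f n) hn) = edgeProduct (K.edgeElement x₀) f 0 n := by
  induction n with
  | zero =>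
    refine ⟨h0, ?_⟩
    rw [pathHom_zero]
    simp [edgeProduct, End.one_def]
  | succ n ih =>
    obtain ⟨hn, ih⟩ := ih
    have hadj : K.Adj (f n) (f (n + 1 : ℕ)) := by exact_mod_cast hf n
    refine ⟨K.nonempty_path_of_adj x₀ hadj hn, ?_⟩
    rw [edgeProduct, End.mul_def, ← ih, pathHom_succ, zero_add, edgeElement,
      dif_pos ⟨by exact_mod_cast hadj, hn⟩]
    simp

/-- A loop at the base point that consists of a path, a closed edge path, and the path backwards, in
terms of the elements of the edges. -/
theorem exists_fromPath_eq_conj {f : ℤ → V} (hf : ∀ j, K.Adj (f j) (f (j + 1)))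
    {y : K.Realization} (hy : y = K.vertexPoint (f 0)) (p : Path x₀ y) :
    ∃ g, ∀ (n : ℕ) (_ : f n = f 0) (L : Path y y),
      (∀ t, L t = K.pathAlong (fun j : ℕ => f j) (fun j => by exact_mod_cast hf j) n t) →
      FundamentalGroup.fromPath (Path.Homotopic.Quotient.mk ((p.trans L).trans p.symm)) =
        g * edgeProduct (K.edgeElement x₀) f 0 n * g⁻¹ := by
  subst hy
  have h0 : Nonempty (Path x₀ (K.vertexPoint (f 0))) := ⟨p⟩
  let P : FundamentalGroupoid.mk x₀ ⟶ FundamentalGroupoid.mk (K.vertexPoint (f 0)) :=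
    Path.Homotopic.Quotient.mk p
  refine ⟨K.spoke x₀ (f 0) h0 ≫ Groupoid.inv P, fun n hn L hL => ?_⟩
  obtain ⟨hn', h⟩ := K.spoke_comp_pathHom x₀ hf h0 n
  have key : ∀ (w : V) (_ : w = f 0) (q : Path (K.vertexPoint (f 0)) (K.vertexPoint w))
      (hw : Nonempty (Path x₀ (K.vertexPoint w))), (∀ t, L t = q t) →
      (K.spoke x₀ (f 0) h0 ≫ Path.Homotopic.Quotient.mk q ≫ Groupoid.inv (K.spoke x₀ w hw) :
        FundamentalGroupoid.mk x₀ ⟶ FundamentalGroupoid.mk x₀) =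
      K.spoke x₀ (f 0) h0 ≫ Path.Homotopic.Quotient.mk L ≫ Groupoid.inv (K.spoke x₀ (f 0) h0) := by
    rintro _ rfl q hw hq
    rw [show L = q from Path.ext (funext hq)]
  have h' := h.symm.trans (key _ hn _ hn' hL)
  rw [h']
  have e : FundamentalGroup.fromPath (Path.Homotopic.Quotient.mk ((p.trans L).trans p.symm)) =
      (P ≫ (Path.Homotopic.Quotient.mk L : FundamentalGroupoid.mk (K.vertexPoint (f 0)) ⟶
        FundamentalGroupoid.mk (K.vertexPoint (f 0)))) ≫ Groupoid.inv P := rfl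
  have aux : ∀ {C : Type _} [Groupoid C] {A B : C} (s P : A ⟶ B) (L : B ⟶ B),
      (s ≫ Groupoid.inv P) ≫ ((P ≫ L) ≫ Groupoid.inv P) =
        (s ≫ L ≫ Groupoid.inv s) ≫ s ≫ Groupoid.inv P := by
    intro C _ A B s P L
    simp
  rw [e, eq_mul_inv_iff_mul_eq]
  exact aux (K.spoke x₀ (f 0) h0) P (Path.Homotopic.Quotient.mk L)

end AbstractSimplicialComplex

/-! ### Malnormality forces closed geodesics apart -/

section EdgeProduct

variable {V G : Type*} [Group G] {E : V → V → G} {f : ℤ → V}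

theorem edgeProduct_congr {f g : ℤ → V} {z y : ℤ} (h : ∀ t : ℤ, f (z + t) = g (y + t)) (n : ℕ) :
    edgeProduct E f z n = edgeProduct E g y n := by
  induction n with
  | zero => rfl
  | succ n ih => rw [edgeProduct, edgeProduct, ih, h, add_assoc, add_assoc, h]

theorem edgeProduct_add (z : ℤ) (m n : ℕ) :
    edgeProduct E f z (m + n) = edgeProduct E f (z + m) n * edgeProduct E f z m := by
  induction n with
  | zero => simp [edgeProduct]
  | succ n ih =>
    rw [← add_assoc, edgeProduct, edgeProduct, ih, mul_assoc]
    push_cast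
    simp only [add_assoc]

theorem edgeProduct_mul {d : ℕ} (hf : ∀ z, f (z + d) = f z) (z : ℤ) (n : ℕ) :
    edgeProduct E f z (d * n) = edgeProduct E f z d ^ n := by
  induction n with
  | zero => simp [edgeProduct]
  | succ n ih =>
    rw [mul_add, mul_one, add_comm, edgeProduct_add, pow_succ, ← ih]
    congr 1
    exact edgeProduct_congr (fun t => by rw [add_right_comm, hf]) _

/-- Backwards, the product is the inverse one. -/
theorem edgeProduct_neg (hE : ∀ u w, E u w * E w u = 1) (z : ℤ) (n : ℕ) :
    edgeProduct E (fun t => f (-t)) z n = (edgeProduct E f (-z - n) n)⁻¹ := by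
  induction n with
  | zero => simp [edgeProduct]
  | succ n ih =>
    rw [edgeProduct, ih, add_comm n 1, edgeProduct_add, mul_inv_rev, edgeProduct, edgeProduct]
    have h1 : -z - ((1 + n : ℕ) : ℤ) + ((0 : ℕ) : ℤ) = -(z + n + 1) := by push_cast; ring
    have h2 : -(z + (n : ℤ) + 1) + 1 = -(z + n) := by ring
    have h3 : -z - ((1 + n : ℕ) : ℤ) + ((1 : ℕ) : ℤ) = -z - n := by push_cast; ring
    rw [h1, h2, h3, mul_one, eq_inv_of_mul_eq_one_left (hE (f (-(z + n))) (f (-(z + n + 1))))]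

theorem isConj_edgeProduct {n : ℕ} (hf : ∀ z, f (z + n) = f z) (c : ℕ) :
    IsConj (edgeProduct E f 0 n) (edgeProduct E f c n) := by
  refine isConj_iff.2 ⟨edgeProduct E f 0 c, ?_⟩
  have h1 := edgeProduct_add (E := E) (f := f) 0 c n
  have h2 := edgeProduct_add (E := E) (f := f) 0 n c
  rw [add_comm n c, h1, edgeProduct_congr (E := E) (z := 0 + (n : ℤ)) (g := f) (y := 0) (fun t => by
    rw [add_right_comm, hf])] at h2
  rw [mul_inv_eq_iff_eq_mul, ← h2, zero_add]

end EdgeProduct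

theorem mem_map_conj_zpowers {G : Type*} [Group G] (h c : G) (r : ℤ) :
    c * h ^ r * c⁻¹ ∈ (Subgroup.zpowers h).map (MulAut.conj (c⁻¹)⁻¹).toMonoidHom :=
  ⟨h ^ r, ⟨r, rfl⟩, by simp⟩

namespace HyperbolicTwoComplex.GeodesicSystem

open AbstractSimplicialComplex

variable {V : Type*} {K : HyperbolicTwoComplex V} {k : ℝ} {J : Type*} (S : K.GeodesicSystem k J)

theorem seq_zpow (i : J) (d z : ℤ) : S.seq ((S.next ^ d) i) z = S.seq i (z + d) := by
  unfold seq
  rw [zpow_add, Equiv.Perm.mul_apply]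

/-- A closed geodesic never meets itself in the opposite direction: it would have to turn back
somewhere. -/
theorem not_seq_eq_seq_sub (i : J) (d : ℤ) : ¬ ∀ z, S.seq i z = S.seq i (d - z) := by
  intro h
  rcases Int.even_or_odd' d with ⟨u, rfl | rfl⟩
  · have := h (u - 1)
    rw [show 2 * u - (u - 1) = u - 1 + 2 by ring] at this
    exact S.seq_ne i _ this
  · have := h u
    rw [show 2 * u + 1 - u = u + 1 by ring] at this
    exact (S.seq_adj i u).1 this

/-- If the classes of the closed geodesics generate a malnormal family of cyclic groups, then
closed geodesics are determined by long enough parts. A common part of length `P`, a multiple of all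
periods, makes the geodesics agree altogether, so the corresponding powers of the conjugates of the
generators agree up to inversion. -/
theorem isSeparated_of_isMalnormalFamily {G : Type*} [Group G] {E : V → V → G}
    (hE : ∀ u w, E u w * E w u = 1) {ι : Type*} {h : ι → G} {a : J → ι} {n : ι → ℕ}
    {P : ℕ} (hP : 0 < P) (hnP : ∀ a, n a ∣ P)
    (hper : ∀ i z, S.seq i (z + n (a i)) = S.seq i z)
    (hconj : ∀ i, IsConj (h (a i)) (edgeProduct E (S.seq i) 0 (n (a i))))
    (horbit : ∀ i j, a i = a j → ∃ d : ℕ, d < n (a i) ∧ j = (S.next ^ (d : ℤ)) i)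
    (hne : ∀ i N, 0 < N → n (a i) ∣ N → edgeProduct E (S.seq i) 0 N ≠ 1)
    (hmal : IsMalnormalFamily fun a => Subgroup.zpowers (h a)) : S.IsSeparated P := by
  have hperP : ∀ i z, S.seq i (z + P) = S.seq i z := fun i => by
    obtain ⟨c, hc⟩ := hnP (a i)
    have h1 : Function.Periodic (S.seq i) (n (a i)) := hper i
    have := h1.nat_mul c
    rw [hc, Nat.cast_mul, mul_comm]
    exact this
  have hmod : ∀ i (z : ℤ), S.seq i (z % P) = S.seq i z := fun i z => by
    have h1 : Function.Periodic (S.seq i) P := hperP i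
    have := h1.int_mul (z / P) (z % P)
    rw [← this]
    congr 1
    rw [mul_comm]
    exact Int.emod_add_mul_ediv z P
  have hnat : ∀ z : ℤ, ∃ t : ℕ, t < P ∧ (t : ℤ) = z % P := fun z => by
    have h1 := Int.emod_nonneg z (by omega : (P : ℤ) ≠ 0)
    have h2 := Int.emod_lt_of_pos z (by omega : (0 : ℤ) < P)
    exact ⟨(z % P).toNat, by omega, by omega⟩
  have hpow : ∀ i, ∃ (c : G) (r : ℤ), edgeProduct E (S.seq i) 0 P = c * h (a i) ^ r * c⁻¹ := by
    intro i
    obtain ⟨r, hr⟩ := hnP (a i)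
    obtain ⟨c, hc⟩ := isConj_iff.1 (hconj i)
    refine ⟨c, r, ?_⟩
    rw [hr, edgeProduct_mul (hper i), ← hc, conj_pow, zpow_natCast]
  have hdiff : ∀ i j, a i ≠ a j → ∀ ε : ℤ,
      edgeProduct E (S.seq i) 0 P ≠ edgeProduct E (S.seq j) 0 P ^ ε := by
    intro i j hij ε heq
    obtain ⟨c, r, hc⟩ := hpow i
    obtain ⟨c', r', hc'⟩ := hpow j
    have h1 := mem_map_conj_zpowers (h (a i)) c r
    have h2 := mem_map_conj_zpowers (h (a j)) c' (r' * ε)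
    rw [zpow_mul, ← conj_zpow, ← hc', ← heq] at h2
    rw [← hc] at h1
    have h3 := hmal.2 (a i) (a j) hij c⁻¹ c'⁻¹
    exact hne i P hP (hnP _) ((Subgroup.mem_bot).1 (h3 ▸ Subgroup.mem_inf.2 ⟨h1, h2⟩))
  refine ⟨fun i j hij => ?_, fun i j hij => ?_⟩
  · have hall : ∀ z, S.seq i z = S.seq j z := fun z => by
      obtain ⟨t, ht, htz⟩ := hnat z
      rw [← hmod i, ← hmod j, ← htz, hij t ht]
    by_cases ha : a i = a j
    · obtain ⟨d, hd, rfl⟩ := horbit i j ha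
      rcases Nat.eq_zero_or_pos d with rfl | hd0
      · simp
      exfalso
      have hperd : ∀ z, S.seq i (z + d) = S.seq i z := fun z => by
        rw [hall z, seq_zpow]
      obtain ⟨c, hc⟩ := isConj_iff.1 (hconj i)
      -- the loop of length `d` is a root of a power of the class of the geodesic
      set y := c⁻¹ * edgeProduct E (S.seq i) 0 d * c with hy
      have hyn : y ^ n (a i) = h (a i) ^ d := by
        have h1 := edgeProduct_mul (E := E) hperd 0 (n (a i))
        rw [mul_comm, edgeProduct_mul (hper i), ← hc, conj_pow] at h1
        have h2 : y = c⁻¹ * edgeProduct E (S.seq i) 0 d * c⁻¹⁻¹ := by rw [hy, inv_inv]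
        rw [h2, conj_pow, ← h1]
        group
      have hinf : ∀ N : ℕ, 0 < N → h (a i) ^ N ≠ 1 := by
        intro N hN h1
        refine hne i (n (a i) * N) (Nat.mul_pos (by omega) hN) (dvd_mul_right _ _) ?_
        rw [edgeProduct_mul (hper i), ← hc, conj_pow, h1]
        group
      by_cases hyH : y ∈ Subgroup.zpowers (h (a i))
      · obtain ⟨e, he⟩ := hyH
        have h1 : h (a i) ^ (e * n (a i) - d) = 1 := by
          rw [zpow_sub, zpow_mul, zpow_natCast, zpow_natCast, ← hyn, ← he]
          group
        have h2 : e * n (a i) - d ≠ 0 := by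
          intro h2
          have h3 : (n (a i) : ℤ) ∣ d := ⟨e, by rw [mul_comm]; omega⟩
          have := Nat.le_of_dvd hd0 (Int.natCast_dvd_natCast.1 h3)
          omega
        refine hinf (e * n (a i) - d).natAbs (Int.natAbs_pos.2 h2) ?_
        rcases Int.natAbs_eq (e * n (a i) - d) with h3 | h3
        · rwa [h3, zpow_natCast] at h1
        · rwa [h3, zpow_neg, inv_eq_one, zpow_natCast] at h1
      · have h1 := hmal.1 (a i) y hyH
        have h2 : h (a i) ^ d ∈ (Subgroup.zpowers (h (a i))).map
            (MulAut.conj y⁻¹).toMonoidHom := by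
          refine ⟨h (a i) ^ d, ⟨d, zpow_natCast _ _⟩, ?_⟩
          rw [← hyn]
          simp
          group
        have h3 : h (a i) ^ d ∈ Subgroup.zpowers (h (a i)) := ⟨d, zpow_natCast _ _⟩
        exact hinf d hd0 ((Subgroup.mem_bot).1 (h1 ▸ Subgroup.mem_inf.2 ⟨h2, h3⟩))
    · exact absurd (by rw [zpow_one, show S.seq i = S.seq j from funext hall]) (hdiff i j ha 1)
  · have hall : ∀ z, S.seq i z = S.seq j (-z) := fun z => by
      obtain ⟨t, ht, htz⟩ := hnat z
      rw [← hmod i, ← htz, hij t ht, htz]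
      have := Int.emod_add_mul_ediv z P
      have h1 : Function.Periodic (S.seq j) P := hperP j
      rw [← h1.int_mul (-(z / P)) (-(z % P))]
      congr 1
      rw [Int.cast_id]
      linear_combination -this
    by_cases ha : a i = a j
    · -- a geodesic that agrees with a translate of its inverse has a reflection
      obtain ⟨d, hd, rfl⟩ := horbit i j ha
      refine S.not_seq_eq_seq_sub i d fun z => ?_
      rw [hall z, seq_zpow]
      congr 1
      ring
    · refine hdiff i j ha (-1) ?_
      rw [show S.seq i = fun z => S.seq j (-z) from funext hall, edgeProduct_neg hE, zpow_neg_one]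
      congr 1
      refine edgeProduct_congr (fun t => ?_) _
      rw [← hperP j]
      congr 1
      ring

end HyperbolicTwoComplex.GeodesicSystem

/-! ### Making closed geodesics transverse -/

namespace AbstractSimplicialComplex

variable {V W : Type*} {K : AbstractSimplicialComplex V} {L : AbstractSimplicialComplex W}

theorem map_pathAlong {r : L.Realization → K.Realization} {f' : ℕ → W} {f : ℕ → V}
    (hf' : ∀ j, L.Adj (f' j) (f' (j + 1))) (hf : ∀ j, K.Adj (f j) (f (j + 1)))
    (h : ∀ j t, r (L.edgePath (hf' j) t) = K.edgePath (hf j) t) (n : ℕ) (t : I) :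
    r (L.pathAlong f' hf' n t) = K.pathAlong f hf n t := by
  induction n generalizing t with
  | zero =>
    have h0 : r (L.vertexPoint (f' 0)) = K.vertexPoint (f 0) := by simpa using h 0 0
    exact h0
  | succ n ih =>
    simp only [pathAlong, Path.trans_apply]
    split_ifs
    · exact ih _
    · exact h n _

theorem pathAlong_congr {f g : ℕ → V} (hfg : f = g) (hf : ∀ j, K.Adj (f j) (f (j + 1)))
    (hg : ∀ j, K.Adj (g j) (g (j + 1))) (n : ℕ) (t : I) :
    K.pathAlong f hf n t = K.pathAlong g hg n t := by
  subst hfg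
  rfl

end AbstractSimplicialComplex

namespace HyperbolicTwoComplex

open AbstractSimplicialComplex

section

variable {V : Type*} {K : HyperbolicTwoComplex V} {k : ℝ}

/-- A closed geodesic represents a nontrivial element of the fundamental group. -/
theorem edgeProduct_ne_one (hK : K.IsNegativelyCurved k) {x₀ : K.Space} {f : ℤ → V}
    (hf : ∀ j, K.Adj (f j) (f (j + 1))) (p : Path x₀ (K.vertexPoint (f 0))) {N : ℕ} (hN : 0 < N)
    (hper : ∀ z, f (z + N) = f z)
    (hgeo : ∀ z (W : (K.link (f (z + 1))).Walk (f z) (f (z + 2))),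
      Real.pi ≤ K.linkLength k (f (z + 1)) W) :
    edgeProduct (K.edgeElement x₀) f 0 N ≠ 1 := by
  intro h
  have h0 : f N = f 0 := by simpa using hper 0
  obtain ⟨g, hg⟩ := K.exists_fromPath_eq_conj x₀ hf rfl p
  have hadj : ∀ j : ℕ, K.Adj (f j) (f (j + 1 : ℕ)) := fun j => by exact_mod_cast hf j
  have h1 := hg N h0 ((K.pathAlong (fun j : ℕ => f j) hadj N).cast rfl
    (congrArg K.vertexPoint h0.symm)) fun t => rfl
  rw [h, mul_one, mul_inv_cancel] at h1
  refine not_homotopic_refl_of_geodesic hK (f := fun j : ℕ => f j) hadj hN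
    (fun t => by exact_mod_cast hper t) (fun t W => ?_) h0 ?_
  · have key : ∀ {a b c : V}, a = f t → b = f (t + 1) → c = f (t + 2) →
        ∀ W : (K.link b).Walk a c, Real.pi ≤ K.linkLength k b W := by
      rintro _ _ _ rfl rfl rfl W
      exact hgeo t W
    exact key rfl (by push_cast; rfl) (by push_cast; rfl) W
  · have aux : ∀ {C : Type _} [CategoryTheory.Groupoid C] {A B : C} (P : A ⟶ B) (L : B ⟶ B),
        CategoryTheory.CategoryStruct.comp (CategoryTheory.CategoryStruct.comp P L)
          (CategoryTheory.Groupoid.inv P) = CategoryTheory.CategoryStruct.id A →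
        L = CategoryTheory.CategoryStruct.id B := by
      intro C _ A B P L h
      have := congrArg (fun x => CategoryTheory.CategoryStruct.comp
        (CategoryTheory.CategoryStruct.comp (CategoryTheory.Groupoid.inv P) x) P) h
      simpa using this
    have h2 := aux (C := FundamentalGroupoid K.Space) (A := ⟨x₀⟩) (B := ⟨K.vertexPoint (f 0)⟩)
      (Path.Homotopic.Quotient.mk p) (Path.Homotopic.Quotient.mk _) h1
    exact Path.Homotopic.Quotient.exact h2

namespace GeodesicSystem

theorem IsSeparated.mono {J : Type*} {S : K.GeodesicSystem k J} {N N' : ℕ} (h : S.IsSeparated N)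
    (hN : N ≤ N') : S.IsSeparated N' :=
  ⟨fun i j hij => h.1 i j fun t ht => hij t (ht.trans_le hN),
    fun i j hij => h.2 i j fun t ht => hij t (ht.trans_le hN)⟩

/-- Separation along two vertices, that is along one edge, means that no edge is run through
twice, in whichever direction. -/
theorem IsSeparated.edge_injective {J : Type*} {S : K.GeodesicSystem k J} (h : S.IsSeparated 2) :
    Function.Injective S.edge := by
  intro i j hij
  have h0 : ∀ i, S.seq i 0 = S.vertex i := fun i => rfl
  have h1 : ∀ i, S.seq i 1 = S.vertex (S.next i) := fun i => by
    unfold seq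
    rw [zpow_one]
  have h2 : S.seq (S.next j) (-1) = S.vertex j := by
    rw [seq_next]
    rfl
  rcases Sym2.eq_iff.1 hij with ⟨e1, e2⟩ | ⟨e1, e2⟩
  · refine h.1 i j fun t ht => ?_
    interval_cases t
    · exact e1
    · rw [Nat.cast_one, h1, h1, e2]
  · refine absurd (fun t ht => ?_) (h.2 i (S.next j))
    interval_cases t
    · exact e1
    · rw [Nat.cast_one, h1, h2, e2]

end GeodesicSystem

namespace ClosedPath

variable {m : ℕ} {γ : Fin m → K.ClosedPath}

instance (γ : K.ClosedPath) : NeZero γ.n := ⟨γ.n_pos.ne'⟩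

/-- A finite family of closed geodesics as a geodesic system. -/
def system (hγ : ∀ a, (γ a).IsGeodesic k) : K.GeodesicSystem k (Σ a, ZMod (γ a).n) where
  next := Equiv.Perm.sigmaCongrRightHom _ fun _ => Equiv.addRight 1
  vertex j := (γ j.1).vertex j.2
  adj j := (γ j.1).adj j.2
  pi_le := by
    rintro ⟨a, j⟩ W
    have key : ∀ {x} (_ : x = (γ a).vertex j)
        (W : (K.link ((γ a).vertex (j + 1))).Walk x ((γ a).vertex (j + 1 + 1))),
        Real.pi ≤ K.linkLength k ((γ a).vertex (j + 1)) W := by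
      intro x hx W
      have h := hγ a (j + 1)
      rw [add_sub_cancel_right, ← hx] at h
      have h1 := h.trans (iInf_le _ W)
      by_contra! h2
      exact absurd h1 (not_le.2 ((ENNReal.ofReal_lt_ofReal_iff Real.pi_pos).2 h2))
    exact key rfl W

theorem addRight_one_zpow {n : ℕ} (j : ZMod n) (z : ℤ) :
    (Equiv.addRight (1 : ZMod n) ^ z) j = j + z := by
  induction z using Int.induction_on with
  | zero => simp
  | succ z ih =>
    rw [add_comm, zpow_add, zpow_one, Equiv.Perm.mul_apply, ih]
    simp [add_assoc, add_comm]
  | pred z ih =>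
    rw [sub_eq_neg_add, zpow_add, zpow_neg_one, Equiv.Perm.mul_apply, ih, Equiv.Perm.inv_def,
      Equiv.addRight_symm]
    simp [add_assoc, add_comm]

theorem system_next_zpow (hγ : ∀ a, (γ a).IsGeodesic k) (a : Fin m) (j : ZMod (γ a).n) (z : ℤ) :
    ((system hγ).next ^ z) ⟨a, j⟩ = ⟨a, j + z⟩ := by
  change ((Equiv.Perm.sigmaCongrRightHom (fun a => ZMod (γ a).n) fun _ => Equiv.addRight 1) ^ z)
    ⟨a, j⟩ = _
  rw [← map_zpow]
  change (⟨a, ((Equiv.addRight (1 : ZMod (γ a).n)) ^ z) j⟩ : Σ a, ZMod (γ a).n) = _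
  rw [addRight_one_zpow]

theorem seq_system (hγ : ∀ a, (γ a).IsGeodesic k) (a : Fin m) (j : ZMod (γ a).n) (z : ℤ) :
    (system hγ).seq ⟨a, j⟩ z = (γ a).vertex (j + z) := by
  unfold GeodesicSystem.seq
  rw [system_next_zpow]
  rfl

theorem exists_isSeparated (hK : K.IsNegativelyCurved k) (hγ : ∀ a, (γ a).IsGeodesic k)
    {x₀ : K.Space} (p : ∀ a, Path x₀ (γ a).start)
    (hmal : IsMalnormalFamily fun a => (γ a).cyclicSubgroup (p a)) :
    ∃ N, (system hγ).IsSeparated N := by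
  let f : Fin m → ℤ → V := fun a z => (γ a).vertex z
  have hfadj : ∀ a z, K.Adj (f a z) (f a (z + 1)) := fun a z => by
    have := (γ a).adj z
    simp only [f, Int.cast_add, Int.cast_one]
    exact this
  have hfper : ∀ a (z : ℤ), f a (z + (γ a).n) = f a z := fun a z => by simp [f]
  have hseq : ∀ (a : Fin m) (j : ZMod (γ a).n) (z : ℤ),
      (system hγ).seq ⟨a, j⟩ z = f a (j.val + z) := fun a j z => by
    rw [seq_system]
    simp [f]
  have hf0 : ∀ a, (γ a).start = K.vertexPoint (f a 0) := fun a => by simp [f, start]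
  have hconj : ∀ a, ∃ g, FundamentalGroup.fromPath (Path.Homotopic.Quotient.mk
      (((p a).trans (γ a).loop).trans (p a).symm)) =
      g * edgeProduct (K.edgeElement x₀) (f a) 0 (γ a).n * g⁻¹ := by
    intro a
    obtain ⟨g, hg⟩ := K.exists_fromPath_eq_conj x₀ (hfadj a) (hf0 a) (p a)
    refine ⟨g, hg _ (by simpa using hfper a 0) _ fun t => ?_⟩
    exact pathAlong_congr (funext fun j => by simp [f]) _ _ _ t
  have hprod : ∀ (a : Fin m) (j : ZMod (γ a).n) N,
      edgeProduct (K.edgeElement x₀) ((system hγ).seq ⟨a, j⟩) 0 N =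
        edgeProduct (K.edgeElement x₀) (f a) j.val N := fun a j N =>
    edgeProduct_congr (fun t => by rw [hseq, zero_add]) N
  refine ⟨∏ a, (γ a).n, (system hγ).isSeparated_of_isMalnormalFamily (E := K.edgeElement x₀)
    (K.edgeElement_mul x₀) (a := Sigma.fst) (n := fun a => (γ a).n)
    (Finset.prod_pos fun a _ => (γ a).n_pos) (fun a => Finset.dvd_prod_of_mem _ (Finset.mem_univ a))
    ?_ ?_ ?_ ?_ hmal⟩
  · rintro ⟨a, j⟩ z
    rw [hseq, hseq, ← add_assoc, hfper]
  · rintro ⟨a, j⟩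
    obtain ⟨g, hg⟩ := hconj a
    rw [hprod]
    exact (isConj_iff.2 ⟨g, hg.symm⟩ : IsConj (edgeProduct (K.edgeElement x₀) (f a) 0 (γ a).n)
      _).symm.trans (isConj_edgeProduct (hfper a) j.val)
  · rintro ⟨a, j⟩ ⟨b, l⟩ (rfl : a = b)
    refine ⟨(l - j).val, ZMod.val_lt _, ?_⟩
    rw [system_next_zpow]
    simp
  · rintro ⟨a, j⟩ N hN ⟨c, hc⟩
    have hper : ∀ z, f a (z + N) = f a z := fun z => by simp [f, hc]
    have h1 := edgeProduct_ne_one hK (hfadj a) ((p a).cast rfl (hf0 a).symm) hN hper fun z W => by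
      refine (system hγ).pi_le_of_eq (j := ⟨a, (z : ZMod (γ a).n)⟩) rfl ?_ ?_ W
      · change (γ a).vertex _ = (γ a).vertex _
        push_cast
        rfl
      · change (γ a).vertex _ = (γ a).vertex (_ + 1 + 1)
        congr 1
        push_cast
        ring
    rw [hprod]
    intro h2
    have h3 := isConj_edgeProduct (E := K.edgeElement x₀) hper j.val
    rw [h2, isConj_one_left] at h3
    exact h1 h3

end ClosedPath

end

end HyperbolicTwoComplex

end

theorem lemma2p22 {V : Type u} (K : HyperbolicTwoComplex V) (k : ℝ)
    (hK : K.IsNegativelyCurved k) (m : ℕ) (γ : Fin m → K.ClosedPath)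
    (hγ : ∀ a, (γ a).IsGeodesic k)
    (x₀ : K.Space) (p : ∀ a, Path x₀ (γ a).start)
    (hmal : IsMalnormalFamily fun a => (γ a).cyclicSubgroup (p a)) :
    ∃ (W : Type u) (L : HyperbolicTwoComplex W) (k' : ℝ),
      L.IsNegativelyCurved k' ∧ k ≤ k' ∧ k' < 0 ∧
      ∃ (i : V ↪ W) (hi : AbstractSimplicialComplex.IsInclusion
          K.toAbstractSimplicialComplex L.toAbstractSimplicialComplex i)
        (r : C(L.Space, K.Space)),
        AbstractSimplicialComplex.IsDeformationRetraction hi r ∧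
        ∃ δ : Fin m → L.ClosedPath,
          (∀ a, (δ a).IsGeodesic k') ∧
          (∀ a, ∃ φ : I ≃o I, ∀ t, r ((δ a).loop t) = (γ a).loop (φ t)) ∧
          (∀ a, (δ a).IntersectsSelfTransversely) ∧
          (∀ a b, a ≠ b → (δ a).IntersectsTransversely (δ b)) := by
  obtain ⟨N, hN⟩ :=
    HyperbolicTwoComplex.ClosedPath.exists_isSeparated hK hγ p hmal
  obtain ⟨W, L, S, i, hi, r, hL, hr, hnext, hedge, hsep⟩ :=
    HyperbolicTwoComplex.GeodesicSystem.exists_separated N hK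
      (HyperbolicTwoComplex.ClosedPath.system hγ)
  have hS : S.IsSeparated 2 := hsep 2 le_rfl (hN.mono (by omega))
  have hnext' : ∀ a (j : ZMod (γ a).n), S.next ⟨a, j⟩ = ⟨a, j + 1⟩ := fun a j => by
    rw [hnext]
    rfl
  have hadj : ∀ a (j : ZMod (γ a).n), L.Adj (S.vertex ⟨a, j⟩) (S.vertex ⟨a, j + 1⟩) := fun a j => by
    rw [← hnext']
    exact S.adj _
  let δ : Fin m → L.ClosedPath := fun a =>
    ⟨(γ a).n, (γ a).n_pos, fun j => S.vertex ⟨a, j⟩, hadj a⟩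
  have hδ : ∀ a j, (δ a).edge j = S.edge ⟨a, j⟩ := fun a j => by
    unfold HyperbolicTwoComplex.GeodesicSystem.edge
    rw [hnext']
    rfl
  refine ⟨W, L, k, hL, le_rfl, hK.1, i, hi, r, hr, δ, fun a j => ?_,
    fun a => ⟨.refl I, fun t => ?_⟩, fun a j l hjl h => ?_, fun a b hab j l h => ?_⟩
  · refine le_iInf fun w => ENNReal.ofReal_le_ofReal ?_
    refine S.pi_le_of_eq (j := ⟨a, j - 1⟩) rfl ?_ ?_ w
    · rw [hnext', sub_add_cancel]
    · rw [hnext', hnext', sub_add_cancel]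
  · refine AbstractSimplicialComplex.map_pathAlong (r := r)
      (f' := fun j : ℕ => S.vertex ⟨a, (j : ZMod (γ a).n)⟩)
      (f := fun j : ℕ => (γ a).vertex (j : ZMod (γ a).n)) _ _ (fun j t => ?_) _ t
    refine hedge ⟨a, j⟩ ⟨a, (j + 1 : ℕ)⟩ ?_ _ _ t
    change _ = (⟨a, (j : ZMod (γ a).n) + 1⟩ : Σ a, ZMod (γ a).n)
    push_cast
    rfl
  · rw [hδ, hδ] at h
    have := hS.edge_injective h
    simp only [Sigma.mk.injEq, heq_eq_eq, true_and] at this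
    exact hjl this
  · rw [hδ, hδ] at h
    exact hab (congrArg Sigma.fst (hS.edge_injective h))
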